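/- Let $d\in\mathbb N$, $1\le p,q<\infty$, $s\in\mathbb R$, and let $p',q'\in(1,\infty]$ be the conjugate exponents. Fix a window $0\ne g\in\mathcal S(\mathbb R^d)$ and put $V_gf(x,\xi)=\int_{\mathbb R^d} f(y)\,\overline{g(y-x)}\,e^{-iy\cdot\xi}\,dy$ (in the sense of distributions) for $f\in\mathcal S'(\mathbb R^d)$, and $v_s(x,\xi)=(1+|x|^2+|\xi|^2)^{s/2}$. For $1\le p,q\le\infty$ and $s\in\mathbb R$ let $\mathcal M_s^{p,q}(\mathbb R^d)$ be the space of those $f\in\mathcal S'(\mathbb R^d)$ with $$\|f\|_{\mathcal M_s^{p,q}}=\Big(\int_{\mathbb R^d}\Big(\int_{\mathbb R^d}|V_gf(x,\xi)|^p\,v_s(x,\xi)^p\,dx\Big)^{q/p}d\xi\Big)^{1/q}<\infty$$ (with essential suprema if $p$ or $q$ is $\infty$). Let $A=-\Delta+|x|^2$ on $\mathbb R^d$, let $\phi_\alpha(x)=\prod_{i=1}^d(2^{\alpha_i}\alpha_i!\sqrt\pi)^{-1/2}H_{\alpha_i}(x_i)e^{-x_i^2/2}$, $\alpha\in\mathbb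 N_0^d$, be the $L^2$-normalised Hermite functions ($H_n$ being the physicists' Hermite polynomials), so that $A\phi_\alpha=\lambda_\alpha\phi_\alpha$ with $\lambda_\alpha=\sum_{i=1}^d(2\alpha_i+1)$, and let $F:\mathbb R\to\mathbb C$ be any function. By $F(A)$ on $\mathcal M_s^{p,q}(\mathbb R^d)$ we mean the bounded operator that satisfies $F(A)u=F(\lambda)u$ for every $u\in\mathcal M_s^{p,q}(\mathbb R^d)$ and $\lambda\in\mathbb R$ with $Au=\lambda u$ in $\mathcal S'(\mathbb R^d)$; in particular $F(A)\phi_\alpha=F(\lambda_\alpha)\phi_\alpha$ for all $\alpha$. For $0<r\le1$ a bounded operator $T$ on a Banach space $B$ is called $r$-nuclear if there are $x_n'\in B'$ and $y_n\in B$ with $\sum_n\|x_n'\|^r\|y_n\|^r<\infty$ and $Tx=\sum_n\langle x,x_n'\rangle y_n$ for all $x\in B$. A $1$-nuclear $T$ has the trace $\operatorname{Tr}T=\sum_n\langle y_n,x_n'\rangle$ if this value is the same for all representations of $T$ of that kind with $r=1$. (i) Let $0<r\le1$ and suppose that $$\sum_{\alpha\in\mathbb N_0^d}|F(\lambda_\alpha)|^r\,\|\phi_\alpha\|^r_{\mathcal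 M_s^{p,q}}\,\|\phi_\alpha\|^r_{\mathcal M_{-s}^{p',q'}}<\infty.\qquad(*)$$ Then there is exactly one bounded operator $F(A)$ on $\mathcal M_s^{p,q}(\mathbb R^d)$ as above, and it is $r$-nuclear. (ii) If $(*)$ holds with $r=1$, then the trace of $F(A)$ on $\mathcal M_s^{p,q}(\mathbb R^d)$ is well defined, the series $\sum_\alpha F(\lambda_\alpha)$ converges absolutely, and $$\operatorname{Tr}F(-\Delta+|x|^2)=\sum_{\alpha\in\mathbb N_0^d}F(\lambda_\alpha).$$ -/

import Mathlib

open scoped SchwartzMap ENNReal Topology ContDiff Nat InnerProductSpace Laplacian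
open MeasureTheory

noncomputable section

namespace HarmonicModulation

/-- The Euclidean space `ℝ^d`. -/
abbrev Rn (d : ℕ) : Type := EuclideanSpace ℝ (Fin d)

variable {d : ℕ}

/-! ### The short-time Fourier transform -/

/-- The unimodular exponential `y ↦ exp (-i y · ξ)`. -/
def expNeg (ξ y : Rn d) : ℂ := Complex.exp (-(Complex.I * ((⟪y, ξ⟫_ℝ : ℝ) : ℂ)))

theorem contDiff_expNeg (ξ : Rn d) : ContDiff ℝ ∞ (expNeg ξ) := by
  unfold expNeg
  refine Complex.contDiff_exp.comp (ContDiff.neg (contDiff_const.mul ?_))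
  exact Complex.ofRealCLM.contDiff.comp (contDiff_id.inner ℝ contDiff_const)

theorem norm_iteratedDeriv_exp_aux (n : ℕ) (t : ℝ) :
    ‖iteratedDeriv n (fun t : ℝ => Complex.exp (-(Complex.I * (t : ℂ)))) t‖ = 1 := by
  have h : ∀ n : ℕ, iteratedDeriv n (fun t : ℝ => Complex.exp (-(Complex.I * (t : ℂ)))) =
      fun t : ℝ => (-Complex.I) ^ n * Complex.exp (-(Complex.I * (t : ℂ))) := by
    intro n
    induction n with
    | zero => simp
    | succ n ih =>
      rw [iteratedDeriv_succ, ih]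
      funext t
      have h1 : HasDerivAt (fun t : ℝ => -(Complex.I * (t : ℂ))) (-Complex.I) t := by
        have h0 := ((Complex.ofRealCLM.hasDerivAt (x := t)).const_mul Complex.I).fun_neg
        simpa using h0
      have h2 := (h1.cexp.const_mul ((-Complex.I) ^ n)).deriv
      rw [h2]
      ring
  rw [h]
  have : (-(Complex.I * (t : ℂ))) = ((-t : ℝ) : ℂ) * Complex.I := by push_cast; ring
  simp only [norm_mul, norm_pow, norm_neg, Complex.norm_I, one_pow, one_mul]
  rw [this, Complex.norm_exp_ofReal_mul_I]

theorem norm_iteratedFDeriv_expNeg_le (ξ : Rn d) (n : ℕ) (y : Rn d) :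
    ‖iteratedFDeriv ℝ n (expNeg ξ) y‖ ≤ ‖ξ‖ ^ n := by
  have hc : ContDiff ℝ ∞ (fun t : ℝ => Complex.exp (-(Complex.I * (t : ℂ)))) :=
    Complex.contDiff_exp.comp (ContDiff.neg (contDiff_const.mul Complex.ofRealCLM.contDiff))
  have he : expNeg ξ = (fun t : ℝ => Complex.exp (-(Complex.I * (t : ℂ)))) ∘ (innerSL ℝ ξ) := by
    funext y
    simp [expNeg, real_inner_comm]
  rw [he, (innerSL ℝ ξ).iteratedFDeriv_comp_right hc y (i := n) (by exact_mod_cast le_top)]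
  refine (ContinuousMultilinearMap.norm_compContinuousLinearMap_le _ _).trans ?_
  rw [norm_iteratedFDeriv_eq_norm_iteratedDeriv, norm_iteratedDeriv_exp_aux]
  simp

theorem hasTemperateGrowth_expNeg (ξ : Rn d) : Function.HasTemperateGrowth (expNeg ξ) :=
  ⟨contDiff_expNeg ξ, fun n => ⟨0, ‖ξ‖ ^ n, fun y => by
    simpa using norm_iteratedFDeriv_expNeg_le ξ n y⟩⟩

/-- Pointwise complex conjugate of a Schwartz function. -/
def conjSchwartz (g : 𝓢(Rn d, ℂ)) : 𝓢(Rn d, ℂ) :=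
  SchwartzMap.postcompCLM (𝕜 := ℝ) (Complex.conjCLE : ℂ →L[ℝ] ℂ) g

/-- The test function `y ↦ exp (-i y · ξ) * conj (g (y - x))`. -/
def stftAtom (g : 𝓢(Rn d, ℂ)) (x ξ : Rn d) : 𝓢(Rn d, ℂ) :=
  SchwartzMap.smulLeftCLM ℂ (expNeg ξ) (SchwartzMap.compSubConstCLM ℂ x (conjSchwartz g))

theorem stftAtom_apply (g : 𝓢(Rn d, ℂ)) (x ξ y : Rn d) :
    stftAtom g x ξ y =
      Complex.exp (-(Complex.I * ((⟪y, ξ⟫_ℝ : ℝ) : ℂ))) * (starRingEnd ℂ) (g (y - x)) := by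
  rw [stftAtom, SchwartzMap.smulLeftCLM_apply_apply (hasTemperateGrowth_expNeg ξ)]
  simp [conjSchwartz, expNeg, SchwartzMap.postcompCLM_apply]

/-- The short-time Fourier transform of a tempered distribution `f` with window `g`:
`V_g f (x, ξ) = ∫ f(y) conj (g (y - x)) exp (-i y · ξ) dy` in the sense of distributions. -/
def stft (g : 𝓢(Rn d, ℂ)) (f : 𝓢'(Rn d, ℂ)) (x ξ : Rn d) : ℂ := f (stftAtom g x ξ)

theorem stftAtom_bound (g : 𝓢(Rn d, ℂ)) (K n : ℕ) (R : ℝ) :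
    ∃ C : ℝ, ∀ x ξ : Rn d, ‖x‖ ≤ R → ‖ξ‖ ≤ R → ∀ y : Rn d,
      ‖y‖ ^ K * ‖iteratedFDeriv ℝ n (stftAtom g x ξ) y‖ ≤ C := by
  set h := conjSchwartz g with hh
  set S := 2 ^ K * (Finset.Iic (K, n)).sup (fun m => SchwartzMap.seminorm ℂ m.1 m.2) h with hS
  have hS0 : 0 ≤ S := by positivity
  refine ⟨∑ i ∈ Finset.range (n + 1), (n.choose i : ℝ) * |R| ^ i * ((1 + |R|) ^ K * S), ?_⟩
  intro x ξ hx hξ y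
  have hx' : ‖x‖ ≤ |R| := hx.trans (le_abs_self R)
  have hξ' : ‖ξ‖ ≤ |R| := hξ.trans (le_abs_self R)
  have hfun : (stftAtom g x ξ : Rn d → ℂ) = fun y => expNeg ξ y * h (y - x) := by
    funext y
    rw [stftAtom, SchwartzMap.smulLeftCLM_apply_apply (hasTemperateGrowth_expNeg ξ)]
    simp [hh]
  have hsm : ContDiff ℝ ∞ (fun y => h (y - x)) :=
    (h.smooth ⊤).comp (contDiff_id.sub contDiff_const)
  have hle := norm_iteratedFDeriv_mul_le (contDiff_expNeg ξ) hsm y (n := n)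
    (by exact_mod_cast le_top)
  rw [hfun]
  calc ‖y‖ ^ K * ‖iteratedFDeriv ℝ n (fun y => expNeg ξ y * h (y - x)) y‖
      ≤ ‖y‖ ^ K * ∑ i ∈ Finset.range (n + 1), (n.choose i : ℝ) *
          ‖iteratedFDeriv ℝ i (expNeg ξ) y‖ *
          ‖iteratedFDeriv ℝ (n - i) (fun y => h (y - x)) y‖ := by gcongr
    _ = ∑ i ∈ Finset.range (n + 1), (n.choose i : ℝ) *
          ‖iteratedFDeriv ℝ i (expNeg ξ) y‖ *
          (‖y‖ ^ K * ‖iteratedFDeriv ℝ (n - i) (fun y => h (y - x)) y‖) := by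
        rw [Finset.mul_sum]
        exact Finset.sum_congr rfl fun i _ => by ring
    _ ≤ _ := by
        refine Finset.sum_le_sum fun i _ => ?_
        have h1 : ‖iteratedFDeriv ℝ i (expNeg ξ) y‖ ≤ |R| ^ i :=
          (norm_iteratedFDeriv_expNeg_le ξ i y).trans (by gcongr)
        have h2 : ‖y‖ ^ K * ‖iteratedFDeriv ℝ (n - i) (fun y => h (y - x)) y‖ ≤
            (1 + |R|) ^ K * S := by
          rw [iteratedFDeriv_comp_sub]
          have h3 := SchwartzMap.one_add_le_sup_seminorm_apply (𝕜 := ℂ) (m := (K, n))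
            (k := K) (n := n - i) le_rfl (Nat.sub_le n i) h (y - x)
          have h4 : ‖y‖ ≤ (1 + |R|) * (1 + ‖y - x‖) := by
            have : ‖y‖ ≤ ‖y - x‖ + ‖x‖ := by simpa using norm_add_le (y - x) x
            nlinarith [norm_nonneg (y - x), abs_nonneg R,
              mul_nonneg (abs_nonneg R) (norm_nonneg (y - x))]
          calc ‖y‖ ^ K * ‖iteratedFDeriv ℝ (n - i) (⇑h) (y - x)‖
              ≤ ((1 + |R|) * (1 + ‖y - x‖)) ^ K * ‖iteratedFDeriv ℝ (n - i) (⇑h) (y - x)‖ := by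
                gcongr
            _ = (1 + |R|) ^ K * ((1 + ‖y - x‖) ^ K * ‖iteratedFDeriv ℝ (n - i) (⇑h) (y - x)‖) := by
                rw [mul_pow]; ring
            _ ≤ _ := by gcongr
        gcongr

theorem continuous_iteratedFDeriv_stftAtom (g : 𝓢(Rn d, ℂ)) (n : ℕ) :
    Continuous (fun z : (Rn d × Rn d) × Rn d =>
      iteratedFDeriv ℝ n (stftAtom g z.1.1 z.1.2) z.2) := by
  set h := conjSchwartz g with hh
  let G : (Rn d × Rn d) × Rn d → ℂ := fun z =>
    Complex.exp (-(Complex.I * ((⟪z.2, z.1.2⟫_ℝ : ℝ) : ℂ))) * h (z.2 - z.1.1)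
  have hG : ContDiff ℝ ∞ G := by
    refine ContDiff.mul ?_ ((h.smooth ⊤).comp (contDiff_snd.sub (contDiff_fst.comp contDiff_fst)))
    refine Complex.contDiff_exp.comp (ContDiff.neg (contDiff_const.mul ?_))
    exact Complex.ofRealCLM.contDiff.comp
      (contDiff_snd.inner ℝ (contDiff_snd.comp contDiff_fst))
  let ι : Rn d →L[ℝ] (Rn d × Rn d) × Rn d := ContinuousLinearMap.inr ℝ _ _
  have key : ∀ z : (Rn d × Rn d) × Rn d,
      iteratedFDeriv ℝ n (stftAtom g z.1.1 z.1.2) z.2 =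
        (iteratedFDeriv ℝ n G z).compContinuousLinearMap (fun _ => ι) := by
    intro z
    have hfun : (stftAtom g z.1.1 z.1.2 : Rn d → ℂ) =
        (fun w => G (w + (z.1, 0))) ∘ ι := by
      funext y
      rw [stftAtom, SchwartzMap.smulLeftCLM_apply_apply (hasTemperateGrowth_expNeg _)]
      simp [G, ι, hh, expNeg]
    have hG' : ContDiff ℝ ∞ (fun w => G (w + (z.1, 0))) :=
      hG.comp (contDiff_id.add contDiff_const)
    rw [hfun, ι.iteratedFDeriv_comp_right hG' z.2 (i := n) (by exact_mod_cast le_top),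
      iteratedFDeriv_comp_add_right]
    congr 2
    simp [ι]
  simp_rw [key]
  exact (ContinuousMultilinearMap.compContinuousLinearMapL (fun _ : Fin n => ι)).continuous.comp
    (hG.continuous_iteratedFDeriv (by exact_mod_cast le_top))

theorem continuous_stftAtom (g : 𝓢(Rn d, ℂ)) :
    Continuous (fun z : Rn d × Rn d => stftAtom g z.1 z.2) := by
  rw [continuous_iff_continuousAt]
  intro z₀
  rw [ContinuousAt, (schwartz_withSeminorms ℂ (Rn d) ℂ).tendsto_nhds]
  rintro ⟨k, n⟩ ε hε
  obtain ⟨C, hC⟩ := stftAtom_bound g (k + 1) n (‖z₀‖ + 1)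
  have hC0 : 0 ≤ C := le_trans (by positivity)
    (hC z₀.1 z₀.2 ((norm_fst_le z₀).trans (by linarith)) ((norm_snd_le z₀).trans (by linarith)) 0)
  -- outside a large ball the decay is uniform, inside it joint continuity suffices
  set R : ℝ := 4 * C / ε + 1 with hR
  have hR0 : 0 < R := by positivity
  have hcont : Continuous (fun w : (Rn d × Rn d) × Rn d =>
      ‖w.2‖ ^ k * ‖iteratedFDeriv ℝ n (stftAtom g w.1.1 w.1.2) w.2 -
        iteratedFDeriv ℝ n (stftAtom g z₀.1 z₀.2) w.2‖) := by
    have h1 := continuous_iteratedFDeriv_stftAtom g n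
    have h2 := h1.comp (f := fun w : (Rn d × Rn d) × Rn d => (z₀, w.2)) (by fun_prop)
    exact (continuous_snd.norm.pow k).mul (h1.sub h2).norm
  have hin : ∀ᶠ z in 𝓝 z₀, ∀ y ∈ Metric.closedBall (0 : Rn d) R,
      ‖y‖ ^ k * ‖iteratedFDeriv ℝ n (stftAtom g z.1 z.2) y -
        iteratedFDeriv ℝ n (stftAtom g z₀.1 z₀.2) y‖ < ε / 2 := by
    refine (isCompact_closedBall (0 : Rn d) R).eventually_forall_of_forall_eventually ?_
    intro y _
    have := (hcont.tendsto (z₀, y)).eventually_lt_const (u := ε / 2) (by simpa using by positivity)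
    exact this
  have hball : ∀ᶠ z in 𝓝 z₀, ‖z‖ ≤ ‖z₀‖ + 1 := by
    have := (continuous_norm.tendsto z₀).eventually_lt_const (u := ‖z₀‖ + 1) (by linarith)
    exact this.mono fun z hz => hz.le
  filter_upwards [hin, hball] with z hz hzb
  refine lt_of_le_of_lt ?_ (half_lt_self hε)
  refine SchwartzMap.seminorm_le_bound ℂ k n _ (by positivity) fun y => ?_
  have hsub : iteratedFDeriv ℝ n (⇑(stftAtom g z.1 z.2 - stftAtom g z₀.1 z₀.2)) y =
      iteratedFDeriv ℝ n (stftAtom g z.1 z.2) y -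
        iteratedFDeriv ℝ n (stftAtom g z₀.1 z₀.2) y := by
    have h1 : ContDiff ℝ n (stftAtom g z.1 z.2) := (stftAtom g z.1 z.2).smooth n
    have h2 : ContDiff ℝ n (stftAtom g z₀.1 z₀.2) := (stftAtom g z₀.1 z₀.2).smooth n
    have h3 : (⇑(stftAtom g z.1 z.2 - stftAtom g z₀.1 z₀.2) : Rn d → ℂ) =
      ⇑(stftAtom g z.1 z.2) - ⇑(stftAtom g z₀.1 z₀.2) := by ext; simp
    rw [h3, iteratedFDeriv_sub_apply h1.contDiffAt h2.contDiffAt]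
  rw [hsub]
  by_cases hy : ‖y‖ ≤ R
  · exact (hz y (by simpa using hy)).le
  · push Not at hy
    have hy0 : 0 < ‖y‖ := hR0.trans hy
    have b1 := hC z.1 z.2 ((norm_fst_le z).trans hzb) ((norm_snd_le z).trans hzb) y
    have b2 := hC z₀.1 z₀.2 ((norm_fst_le z₀).trans (by linarith))
      ((norm_snd_le z₀).trans (by linarith)) y
    have b3 := norm_sub_le (iteratedFDeriv ℝ n (stftAtom g z.1 z.2) y)
        (iteratedFDeriv ℝ n (stftAtom g z₀.1 z₀.2) y)
    have b4 : ‖y‖ * (‖y‖ ^ k * ‖iteratedFDeriv ℝ n (stftAtom g z.1 z.2) y -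
        iteratedFDeriv ℝ n (stftAtom g z₀.1 z₀.2) y‖) ≤ 2 * C := by
      calc _ = ‖y‖ ^ (k + 1) * ‖iteratedFDeriv ℝ n (stftAtom g z.1 z.2) y -
        iteratedFDeriv ℝ n (stftAtom g z₀.1 z₀.2) y‖ := by ring
        _ ≤ ‖y‖ ^ (k + 1) * (‖iteratedFDeriv ℝ n (stftAtom g z.1 z.2) y‖ +
            ‖iteratedFDeriv ℝ n (stftAtom g z₀.1 z₀.2) y‖) := by gcongr
        _ ≤ 2 * C := by rw [mul_add]; linarith
    have b5 : 2 * C ≤ ‖y‖ * (ε / 2) := by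
      have : 4 * C / ε ≤ ‖y‖ := by linarith
      rw [div_le_iff₀ hε] at this
      linarith
    exact le_of_mul_le_mul_left (b4.trans b5) hy0

theorem continuous_stft (g : 𝓢(Rn d, ℂ)) (f : 𝓢'(Rn d, ℂ)) :
    Continuous (fun z : Rn d × Rn d => stft g f z.1 z.2) :=
  f.continuous.comp (continuous_stftAtom g)

/-! ### Modulation spaces -/

/-- The polynomial weight `v_s (x, ξ) = (1 + |x|² + |ξ|²)^{s/2}`. -/
def polyWeight (s : ℝ) (x ξ : Rn d) : ℝ := (1 + ‖x‖ ^ 2 + ‖ξ‖ ^ 2) ^ (s / 2)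

/-- The modulation norm
`(∫ (∫ |V_g f(x, ξ)|^p v_s(x, ξ)^p dx)^{q/p} dξ)^{1/q}` of a tempered distribution, with values
in `[0, ∞]` and with essential suprema in place of the integrals if `p = ∞` or `q = ∞`. -/
def modNorm (g : 𝓢(Rn d, ℂ)) (p q : ℝ≥0∞) (s : ℝ) (f : 𝓢'(Rn d, ℂ)) : ℝ≥0∞ :=
  eLpNorm (fun ξ : Rn d => eLpNorm (fun x : Rn d => polyWeight s x ξ • stft g f x ξ) p volume)
    q volume

theorem continuous_polyWeight (s : ℝ) :
    Continuous (fun z : Rn d × Rn d => polyWeight s z.1 z.2) := by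
  unfold polyWeight
  refine Continuous.rpow_const (by fun_prop) fun z => Or.inl ?_
  positivity

theorem continuous_weighted_stft (g : 𝓢(Rn d, ℂ)) (s : ℝ) (f : 𝓢'(Rn d, ℂ)) :
    Continuous (fun z : Rn d × Rn d => polyWeight s z.1 z.2 • stft g f z.1 z.2) :=
  (continuous_polyWeight s).smul (continuous_stft g f)

theorem eLpNorm_top_eq_iSup {h : Rn d → ℂ} (hh : Continuous h) :
    eLpNorm h ∞ volume = ⨆ x, ‖h x‖ₑ := by
  rw [eLpNorm_exponent_top]
  refine le_antisymm essSup_le_iSup (iSup_le fun x => ?_)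
  by_contra hlt
  push Not at hlt
  have hopen : IsOpen {y | eLpNormEssSup h volume < ‖h y‖ₑ} :=
    isOpen_lt continuous_const hh.enorm
  have hpos := hopen.measure_pos volume ⟨x, hlt⟩
  have hzero : volume {y | eLpNormEssSup h volume < ‖h y‖ₑ} = 0 := by
    have := ae_le_eLpNormEssSup (f := h) (μ := volume)
    rw [ae_iff] at this
    simpa using this
  exact hpos.ne' hzero

theorem measurable_eLpNorm_slice (g : 𝓢(Rn d, ℂ)) (p : ℝ≥0∞) (hp : 1 ≤ p) (s : ℝ)
    (f : 𝓢'(Rn d, ℂ)) :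
    Measurable (fun ξ : Rn d =>
      eLpNorm (fun x : Rn d => polyWeight s x ξ • stft g f x ξ) p volume) := by
  have hc := continuous_weighted_stft g s f
  rcases eq_or_ne p ∞ with rfl | hpt
  · have : ∀ ξ : Rn d, eLpNorm (fun x : Rn d => polyWeight s x ξ • stft g f x ξ) ∞ volume =
        ⨆ x, ‖polyWeight s x ξ • stft g f x ξ‖ₑ := fun ξ =>
      eLpNorm_top_eq_iSup (hc.comp (f := fun x : Rn d => (x, ξ)) (by fun_prop))
    simp_rw [this]
    refine LowerSemicontinuous.measurable (lowerSemicontinuous_iSup fun x => ?_)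
    exact ((hc.comp (f := fun ξ : Rn d => (x, ξ)) (by fun_prop)).enorm).lowerSemicontinuous
  · have hp0 : p ≠ 0 := (zero_lt_one.trans_le hp).ne'
    simp_rw [eLpNorm_eq_lintegral_rpow_enorm_toReal hp0 hpt]
    refine Measurable.pow_const ?_ _
    have : Measurable (fun z : Rn d × Rn d => ‖polyWeight s z.1 z.2 • stft g f z.1 z.2‖ₑ ^ p.toReal) :=
      (hc.measurable.enorm).pow_const _
    exact this.lintegral_prod_left'

theorem modNorm_zero (g : 𝓢(Rn d, ℂ)) (p q : ℝ≥0∞) (s : ℝ) : modNorm g p q s 0 = 0 := by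
  simp [modNorm, stft]

theorem modNorm_add_le (g : 𝓢(Rn d, ℂ)) {p q : ℝ≥0∞} (hp : 1 ≤ p) (hq : 1 ≤ q) (s : ℝ)
    (f₁ f₂ : 𝓢'(Rn d, ℂ)) :
    modNorm g p q s (f₁ + f₂) ≤ modNorm g p q s f₁ + modNorm g p q s f₂ := by
  have hslice : ∀ (f : 𝓢'(Rn d, ℂ)) (ξ : Rn d),
      AEStronglyMeasurable (fun x : Rn d => polyWeight s x ξ • stft g f x ξ) volume := fun f ξ =>
    ((continuous_weighted_stft g s f).comp
      (f := fun x : Rn d => (x, ξ)) (by fun_prop)).aestronglyMeasurable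
  have hm := fun f => (measurable_eLpNorm_slice g p hp s f).aestronglyMeasurable (μ := volume)
  refine le_trans ?_ (eLpNorm_add_le (hm f₁) (hm f₂) hq)
  refine eLpNorm_mono_enorm fun ξ => ?_
  simp only [enorm_eq_self, Pi.add_apply]
  refine le_trans (le_of_eq ?_) (eLpNorm_add_le (hslice f₁ ξ) (hslice f₂ ξ) hp)
  congr 1
  funext x
  simp [stft]

theorem modNorm_smul_le (g : 𝓢(Rn d, ℂ)) (p q : ℝ≥0∞) (s : ℝ) (c : ℂ) (f : 𝓢'(Rn d, ℂ)) :
    modNorm g p q s (c • f) ≤ ‖c‖ₑ * modNorm g p q s f := by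
  refine eLpNorm_le_nnreal_smul_eLpNorm_of_ae_le_mul' (c := ‖c‖₊) (ae_of_all _ fun ξ => ?_) q
  simp only [enorm_eq_self]
  refine eLpNorm_le_nnreal_smul_eLpNorm_of_ae_le_mul' (c := ‖c‖₊) (ae_of_all _ fun x => ?_) p
  have : polyWeight s x ξ • stft g (c • f) x ξ = c • (polyWeight s x ξ • stft g f x ξ) := by
    simp [stft, mul_left_comm]
  rw [this, enorm_smul]
  rfl

theorem modNorm_smul (g : 𝓢(Rn d, ℂ)) (p q : ℝ≥0∞) (s : ℝ) (c : ℂ) (f : 𝓢'(Rn d, ℂ)) :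
    modNorm g p q s (c • f) = ‖c‖ₑ * modNorm g p q s f := by
  rcases eq_or_ne c 0 with rfl | hc
  · refine le_antisymm (modNorm_smul_le g p q s 0 f) ?_
    rw [enorm_zero, zero_mul]
    exact zero_le
  refine le_antisymm (modNorm_smul_le g p q s c f) ?_
  have h := modNorm_smul_le g p q s c⁻¹ (c • f)
  rw [smul_smul, inv_mul_cancel₀ hc, one_smul] at h
  calc ‖c‖ₑ * modNorm g p q s f ≤ ‖c‖ₑ * (‖c⁻¹‖ₑ * modNorm g p q s (c • f)) := by gcongr
    _ = modNorm g p q s (c • f) := by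
      rw [← mul_assoc, ← enorm_mul, mul_inv_cancel₀ hc]
      simp

section Space

variable (g : 𝓢(Rn d, ℂ)) (p q : ℝ≥0∞) [Fact (1 ≤ p)] [Fact (1 ≤ q)] (s : ℝ)

/-- The tempered distributions of finite modulation norm. -/
def modulationSubmodule : Submodule ℂ 𝓢'(Rn d, ℂ) where
  carrier := {f | modNorm g p q s f < ⊤}
  zero_mem' := by simp [modNorm_zero]
  add_mem' {f₁ f₂} h₁ h₂ :=
    (modNorm_add_le g Fact.out Fact.out s f₁ f₂).trans_lt (ENNReal.add_lt_top.2 ⟨h₁, h₂⟩)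
  smul_mem' c f h := by
    simp only [Set.mem_ofPred_eq, modNorm_smul] at h ⊢
    exact ENNReal.mul_lt_top enorm_lt_top h

/-- The modulation space `M_s^{p,q}(ℝ^d)` (with respect to the window `g`): the space of tempered
distributions `f` with `modNorm g p q s f < ⊤`. It is a type of its own because it carries
the topology of its norm and not the one induced by the tempered distributions. -/
def ModulationSpace : Type := ↥(modulationSubmodule g p q s)

namespace ModulationSpace

instance : AddCommGroup (ModulationSpace g p q s) :=
  inferInstanceAs (AddCommGroup ↥(modulationSubmodule g p q s))

instance : Module ℂ (ModulationSpace g p q s) :=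
  inferInstanceAs (Module ℂ ↥(modulationSubmodule g p q s))

variable {g p q s}

/-- The inclusion of a modulation space into the tempered distributions. -/
def toDistribution : ModulationSpace g p q s →ₗ[ℂ] 𝓢'(Rn d, ℂ) :=
  (modulationSubmodule g p q s).subtype

theorem modNorm_lt_top (f : ModulationSpace g p q s) :
    modNorm g p q s (toDistribution f) < ⊤ := f.2

instance : Norm (ModulationSpace g p q s) :=
  ⟨fun f => (modNorm g p q s (toDistribution f)).toReal⟩

theorem norm_def (f : ModulationSpace g p q s) :
    ‖f‖ = (modNorm g p q s (toDistribution f)).toReal := rfl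

theorem core : SeminormedSpace.Core ℂ (ModulationSpace g p q s) where
  norm_nonneg f := ENNReal.toReal_nonneg
  norm_smul c f := by
    rw [norm_def, norm_def, map_smul, modNorm_smul, ENNReal.toReal_mul, toReal_enorm]
  norm_triangle f₁ f₂ := by
    rw [norm_def, norm_def, norm_def, map_add,
      ← ENNReal.toReal_add (modNorm_lt_top f₁).ne (modNorm_lt_top f₂).ne]
    exact ENNReal.toReal_mono
      (ENNReal.add_lt_top.2 ⟨modNorm_lt_top f₁, modNorm_lt_top f₂⟩).ne
      (modNorm_add_le g Fact.out Fact.out s _ _)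

/-- The topology of `M_s^{p,q}` is that of the modulation norm. (For `g ≠ 0` the
seminorm `‖f‖ = ‖V_g f‖` is a norm; this is a theorem that the definition does not need.) -/
instance : SeminormedAddCommGroup (ModulationSpace g p q s) :=
  SeminormedAddCommGroup.ofCore core

instance : NormedSpace ℂ (ModulationSpace g p q s) where
  norm_smul_le c f := (core.norm_smul c f).le

end ModulationSpace

end Space

/-! ### Nuclear operators and their trace -/

section Nuclear

variable {B₁ B₂ B : Type*} [SeminormedAddCommGroup B₁] [NormedSpace ℂ B₁]
  [SeminormedAddCommGroup B₂] [NormedSpace ℂ B₂] [SeminormedAddCommGroup B] [NormedSpace ℂ B]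

/-- `T = ∑ₙ x'ₙ ⊗ yₙ` with functionals `x'ₙ` in the dual of `B₁` and vectors `yₙ` in `B₂` such that
`∑ₙ ‖x'ₙ‖^r ‖yₙ‖^r < ∞`. -/
def IsNuclearRepresentation (r : ℝ) (T : B₁ →L[ℂ] B₂)
    (x' : ℕ → (B₁ →L[ℂ] ℂ)) (y : ℕ → B₂) : Prop :=
  Summable (fun n => ‖x' n‖ ^ r * ‖y n‖ ^ r) ∧
    ∀ x : B₁, HasSum (fun n => x' n x • y n) (T x)

/-- `T` is an `r`-nuclear operator. -/
def IsRNuclear (r : ℝ) (T : B₁ →L[ℂ] B₂) : Prop :=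
  ∃ (x' : ℕ → (B₁ →L[ℂ] ℂ)) (y : ℕ → B₂), IsNuclearRepresentation r T x' y

/-- The operator `T` is nuclear, its trace is well defined, and its value is `τ`: every nuclear
representation `T = ∑ₙ x'ₙ ⊗ yₙ` has `∑ₙ ⟨yₙ, x'ₙ⟩ = τ`. -/
def HasNuclearTrace (T : B →L[ℂ] B) (τ : ℂ) : Prop :=
  IsRNuclear 1 T ∧
    ∀ (x' : ℕ → (B →L[ℂ] ℂ)) (y : ℕ → B), IsNuclearRepresentation 1 T x' y →
      HasSum (fun n => x' n (y n)) τ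

end Nuclear

/-! ### The harmonic oscillator and the Hermite functions -/

/-- The harmonic oscillator `-Δ + |x|²`, acting on tempered distributions. -/
def harmonicOscillator (f : 𝓢'(Rn d, ℂ)) : 𝓢'(Rn d, ℂ) :=
  -Δ f + TemperedDistribution.smulLeftCLM ℂ (fun x : Rn d => ((‖x‖ ^ 2 : ℝ) : ℂ)) f

theorem hasTemperateGrowth_norm_sq :
    Function.HasTemperateGrowth (fun x : Rn d => ((‖x‖ ^ 2 : ℝ) : ℂ)) := by
  fun_prop

theorem exists_gaussian_bound (K n : ℕ) : ∃ C : ℝ, ∀ x : Rn d,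
    ‖x‖ ^ K * ‖iteratedFDeriv ℝ n (fun x : Rn d => Real.exp (-(‖x‖ ^ 2 / 2))) x‖ ≤ C := by
  have hf : Function.HasTemperateGrowth (fun x : Rn d => -(‖x‖ ^ 2 / 2)) := by
    have h1 : Function.HasTemperateGrowth (fun x : Rn d => (-(1 / 2) : ℝ) * ‖x‖ ^ 2) := by fun_prop
    convert h1 using 2
    ring
  obtain ⟨k, C, hC, hb⟩ := hf.norm_iteratedFDeriv_le_uniform n
  refine ⟨n ! * (1 + C) ^ n * (Real.exp 2 * (K + k * n)!), fun x => ?_⟩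
  set t := ‖x‖ with ht
  have ht0 : 0 ≤ t := norm_nonneg x
  have hD := norm_iteratedFDeriv_comp_le (𝕜 := ℝ) (g := Real.exp)
    (f := fun x : Rn d => -(‖x‖ ^ 2 / 2)) (n := n) (N := ∞) Real.contDiff_exp hf.1
    (by exact_mod_cast le_top) x (C := Real.exp (-(t ^ 2 / 2))) (D := (1 + C) * (1 + t) ^ k)
    (by
      intro i _
      rw [norm_iteratedFDeriv_eq_norm_iteratedDeriv, iteratedDeriv_eq_iterate,
        Real.iter_deriv_exp, Real.norm_of_nonneg (Real.exp_pos _).le])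
    (by
      intro i hi1 hi
      have hone : 1 ≤ (1 + C) * (1 + t) ^ k :=
        one_le_mul_of_one_le_of_one_le (by linarith) (one_le_pow₀ (by linarith))
      calc _ ≤ C * (1 + t) ^ k := hb i hi x
        _ ≤ (1 + C) * (1 + t) ^ k := by gcongr; linarith
        _ ≤ ((1 + C) * (1 + t) ^ k) ^ i := le_self_pow₀ hone (by omega))
  have hpow : (1 + t) ^ (K + k * n) * Real.exp (-(t ^ 2 / 2)) ≤
      Real.exp 2 * (K + k * n)! := by
    set m := K + k * n
    have h1 : (1 + t) ^ m ≤ (2 + t ^ 2 / 2) ^ m := by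
      refine pow_le_pow_left₀ (by positivity) ?_ m
      nlinarith [sq_nonneg (t - 1)]
    have h2 := Real.pow_div_factorial_le_exp (2 + t ^ 2 / 2) (by positivity) m
    rw [div_le_iff₀ (by positivity)] at h2
    calc (1 + t) ^ m * Real.exp (-(t ^ 2 / 2))
        ≤ (Real.exp (2 + t ^ 2 / 2) * m !) * Real.exp (-(t ^ 2 / 2)) := by
          gcongr
          exact h1.trans h2
      _ = (Real.exp (2 + t ^ 2 / 2) * Real.exp (-(t ^ 2 / 2))) * m ! := by ring
      _ = Real.exp 2 * m ! := by rw [← Real.exp_add]; congr 2; ring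
  calc t ^ K * ‖iteratedFDeriv ℝ n (fun x : Rn d => Real.exp (-(‖x‖ ^ 2 / 2))) x‖
      ≤ (1 + t) ^ K * (n ! * Real.exp (-(t ^ 2 / 2)) * ((1 + C) * (1 + t) ^ k) ^ n) := by
        gcongr
        · linarith
        · exact hD
    _ = n ! * (1 + C) ^ n * ((1 + t) ^ (K + k * n) * Real.exp (-(t ^ 2 / 2))) := by
        rw [mul_pow, pow_add, pow_mul]; ring
    _ ≤ _ := by gcongr

/-- The Gaussian `exp (-|x|²/2)`. -/
def gaussian (d : ℕ) : 𝓢(Rn d, ℝ) where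
  toFun x := Real.exp (-(‖x‖ ^ 2 / 2))
  smooth' := by
    refine Real.contDiff_exp.comp ?_
    exact ((contDiff_norm_sq ℝ).div_const 2).neg
  decay' := exists_gaussian_bound

/-- The normalised physicists' Hermite polynomial
`(2^n n! √π)^{-1/2} H_n(t) = (n! √π)^{-1/2} He_n(√2 t)`. -/
def normHermite (n : ℕ) (t : ℝ) : ℝ :=
  (Real.sqrt (n ! * Real.sqrt Real.pi))⁻¹ *
    Polynomial.aeval (Real.sqrt 2 * t) (Polynomial.hermite n)

/-- The Hermite function `φ_α(x) = ∏ᵢ (2^{αᵢ} αᵢ! √π)^{-1/2} H_{αᵢ}(xᵢ) exp (-xᵢ²/2)`; these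
functions, for `α ∈ ℕ^d`, are the usual `L²`-orthonormal basis of eigenfunctions of the harmonic
oscillator. -/
def hermiteFunction (α : Fin d → ℕ) : 𝓢(Rn d, ℂ) :=
  SchwartzMap.postcompCLM (𝕜 := ℝ) Complex.ofRealCLM
    (SchwartzMap.smulLeftCLM ℝ (fun x : Rn d => ∏ i, normHermite (α i) (x i)) (gaussian d))

theorem hasTemperateGrowth_prod {ι : Type*} (t : Finset ι) (f : ι → Rn d → ℝ)
    (hf : ∀ i, (f i).HasTemperateGrowth) :
    Function.HasTemperateGrowth (fun x => ∏ i ∈ t, f i x) := by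
  classical
  induction t using Finset.induction_on with
  | empty =>
    simp only [Finset.prod_empty]
    exact Function.HasTemperateGrowth.const (1 : ℝ)
  | insert a t ha ih =>
    simp only [Finset.prod_insert ha]
    exact (hf a).mul ih

theorem hasTemperateGrowth_normHermite (n : ℕ) (i : Fin d) :
    Function.HasTemperateGrowth (fun x : Rn d => normHermite n (x i)) := by
  have hi : Function.HasTemperateGrowth (fun x : Rn d => x i) :=
    (EuclideanSpace.proj (𝕜 := ℝ) i : Rn d →L[ℝ] ℝ).hasTemperateGrowth
  unfold normHermite
  simp_rw [Polynomial.aeval_eq_sum_range, mul_pow]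
  refine (Function.HasTemperateGrowth.const _).mul (Function.HasTemperateGrowth.sum fun k _ => ?_)
  have : Function.HasTemperateGrowth (fun x : Rn d =>
      (((Polynomial.hermite n).coeff k : ℤ) : ℝ) * (Real.sqrt 2 ^ k * (x i) ^ k)) :=
    (Function.HasTemperateGrowth.const _).mul
      ((Function.HasTemperateGrowth.const _).mul (hi.pow k))
  simpa [zsmul_eq_mul] using this

theorem hermiteFunction_apply (α : Fin d → ℕ) (x : Rn d) :
    hermiteFunction α x =
      ((∏ i, (normHermite (α i) (x i) * Real.exp (-((x i) ^ 2 / 2))) : ℝ) : ℂ) := by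
  have h := hasTemperateGrowth_prod Finset.univ
    (fun i (x : Rn d) => normHermite (α i) (x i)) fun i => hasTemperateGrowth_normHermite (α i) i
  have hg : gaussian d x = ∏ i, Real.exp (-((x i) ^ 2 / 2)) := by
    change Real.exp (-(‖x‖ ^ 2 / 2)) = _
    rw [← Real.exp_sum, EuclideanSpace.norm_sq_eq, Finset.sum_div, ← Finset.sum_neg_distrib]
    simp
  rw [hermiteFunction, SchwartzMap.postcompCLM_apply, SchwartzMap.smulLeftCLM_apply_apply h, hg,
    Finset.prod_mul_distrib]
  rfl

/-- The eigenvalue `∑ᵢ (2 αᵢ + 1)` of the harmonic oscillator that belongs to `φ_α`. -/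
def hermiteEigenvalue (α : Fin d → ℕ) : ℝ := ∑ i, (2 * (α i : ℝ) + 1)

/-- The Hermite function `φ_α` as a tempered distribution. -/
def hermiteDistribution (α : Fin d → ℕ) : 𝓢'(Rn d, ℂ) :=
  SchwartzMap.toTemperedDistributionCLM (Rn d) ℂ volume (hermiteFunction α)

theorem derivative_hermite_succ (n : ℕ) :
    Polynomial.derivative (Polynomial.hermite (n + 1)) =
      ((n : Polynomial ℤ) + 1) * Polynomial.hermite n := by
  induction n with
  | zero => simp [Polynomial.hermite_succ]
  | succ n ih =>
    rw [Polynomial.hermite_succ (n + 1), map_sub, Polynomial.derivative_mul, ih]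
    have h2 : Polynomial.derivative (((n : Polynomial ℤ) + 1) * Polynomial.hermite n) =
        ((n : Polynomial ℤ) + 1) * Polynomial.derivative (Polynomial.hermite n) := by
      simp [Polynomial.derivative_mul]
    rw [h2]
    have h3 := Polynomial.hermite_succ n
    rw [Polynomial.derivative_X]
    push_cast
    linear_combination (-(n : Polynomial ℤ) - 1) * h3

theorem hermite_ode (n : ℕ) :
    Polynomial.derivative (Polynomial.derivative (Polynomial.hermite n)) =
      Polynomial.X * Polynomial.derivative (Polynomial.hermite n) -
        (n : Polynomial ℤ) * Polynomial.hermite n := by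
  have h := congrArg Polynomial.derivative (Polynomial.hermite_succ n)
  rw [derivative_hermite_succ, map_sub, Polynomial.derivative_mul, Polynomial.derivative_X] at h
  linear_combination h

/-- The one-dimensional Hermite functions satisfy `h'' = (t² - (2 n + 1)) h`. -/
theorem exists_hasDerivAt_hermite (n : ℕ) : ∃ u : ℝ → ℝ,
    (∀ t, HasDerivAt (fun t => normHermite n t * Real.exp (-(t ^ 2 / 2))) (u t) t) ∧
    ∀ t, HasDerivAt u ((t ^ 2 - (2 * n + 1)) * (normHermite n t * Real.exp (-(t ^ 2 / 2)))) t := by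
  set c := (Real.sqrt (n ! * Real.sqrt Real.pi))⁻¹ with hc
  set P := Polynomial.hermite n with hP
  set w := Real.sqrt 2 with hw
  have hw2 : w ^ 2 = 2 := Real.sq_sqrt (by norm_num)
  have hpoly : ∀ (Q : Polynomial ℤ) (t : ℝ), HasDerivAt (fun t => Polynomial.aeval (w * t) Q)
      (Polynomial.aeval (w * t) (Polynomial.derivative Q) * w) t := by
    intro Q t
    have h1 : HasDerivAt (fun t : ℝ => w * t) w t := by
      simpa using (hasDerivAt_id t).const_mul w
    exact (Q.hasDerivAt_aeval (w * t)).comp t h1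
  have hexp : ∀ t : ℝ, HasDerivAt (fun t : ℝ => Real.exp (-(t ^ 2 / 2)))
      (Real.exp (-(t ^ 2 / 2)) * (-t)) t := by
    intro t
    have h1 : HasDerivAt (fun t : ℝ => -(t ^ 2 / 2)) (-t) t := by
      exact ((hasDerivAt_pow 2 t).div_const 2).fun_neg.congr_deriv (by norm_num)
    exact h1.exp
  refine ⟨fun t => c * ((Polynomial.aeval (w * t) (Polynomial.derivative P) * w -
    t * Polynomial.aeval (w * t) P) * Real.exp (-(t ^ 2 / 2))), fun t => ?_, fun t => ?_⟩
  · have h := ((hpoly P t).fun_mul (hexp t)).const_mul c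
    have hfun : (fun t => normHermite n t * Real.exp (-(t ^ 2 / 2))) =
        fun t => c * (Polynomial.aeval (w * t) P * Real.exp (-(t ^ 2 / 2))) := by
      funext t
      simp only [normHermite, ← hc, ← hP, ← hw]
      ring
    rw [hfun]
    exact h.congr_deriv (by ring)
  · have h1 := ((hpoly (Polynomial.derivative P) t).mul_const w).fun_sub
      ((hasDerivAt_id' t).fun_mul (hpoly P t))
    have h := (h1.fun_mul (hexp t)).const_mul c
    refine h.congr_deriv ?_
    have hode := congrArg (Polynomial.aeval (w * t)) (hermite_ode n)
    simp only [map_sub, map_mul, Polynomial.aeval_X, map_natCast] at hode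
    rw [← hP] at hode
    simp only [normHermite, ← hc, ← hP, ← hw]
    rw [hode]
    linear_combination (c * Real.exp (-(t ^ 2 / 2)) *
      (t * w * Polynomial.aeval (w * t) (Polynomial.derivative P) -
        (n : ℝ) * Polynomial.aeval (w * t) P)) * hw2

theorem lineDeriv_separated (i : Fin d) (u v : ℝ → ℝ) (huv : ∀ t, HasDerivAt u (v t) t)
    (h : Fin d → ℝ → ℝ) (x : Rn d) :
    lineDeriv ℝ (fun x : Rn d => ((u (x i) * ∏ j ∈ Finset.univ.erase i, h j (x j) : ℝ) : ℂ)) x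
      (EuclideanSpace.basisFun (Fin d) ℝ i) =
    ((v (x i) * ∏ j ∈ Finset.univ.erase i, h j (x j) : ℝ) : ℂ) := by
  have hfun : (fun t : ℝ => ((u ((x + t • EuclideanSpace.basisFun (Fin d) ℝ i) i) *
      ∏ j ∈ Finset.univ.erase i, h j ((x + t • EuclideanSpace.basisFun (Fin d) ℝ i) j) : ℝ) : ℂ)) =
      fun t : ℝ => ((u (x i + t) * ∏ j ∈ Finset.univ.erase i, h j (x j) : ℝ) : ℂ) := by
    funext t
    congr 2
    · simp
    · refine Finset.prod_congr rfl fun j hj => ?_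
      simp [Finset.ne_of_mem_erase hj]
  rw [lineDeriv, hfun]
  have h1 : HasDerivAt (fun t : ℝ => u (x i + t)) (v (x i)) 0 := by
    have := huv (x i + 0)
    rw [add_zero] at this
    simpa using HasDerivAt.comp_const_add (x i) 0 (by simpa using this)
  exact ((h1.mul_const _).ofReal_comp).deriv

/-- The Hermite functions are eigenfunctions: `(-Δ + |x|²) φ_α = λ_α φ_α`. -/
theorem harmonicOscillator_hermiteDistribution (α : Fin d → ℕ) :
    harmonicOscillator (hermiteDistribution α) =
      (hermiteEigenvalue α : ℂ) • hermiteDistribution α := by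
  choose u hu hu' using exists_hasDerivAt_hermite
  let h : ℕ → ℝ → ℝ := fun n t => normHermite n t * Real.exp (-(t ^ 2 / 2))
  have hφ : ∀ i : Fin d, (hermiteFunction α : Rn d → ℂ) = fun x => ((h (α i) (x i) *
      ∏ j ∈ Finset.univ.erase i, h (α j) (x j) : ℝ) : ℂ) := by
    intro i
    funext x
    rw [hermiteFunction_apply, ← Finset.mul_prod_erase _ _ (Finset.mem_univ i)]
  have hΔ : ∀ x, (Δ (hermiteFunction α)) x =
      ((‖x‖ ^ 2 - hermiteEigenvalue α : ℝ) : ℂ) * hermiteFunction α x := by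
    intro x
    rw [SchwartzMap.laplacian_eq_sum (EuclideanSpace.basisFun (Fin d) ℝ), sum_apply]
    have hi : ∀ i : Fin d, (LineDeriv.lineDerivOp (EuclideanSpace.basisFun (Fin d) ℝ i)
        (LineDeriv.lineDerivOp (EuclideanSpace.basisFun (Fin d) ℝ i) (hermiteFunction α))
          : 𝓢(Rn d, ℂ)) x =
        (((x i) ^ 2 - (2 * (α i : ℝ) + 1) : ℝ) : ℂ) * hermiteFunction α x := by
      intro i
      have h1 : ((LineDeriv.lineDerivOp (EuclideanSpace.basisFun (Fin d) ℝ i) (hermiteFunction α)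
          : 𝓢(Rn d, ℂ)) : Rn d → ℂ) = fun x => ((u (α i) (x i) *
          ∏ j ∈ Finset.univ.erase i, h (α j) (x j) : ℝ) : ℂ) := by
        funext x
        rw [SchwartzMap.lineDerivOp_apply, hφ i]
        exact lineDeriv_separated i _ _ (hu (α i)) _ x
      rw [SchwartzMap.lineDerivOp_apply, h1,
        lineDeriv_separated i _ _ (hu' (α i)) (fun j => h (α j)) x, hφ i]
      push_cast
      simp only [h]
      push_cast
      ring
    simp_rw [hi]
    rw [← Finset.sum_mul, EuclideanSpace.norm_sq_eq, hermiteEigenvalue]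
    congr 1
    push_cast
    rw [Finset.sum_sub_distrib]
    congr 1
    exact Finset.sum_congr rfl fun i _ => by 
      rw [← Complex.ofReal_pow, ← Complex.ofReal_pow, Real.norm_eq_abs, sq_abs]
  have hmul : TemperedDistribution.smulLeftCLM ℂ (fun x : Rn d => ((‖x‖ ^ 2 : ℝ) : ℂ))
      (hermiteDistribution α) = SchwartzMap.toTemperedDistributionCLM (Rn d) ℂ volume
        (SchwartzMap.smulLeftCLM ℂ (fun x : Rn d => ((‖x‖ ^ 2 : ℝ) : ℂ)) (hermiteFunction α)) := by
    ext ψ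
    rw [TemperedDistribution.smulLeftCLM_apply_apply, hermiteDistribution,
      SchwartzMap.toTemperedDistributionCLM_apply_apply volume,
      SchwartzMap.toTemperedDistributionCLM_apply_apply volume]
    refine integral_congr_ae (ae_of_all _ fun x => ?_)
    simp only [SchwartzMap.smulLeftCLM_apply_apply hasTemperateGrowth_norm_sq, smul_eq_mul]
    ring
  rw [harmonicOscillator, hmul, hermiteDistribution,
    TemperedDistribution.laplacian_toTemperedDistributionCLM_eq, ← map_neg, ← map_add, ← map_smul]
  congr 1
  ext x
  have := hΔ x
  simp only [add_apply, neg_apply, smul_apply, this,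
    SchwartzMap.smulLeftCLM_apply_apply hasTemperateGrowth_norm_sq, smul_eq_mul]
  push_cast
  ring

/-- The bounded operator `T` on `M_s^{p,q}` is `F(-Δ + |x|²)`: it multiplies each eigenvector of
`-Δ + |x|²` by the value of `F` at its eigenvalue. -/
def IsFunctionOfOscillator {g : 𝓢(Rn d, ℂ)} {p q : ℝ≥0∞} [Fact (1 ≤ p)] [Fact (1 ≤ q)] {s : ℝ}
    (F : ℝ → ℂ) (T : ModulationSpace g p q s →L[ℂ] ModulationSpace g p q s) : Prop :=
  ∀ (lam : ℝ) (f : ModulationSpace g p q s),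
    harmonicOscillator f.toDistribution = (lam : ℂ) • f.toDistribution → T f = F lam • f

/-- The series
`∑_α |F(λ_α)|^r ‖φ_α‖^r ‖φ_α‖^r` with the norms of `M_s^{p,q}` and of `M_{-s}^{p',q'}`. -/
def hermiteSeries (g : 𝓢(Rn d, ℂ)) (p q : ℝ≥0∞) (s : ℝ) (F : ℝ → ℂ) (r : ℝ) : ℝ≥0∞ :=
  ∑' α : Fin d → ℕ, ‖F (hermiteEigenvalue α)‖ₑ ^ r *
    modNorm g p q s (hermiteDistribution α) ^ r *
    modNorm g p.conjExponent q.conjExponent (-s) (hermiteDistribution α) ^ r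

end HarmonicModulation

end

noncomputable section

namespace HarmonicModulation

variable {d : ℕ}

/-! ### Minkowski's integral inequality and mixed norms -/

section MixedNorm

variable {X Y Z : Type*} [MeasurableSpace X] [MeasurableSpace Y] [MeasurableSpace Z]

/-! Existence and nuclearity. The candidate for F(A) is the Hermite expansion f ↦ ∑_α F(λ_α) ⟨f,
φ_α⟩ φ_α. By the inversion formula of the short-time Fourier transform and Hölder's inequality on
phase space, the functional ⟨·, φ_α⟩ has norm at most a constant times the M_{-s}^{p',q'} norm of
φ_α. So (*) says that the expansion is itself an r-nuclear representation, and since r ≤ 1 it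
converges in operator norm. Orthonormality shows that the sum multiplies the β-th Hermite
coefficient by F(λ_β). An eigenvector for λ has nonzero coefficients only where λ_β = λ, and a
tempered distribution is determined by its Hermite coefficients (`eq_zero_of_hermiteFunction`), so
the sum acts on every eigenvector as required. The trace read off from this representation is ∑_α
F(λ_α).

Uniqueness of the operator and independence of the trace both rest on a truncated inversion formula.
Let c = (2π)^d ‖g‖², let π(z)g be the time-frequency shifts of g, and put P_n y = c⁻¹ ∫_{|z| ≤ n}
V_g y(z) π(z)g dz. The remainder y - P_n y is synthesised from V_g y cut off to the complement of
the ball. Synthesis is bounded from the weighted mixed-norm space to the modulation space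
(`exists_modNorm_le_of_synthesis`), because on the transform side it is dominated by convolution
with an integrable kernel. Hence the P_n are uniformly bounded, and P_n y → y by dominated
convergence, which uses p, q < ∞ (`ModulationSpace.isResolution_gaborAtom`).

Consequently a bounded operator that kills all Schwartz functions is zero. That an operator killing
all φ_α kills all Schwartz functions is again totality of the Hermite functions. For nuclear T = ∑
x'_k ⊗ y_k the integrals c⁻¹ ∫_{|z| ≤ n} V_g(T π(z)g)(z) dz involve only T, and they equal ∑
x'_k(P_n y_k), which tends to ∑ x'_k(y_k) (`IsResolution.tendsto_trace`); so that sum is the same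
for all representations.

The inversion formula and totality both need a tempered distribution to pass through a
Schwartz-valued integral; `SchwartzIntegrable.integrable_integral_apply` provides this. -/

theorem rpow_lintegral_le_of_le_lintegral {μ : Measure X} {τ : Measure Z} [SFinite μ] [SFinite τ]
    {h : X → Z → ℝ≥0∞} (hh : Measurable (Function.uncurry h)) {a : ℝ} (ha : 1 < a)
    {u : X → ℝ≥0∞} (hu : Measurable u) (hfin : ∫⁻ x, u x ^ a ∂μ ≠ ⊤)
    (hle : ∀ x, u x ≤ ∫⁻ t, h x t ∂τ) :
    (∫⁻ x, u x ^ a ∂μ) ^ (1 / a) ≤ ∫⁻ t, (∫⁻ x, h x t ^ a ∂μ) ^ (1 / a) ∂τ := by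
  set I := ∫⁻ x, u x ^ a ∂μ with hI
  have ha0 : 0 < a := by linarith
  rcases eq_or_ne I 0 with h0 | h0
  · rw [h0, ENNReal.zero_rpow_of_pos (by positivity)]
    exact zero_le
  set b := a / (a - 1) with hb
  have hab : b.HolderConjugate a := (Real.HolderConjugate.conjExponent ha).symm
  have hmul : (a - 1) * b = a := by
    rw [hb]; field_simp [sub_ne_zero.2 ha.ne']
  -- Write u^a = u^{a-1} u, bound the last factor by the integral of h, swap the integrals and apply
  -- Hölder in x with the exponents b and a. It remains to divide by I^{1/b}, which is neither 0 nor
  -- ∞; this is why I is assumed finite.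
  have key : I ≤ I ^ (1 / b) * ∫⁻ t, (∫⁻ x, h x t ^ a ∂μ) ^ (1 / a) ∂τ := by
    calc I ≤ ∫⁻ x, u x ^ (a - 1) * ∫⁻ t, h x t ∂τ ∂μ := by
          refine lintegral_mono fun x => ?_
          calc u x ^ a = u x ^ (a - 1) * u x := by
                conv_rhs => rw [← ENNReal.rpow_one (u x), ← ENNReal.rpow_mul, one_mul]
                rw [← ENNReal.rpow_add_of_nonneg _ _ (by linarith) (by norm_num)]
                congr 1; ring
            _ ≤ _ := by gcongr; exact hle x
      _ = ∫⁻ x, ∫⁻ t, u x ^ (a - 1) * h x t ∂τ ∂μ := by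
          refine lintegral_congr fun x => ?_
          rw [lintegral_const_mul _ (by fun_prop)]
      _ = ∫⁻ t, ∫⁻ x, u x ^ (a - 1) * h x t ∂μ ∂τ := by
          refine lintegral_lintegral_swap (Measurable.aemeasurable ?_)
          exact ((hu.comp measurable_fst).pow_const _).mul hh
      _ ≤ ∫⁻ t, I ^ (1 / b) * (∫⁻ x, h x t ^ a ∂μ) ^ (1 / a) ∂τ := by
          refine lintegral_mono fun t => ?_
          refine (ENNReal.lintegral_mul_le_Lp_mul_Lq μ hab (hu.pow_const _).aemeasurable
            (hh.comp measurable_prodMk_right).aemeasurable).trans (le_of_eq ?_)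
          simp_rw [← ENNReal.rpow_mul, hmul]
          rfl
      _ = _ := by
          refine lintegral_const_mul _ ?_
          exact ((hh.pow_const a).lintegral_prod_left').pow_const _
  have hsplit : I = I ^ (1 / b) * I ^ (1 / a) := by
    rw [← ENNReal.rpow_add _ _ h0 hfin, hab.one_div_add_one_div]
    simp
  have hb0 : I ^ (1 / b) ≠ 0 := by
    rw [Ne, ENNReal.rpow_eq_zero_iff]
    rintro (h | h)
    · exact h0 h.1
    · exact hfin h.1
  have hbt : I ^ (1 / b) ≠ ⊤ := ENNReal.rpow_ne_top_of_nonneg (one_div_nonneg.2 hab.nonneg) hfin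
  rw [hsplit] at key
  conv at key => rhs; rw [← hsplit]
  exact (ENNReal.mul_le_mul_iff_right hb0 hbt).1 key

/-- The preceding Hölder argument needs a finite left side. So the inner integral is cut off in
height at n and in space to the n-th spanning set, and monotone convergence removes the cut-off. -/
theorem minkowski_lintegral {μ : Measure X} {τ : Measure Z} [SigmaFinite μ] [SFinite τ]
    {h : X → Z → ℝ≥0∞} (hh : Measurable (Function.uncurry h)) {a : ℝ} (ha : 1 ≤ a) :
    (∫⁻ x, (∫⁻ t, h x t ∂τ) ^ a ∂μ) ^ (1 / a) ≤
      ∫⁻ t, (∫⁻ x, h x t ^ a ∂μ) ^ (1 / a) ∂τ := by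
  rcases ha.eq_or_lt with rfl | ha
  · simp only [ENNReal.rpow_one, div_one]
    exact (lintegral_lintegral_swap hh.aemeasurable).le
  have ha0 : 0 < a := by linarith
  set G := fun x => ∫⁻ t, h x t ∂τ with hG
  have hGm : Measurable G := hh.lintegral_prod_right'
  let u : ℕ → X → ℝ≥0∞ := fun n => (spanningSets μ n).indicator fun x => min (G x) n
  have hum : ∀ n, Measurable (u n) := fun n =>
    (hGm.min measurable_const).indicator (measurableSet_spanningSets μ n)
  have hmono : Monotone u := by
    intro n m hnm x
    refine Set.indicator_le_indicator_of_subset (monotone_spanningSets μ hnm)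
      (fun _ => zero_le) x |>.trans ?_
    refine Set.indicator_le_indicator ?_
    gcongr
  have hule : ∀ n x, u n x ≤ G x := fun n x =>
    (Set.indicator_le_self' (fun _ _ => zero_le) x).trans (min_le_left _ _)
  have hsup : ∀ x, ⨆ n, u n x = G x := by
    intro x
    refine le_antisymm (iSup_le fun n => hule n x) ?_
    refine le_of_forall_lt fun c hc => ?_
    obtain ⟨n, hn⟩ := ENNReal.exists_nat_gt (hc.ne_top)
    have hx := mem_spanningSetsIndex μ x
    refine lt_of_lt_of_le ?_ (le_iSup _ (max n (spanningSetsIndex μ x)))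
    have hx' : x ∈ spanningSets μ (max n (spanningSetsIndex μ x)) :=
      monotone_spanningSets μ (le_max_right _ _) hx
    simp only [u, Set.indicator_of_mem hx', lt_min_iff]
    refine ⟨hc, hn.trans_le ?_⟩
    exact_mod_cast le_max_left _ _
  have hfin : ∀ n, ∫⁻ x, u n x ^ a ∂μ ≠ ⊤ := by
    intro n
    refine ne_top_of_le_ne_top (b := (n : ℝ≥0∞) ^ a * μ (spanningSets μ n)) ?_ ?_
    · exact ENNReal.mul_ne_top (by simp [ha0.le]) (measure_spanningSets_lt_top μ n).ne
    · rw [← setLIntegral_const, ← lintegral_indicator (measurableSet_spanningSets μ n)]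
      refine lintegral_mono fun x => ?_
      by_cases hx : x ∈ spanningSets μ n
      · simp only [u, Set.indicator_of_mem hx]
        exact ENNReal.rpow_le_rpow (min_le_right _ _) ha0.le
      · simp [u, Set.indicator_of_notMem hx, ha0]
  have hlim : ∫⁻ x, G x ^ a ∂μ = ⨆ n, ∫⁻ x, u n x ^ a ∂μ := by
    rw [← lintegral_iSup (fun n => (hum n).pow_const a)
      (fun n m hnm x => ENNReal.rpow_le_rpow (hmono hnm x) ha0.le)]
    refine lintegral_congr fun x => ?_
    rw [← hsup x]
    exact (ENNReal.orderIsoRpow a ha0).map_iSup _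
  rw [hlim]
  have := (ENNReal.orderIsoRpow (1 / a) (by positivity)).map_iSup fun n => ∫⁻ x, u n x ^ a ∂μ
  simp only [ENNReal.orderIsoRpow_apply] at this
  rw [this]
  exact iSup_le fun n => rpow_lintegral_le_of_le_lintegral hh ha (hum n) (hfin n) (hule n)

theorem eLpNorm_lintegral_le {μ : Measure X} {τ : Measure Z} [SigmaFinite μ] [SFinite τ]
    {h : X → Z → ℝ≥0∞} (hh : Measurable (Function.uncurry h)) {p : ℝ≥0∞} (hp : 1 ≤ p)
    (hpt : p ≠ ⊤) :
    eLpNorm (fun x => ∫⁻ t, h x t ∂τ) p μ ≤ ∫⁻ t, eLpNorm (fun x => h x t) p μ ∂τ := by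
  have hp0 : p ≠ 0 := (zero_lt_one.trans_le hp).ne'
  simp_rw [eLpNorm_eq_lintegral_rpow_enorm_toReal hp0 hpt, enorm_eq_self]
  exact minkowski_lintegral hh (by simpa using ENNReal.toReal_mono hpt hp)

theorem measurable_eLpNorm_left {μ : Measure X} [SFinite μ] {h : X → Z → ℝ≥0∞}
    (hh : Measurable (Function.uncurry h)) {p : ℝ≥0∞} (hp : 1 ≤ p) (hpt : p ≠ ⊤) :
    Measurable fun t => eLpNorm (fun x => h x t) p μ := by
  have hp0 : p ≠ 0 := (zero_lt_one.trans_le hp).ne'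
  simp_rw [eLpNorm_eq_lintegral_rpow_enorm_toReal hp0 hpt, enorm_eq_self]
  exact ((hh.pow_const _).lintegral_prod_left').pow_const _

/-- The mixed norm of a nonnegative function: the `p`-norm in the first variable is taken first. -/
def mixedNorm (μ : Measure X) (ν : Measure Y) (p q : ℝ≥0∞) (u : X → Y → ℝ≥0∞) : ℝ≥0∞ :=
  eLpNorm (fun y => eLpNorm (fun x => u x y) p μ) q ν

theorem mixedNorm_mono {μ : Measure X} {ν : Measure Y} {p q : ℝ≥0∞} {u v : X → Y → ℝ≥0∞}
    (huv : ∀ x y, u x y ≤ v x y) : mixedNorm μ ν p q u ≤ mixedNorm μ ν p q v := by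
  refine eLpNorm_mono_enorm fun y => ?_
  simp only [enorm_eq_self]
  exact eLpNorm_mono_enorm fun x => by simpa using huv x y

theorem eLpNorm_const_mul_ennreal {μ : Measure X} {p : ℝ≥0∞} (c : ℝ≥0∞) (hc : c ≠ ⊤)
    (u : X → ℝ≥0∞) : eLpNorm (fun x => c * u x) p μ ≤ c * eLpNorm u p μ := by
  lift c to NNReal using hc
  exact eLpNorm_le_nnreal_smul_eLpNorm_of_ae_le_mul' (ae_of_all _ fun x => by simp) p

theorem mixedNorm_const_mul_le {μ : Measure X} {ν : Measure Y} {p q : ℝ≥0∞} (c : ℝ≥0∞)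
    (hc : c ≠ ⊤) (u : X → Y → ℝ≥0∞) :
    mixedNorm μ ν p q (fun x y => c * u x y) ≤ c * mixedNorm μ ν p q u := by
  refine le_trans (eLpNorm_mono_enorm fun y => ?_) (eLpNorm_const_mul_ennreal c hc _)
  simp only [enorm_eq_self]
  exact eLpNorm_const_mul_ennreal c hc _

/-- Minkowski's inequality, once in each variable. With counting measure for τ it gives countable
subadditivity of the modulation norm; with Lebesgue measure on phase space it gives a Young
inequality. -/
theorem mixedNorm_lintegral_le {μ : Measure X} {ν : Measure Y} {τ : Measure Z} [SigmaFinite μ]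
    [SigmaFinite ν] [SFinite τ] {h : X → Y → Z → ℝ≥0∞}
    (hh : Measurable fun w : (X × Y) × Z => h w.1.1 w.1.2 w.2) {p q : ℝ≥0∞} (hp : 1 ≤ p)
    (hpt : p ≠ ⊤) (hq : 1 ≤ q) (hqt : q ≠ ⊤) :
    mixedNorm μ ν p q (fun x y => ∫⁻ t, h x y t ∂τ) ≤
      ∫⁻ t, mixedNorm μ ν p q (fun x y => h x y t) ∂τ := by
  have h1 : Measurable (Function.uncurry fun (x : X) (w : Y × Z) => h x w.1 w.2) :=
    hh.comp (f := fun w : X × (Y × Z) => ((w.1, w.2.1), w.2.2)) (by fun_prop)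
  refine le_trans (eLpNorm_mono_enorm fun y => ?_) (eLpNorm_lintegral_le
    (h := fun y t => eLpNorm (fun x => h x y t) p μ) ?_ hq hqt)
  · simp only [enorm_eq_self]
    refine eLpNorm_lintegral_le ?_ hp hpt
    exact hh.comp (f := fun w : X × Z => ((w.1, y), w.2)) (by fun_prop)
  · exact measurable_eLpNorm_left h1 hp hpt

/-- The endpoint exponents are treated separately: p = 1 or q = 1 is allowed in the theorem, and the
dual exponent is then ∞. -/
theorem lintegral_mul_le_eLpNorm_mul_eLpNorm {μ : Measure X} {p q : ℝ≥0∞} [p.HolderConjugate q]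
    {u v : X → ℝ≥0∞} (hu : Measurable u) (hv : Measurable v) :
    ∫⁻ x, u x * v x ∂μ ≤ eLpNorm u p μ * eLpNorm v q μ := by
  rcases eq_or_ne p ⊤ with rfl | hp
  · have hq : q = 1 := (ENNReal.HolderConjugate.eq_top_iff_eq_one ⊤ q).1 rfl
    subst hq
    rw [eLpNorm_exponent_top, eLpNorm_one_eq_lintegral_enorm, eLpNormEssSup,
      ← lintegral_const_mul _ (by fun_prop)]
    simp only [enorm_eq_self]
    refine lintegral_mono_ae ?_
    filter_upwards [ENNReal.ae_le_essSup u] with x hx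
    gcongr
  rcases eq_or_ne q ⊤ with rfl | hq
  · have hp1 : p = 1 := (ENNReal.HolderConjugate.eq_top_iff_eq_one ⊤ p).1 rfl
    subst hp1
    rw [eLpNorm_exponent_top, eLpNorm_one_eq_lintegral_enorm, eLpNormEssSup,
      ← lintegral_mul_const _ (by fun_prop)]
    simp only [enorm_eq_self]
    refine lintegral_mono_ae ?_
    filter_upwards [ENNReal.ae_le_essSup v] with x hx
    gcongr
  have hpq : p.toReal.HolderConjugate q.toReal := ENNReal.HolderTriple.toReal
    (r := 1) (ENNReal.toReal_pos (ENNReal.HolderConjugate.ne_zero p q) hp)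
    (ENNReal.toReal_pos (ENNReal.HolderConjugate.ne_zero q p) hq)
  rw [eLpNorm_eq_lintegral_rpow_enorm_toReal (ENNReal.HolderConjugate.ne_zero p q) hp,
    eLpNorm_eq_lintegral_rpow_enorm_toReal (ENNReal.HolderConjugate.ne_zero q p) hq]
  exact ENNReal.lintegral_mul_le_Lp_mul_Lq μ hpq hu.aemeasurable hv.aemeasurable

end MixedNorm

/-! ### Weak integrals of Schwartz-valued maps -/

section WeakIntegral

variable {E : Type*} [NormedAddCommGroup E] [NormedSpace ℝ E]

theorem continuous_schwartz_eval (y : E) : Continuous fun u : 𝓢(E, ℂ) => u y :=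
  (BoundedContinuousFunction.evalCLM ℂ (β := ℂ) y).continuous.comp
    (SchwartzMap.toBoundedContinuousFunctionCLM ℂ E ℂ).continuous

theorem continuous_schwartz_seminorm (k n : ℕ) :
    Continuous (SchwartzMap.seminorm ℂ k n : Seminorm ℂ 𝓢(E, ℂ)) :=
  (schwartz_withSeminorms ℂ E ℂ).continuous_seminorm (k, n)

/-- By homogeneity, each argument is its norm times a vector of the unit ball. Thus the operator
norm of a derivative is a supremum of scalars, and a Schwartz seminorm becomes the norm of a scalar
bounded continuous function. -/
theorem exists_multilinear_bound {n : ℕ} (T : E [×n]→L[ℝ] ℂ) {M : ℝ}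
    (hM : ∀ m : Fin n → Metric.closedBall (0 : E) 1, ‖T fun i => m i‖ ≤ M) : ‖T‖ ≤ M := by
  have hM0 : 0 ≤ M := (norm_nonneg _).trans (hM fun _ => ⟨0, by simp⟩)
  refine T.opNorm_le_bound hM0 fun m => ?_
  have h1 := hM fun i => ⟨(‖m i‖)⁻¹ • m i, by
    rw [mem_closedBall_zero_iff, norm_smul, norm_inv, norm_norm]
    exact inv_mul_le_one⟩
  have h2 : m = fun i => ‖m i‖ • ((‖m i‖)⁻¹ • m i) := by
    funext i
    rcases eq_or_ne (m i) 0 with h | h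
    · simp [h]
    · rw [smul_inv_smul₀ (norm_ne_zero_iff.2 h)]
  conv_lhs => rw [h2]
  rw [T.map_smul_univ, norm_smul, mul_comm, norm_prod]
  simp only [norm_norm]
  gcongr

theorem norm_weightedDeriv_le (k n : ℕ) (u : 𝓢(E, ℂ))
    (w : E × (Fin n → Metric.closedBall (0 : E) 1)) :
    ‖(‖w.1‖ ^ k) • iteratedFDeriv ℝ n u w.1 fun i => (w.2 i : E)‖ ≤ SchwartzMap.seminorm ℂ k n u := by
  rw [norm_smul, norm_pow, norm_norm]
  refine le_trans ?_ (SchwartzMap.le_seminorm ℂ k n u w.1)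
  gcongr
  refine ((iteratedFDeriv ℝ n u w.1).le_opNorm _).trans (mul_le_of_le_one_right (norm_nonneg _) ?_)
  exact Finset.prod_le_one (fun _ _ => norm_nonneg _) fun i _ =>
    mem_closedBall_zero_iff.1 (w.2 i).2

/-- The function `(y, m) ↦ ‖y‖ ^ k • D^n u(y) m` on `E` times the `n`-th power of the unit ball, as a
linear map on the Schwartz space with values in the bounded continuous functions. -/
def weightedDerivLM (k n : ℕ) : 𝓢(E, ℂ) →ₗ[ℂ]
    BoundedContinuousFunction (E × (Fin n → Metric.closedBall (0 : E) 1)) ℂ where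
  toFun u := BoundedContinuousFunction.ofNormedAddCommGroup
    (fun w => (‖w.1‖ ^ k) • iteratedFDeriv ℝ n u w.1 fun i => w.2 i)
    (by
      have h : Continuous (iteratedFDeriv ℝ n u) :=
        (u.smooth ⊤).continuous_iteratedFDeriv (by exact_mod_cast le_top)
      fun_prop)
    (SchwartzMap.seminorm ℂ k n u) fun w =>
      norm_weightedDeriv_le k n u w
  map_add' u v := by
    ext1 w
    have h : (⇑(u + v) : E → ℂ) = ⇑u + ⇑v := by ext; simp
    simp [h, iteratedFDeriv_add_apply (u.contDiffAt n) (v.contDiffAt n)]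
  map_smul' a u := by
    ext1 w
    have h : (⇑(a • u) : E → ℂ) = a • ⇑u := by ext; simp
    simp [h, iteratedFDeriv_const_smul_apply (u.contDiffAt n), mul_left_comm]

theorem norm_weightedDerivLM_le (k n : ℕ) (u : 𝓢(E, ℂ)) :
    ‖weightedDerivLM k n u‖ ≤ SchwartzMap.seminorm ℂ k n u :=
  BoundedContinuousFunction.norm_ofNormedAddCommGroup_le _ (by positivity)
    (norm_weightedDeriv_le k n u)

theorem seminorm_le_norm_weightedDerivLM (k n : ℕ) (u : 𝓢(E, ℂ)) :
    SchwartzMap.seminorm ℂ k n u ≤ ‖weightedDerivLM k n u‖ := by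
  refine SchwartzMap.seminorm_le_bound ℂ k n u (norm_nonneg _) fun y => ?_
  have h : ‖(‖y‖ ^ k) • iteratedFDeriv ℝ n u y‖ ≤ ‖weightedDerivLM k n u‖ :=
    exists_multilinear_bound _ fun m => (weightedDerivLM k n u).norm_coe_le_norm (y, m)
  rwa [norm_smul, norm_pow, norm_norm] at h

theorem continuous_weightedDerivLM (k n : ℕ) :
    Continuous (weightedDerivLM k n : 𝓢(E, ℂ) → _) := by
  refine continuous_of_continuousAt_zero (weightedDerivLM (E := E) k n) ?_
  rw [ContinuousAt, map_zero, tendsto_zero_iff_norm_tendsto_zero]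
  have h := (continuous_schwartz_seminorm (E := E) k n).tendsto 0
  rw [map_zero] at h
  exact squeeze_zero (fun _ => norm_nonneg _) (norm_weightedDerivLM_le k n) h

/-- A continuous functional on the Schwartz space factors through finitely many
`weightedDerivLM`. -/
theorem exists_factor_weightedDeriv (f : 𝓢(E, ℂ) →L[ℂ] ℂ) :
    ∃ (t : Finset (ℕ × ℕ))
      (L : (∀ i : t, BoundedContinuousFunction (E × (Fin i.1.2 → Metric.closedBall (0 : E) 1)) ℂ)
        →L[ℂ] ℂ),
      ∀ u, f u = L fun i => weightedDerivLM i.1.1 i.1.2 u := by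
  obtain ⟨t, C, -, hC⟩ := Seminorm.bound_of_continuous (schwartz_withSeminorms ℂ E ℂ)
    ((normSeminorm ℂ ℂ).comp f.toLinearMap) (by
      change Continuous fun u => ‖f u‖
      exact f.continuous.norm)
  let J : 𝓢(E, ℂ) →ₗ[ℂ]
      ∀ i : t, BoundedContinuousFunction (E × (Fin i.1.2 → Metric.closedBall (0 : E) 1)) ℂ :=
    LinearMap.pi fun i => weightedDerivLM i.1.1 i.1.2
  have hJ : ∀ u, ‖f u‖ ≤ C * ‖J u‖ := by
    intro u
    refine (hC u).trans ?_
    change (C : ℝ) * _ ≤ _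
    gcongr
    refine Seminorm.finset_sup_apply_le (norm_nonneg _) fun i hi => ?_
    exact (seminorm_le_norm_weightedDerivLM i.1 i.2 u).trans (norm_le_pi_norm (J u) ⟨i, hi⟩)
  -- The section σ is only linear. The bound `hJ` shows that f ∘ σ is bounded on the range of J, so
  -- Hahn–Banach extends it to the Banach space, and also that f vanishes on the kernel of J, so the
  -- extension composed with J gives back f.
  obtain ⟨σ, hσ⟩ := J.rangeRestrict.exists_rightInverse_of_surjective J.range_rangeRestrict
  have hσ' : ∀ w : LinearMap.range J, J (σ w) = w := fun w =>
    congrArg Subtype.val (LinearMap.congr_fun hσ w)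
  let L₀ : LinearMap.range J →L[ℂ] ℂ := (f.toLinearMap ∘ₗ σ).mkContinuous C fun w => by
    refine (hJ (σ w)).trans ?_
    rw [hσ']
    rfl
  obtain ⟨L, hL, -⟩ := exists_extension_norm_eq (LinearMap.range J) L₀
  refine ⟨t, L, fun u => ?_⟩
  have h1 : L (J u) = f (σ ⟨J u, u, rfl⟩) := hL ⟨J u, u, rfl⟩
  have h2 : ‖f (u - σ ⟨J u, u, rfl⟩)‖ ≤ 0 := by
    refine (hJ _).trans ?_
    rw [map_sub, hσ']
    simp
  have h3 := norm_le_zero_iff.1 h2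
  rw [map_sub, sub_eq_zero] at h3
  rw [h3, ← h1]
  rfl

variable {Z : Type*} [TopologicalSpace Z] [MeasurableSpace Z] {μ : Measure Z} {G : Z → 𝓢(E, ℂ)}

/-- A continuous map into the Schwartz space all of whose seminorms are integrable. -/
def SchwartzIntegrable (G : Z → 𝓢(E, ℂ)) (μ : Measure Z) : Prop :=
  Continuous G ∧ ∀ p : Seminorm ℂ 𝓢(E, ℂ), Continuous p → Integrable (fun z => p (G z)) μ

theorem SchwartzIntegrable.lineDerivOp (hG : SchwartzIntegrable G μ) (v : E) :
    SchwartzIntegrable (fun z => LineDeriv.lineDerivOp v (G z)) μ := by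
  have hc := (LineDeriv.lineDerivOpCLM ℂ 𝓢(E, ℂ) v).continuous
  exact ⟨hc.comp hG.1, fun p hp =>
    hG.2 (p.comp (LineDeriv.lineDerivOpCLM ℂ 𝓢(E, ℂ) v).toLinearMap) (hp.comp hc)⟩

variable [OpensMeasurableSpace Z]

theorem SchwartzIntegrable.integrable_eval (hG : SchwartzIntegrable G μ) (y : E) :
    Integrable (fun z => G z y) μ :=
  (hG.2 _ (continuous_schwartz_seminorm 0 0)).mono'
    ((continuous_schwartz_eval y).comp hG.1).aestronglyMeasurable
    (ae_of_all _ fun z => SchwartzMap.norm_le_seminorm ℂ (G z) y)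

/-- Differentiation under the integral sign along t ↦ y + t v. The seminorm of order (0, 0) of the
derivative does not depend on t and serves as the integrable majorant. -/
theorem SchwartzIntegrable.integral_lineDerivOp (hG : SchwartzIntegrable G μ) {Ψ : 𝓢(E, ℂ)}
    (hΨ : ∀ y, ∫ z, G z y ∂μ = Ψ y) (v y : E) :
    ∫ z, LineDeriv.lineDerivOp v (G z) y ∂μ = LineDeriv.lineDerivOp v Ψ y := by
  have hder : ∀ (u : 𝓢(E, ℂ)) (t : ℝ),
      HasDerivAt (fun t : ℝ => u (y + t • v)) (LineDeriv.lineDerivOp v u (y + t • v)) t := by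
    intro u t
    rw [SchwartzMap.lineDerivOp_apply_eq_fderiv]
    have h1 : HasDerivAt (fun t : ℝ => y + t • v) v t := by
      simpa using ((hasDerivAt_id t).smul_const v).const_add y
    exact (u.hasFDerivAt (y + t • v)).comp_hasDerivAt t h1
  have hG' := hG.lineDerivOp v
  have hd := hasDerivAt_integral_of_dominated_loc_of_deriv_le (μ := μ) (s := Set.univ)
    (F := fun (t : ℝ) z => G z (y + t • v)) (x₀ := 0)
    (F' := fun (t : ℝ) z => LineDeriv.lineDerivOp v (G z) (y + t • v)) Filter.univ_mem
    (Filter.Eventually.of_forall fun t => (hG.integrable_eval _).aestronglyMeasurable)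
    (hG.integrable_eval _) (hG'.integrable_eval _).aestronglyMeasurable
    (ae_of_all _ fun z t _ => SchwartzMap.norm_le_seminorm ℂ _ _)
    (hG'.2 _ (continuous_schwartz_seminorm 0 0)) (ae_of_all _ fun z t _ => hder (G z) t)
  have h2 := hd.2
  simp_rw [hΨ] at h2
  simpa using h2.unique (hder Ψ 0)

theorem SchwartzIntegrable.integral_iteratedFDeriv (hG : SchwartzIntegrable G μ) {Ψ : 𝓢(E, ℂ)}
    (hΨ : ∀ y, ∫ z, G z y ∂μ = Ψ y) {n : ℕ} (m : Fin n → E) (y : E) :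
    ∫ z, iteratedFDeriv ℝ n (G z) y m ∂μ = iteratedFDeriv ℝ n Ψ y m := by
  simp_rw [← SchwartzMap.iteratedLineDerivOp_eq_iteratedFDeriv]
  suffices h : SchwartzIntegrable (fun z => LineDeriv.iteratedLineDerivOp m (G z)) μ ∧
      ∀ y, ∫ z, LineDeriv.iteratedLineDerivOp m (G z) y ∂μ =
        LineDeriv.iteratedLineDerivOp m Ψ y from h.2 y
  induction n with
  | zero => simpa [LineDeriv.iteratedLineDerivOp_fin_zero] using ⟨hG, hΨ⟩
  | succ n ih =>
    simp_rw [LineDeriv.iteratedLineDerivOp_succ_left]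
    obtain ⟨h1, h2⟩ := ih (Fin.tail m)
    exact ⟨h1.lineDerivOp _, h1.integral_lineDerivOp h2 _⟩

variable [SecondCountableTopology Z]

/-- Continuous functionals commute with the pointwise integral of a Schwartz-valued map. -/
theorem SchwartzIntegrable.integrable_integral_apply (hG : SchwartzIntegrable G μ) {Ψ : 𝓢(E, ℂ)}
    (hΨ : ∀ y, ∫ z, G z y ∂μ = Ψ y) (f : 𝓢(E, ℂ) →L[ℂ] ℂ) :
    Integrable (fun z => f (G z)) μ ∧ ∫ z, f (G z) ∂μ = f Ψ := by
  -- The Schwartz space is not normed, so the Bochner integral is taken in the finite product of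
  -- Banach spaces through which f factors. There the integral is identified pointwise, which is
  -- differentiation under the integral sign.
  obtain ⟨t, L, hL⟩ := exists_factor_weightedDeriv f
  have hi : ∀ i : t, Integrable (fun z => weightedDerivLM i.1.1 i.1.2 (G z)) μ := fun i =>
    (hG.2 _ (continuous_schwartz_seminorm i.1.1 i.1.2)).mono'
      ((continuous_weightedDerivLM i.1.1 i.1.2).comp hG.1).aestronglyMeasurable
      (ae_of_all _ fun z => norm_weightedDerivLM_le _ _ _)
  have hI : Integrable (fun z => fun i : t => weightedDerivLM i.1.1 i.1.2 (G z)) μ :=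
    Integrable.of_eval hi
  have heq : ∫ z, (fun i : t => weightedDerivLM i.1.1 i.1.2 (G z)) ∂μ =
      fun i : t => weightedDerivLM i.1.1 i.1.2 Ψ := by
    funext i
    rw [eval_integral hi]
    ext1 w
    refine ((BoundedContinuousFunction.evalCLM ℂ (β := ℂ) w).integral_comp_comm (hi i)).symm.trans ?_
    change ∫ z, (‖w.1‖ ^ i.1.1) • iteratedFDeriv ℝ i.1.2 (G z) w.1 (fun j => w.2 j) ∂μ =
      (‖w.1‖ ^ i.1.1) • iteratedFDeriv ℝ i.1.2 Ψ w.1 fun j => w.2 j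
    rw [integral_smul, hG.integral_iteratedFDeriv hΨ]
  simp_rw [hL]
  exact ⟨L.integrable_comp hI, by rw [L.integral_comp_comm hI, heq]⟩

end WeakIntegral

/-! ### Estimates for the short-time Fourier transform -/

/-- A Schwartz function as a tempered distribution. -/
abbrev ofSchwartz (u : 𝓢(Rn d, ℂ)) : 𝓢'(Rn d, ℂ) :=
  SchwartzMap.toTemperedDistributionCLM (Rn d) ℂ volume u

theorem ofSchwartz_apply (u v : 𝓢(Rn d, ℂ)) : ofSchwartz u v = ∫ y, v y * u y := by
  rw [ofSchwartz, SchwartzMap.toTemperedDistributionCLM_apply_apply volume]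
  simp [smul_eq_mul]

theorem conjSchwartz_apply (g : 𝓢(Rn d, ℂ)) (y : Rn d) :
    conjSchwartz g y = (starRingEnd ℂ) (g y) := by
  simp [conjSchwartz, SchwartzMap.postcompCLM_apply]

theorem norm_stftAtom_apply (g : 𝓢(Rn d, ℂ)) (x ξ y : Rn d) :
    ‖stftAtom g x ξ y‖ = ‖g (y - x)‖ := by
  rw [stftAtom_apply, norm_mul, RCLike.norm_conj]
  have : (-(Complex.I * ((⟪y, ξ⟫_ℝ : ℝ) : ℂ))) = ((-⟪y, ξ⟫_ℝ : ℝ) : ℂ) * Complex.I := by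
    push_cast; ring
  rw [this, Complex.norm_exp_ofReal_mul_I, one_mul]

theorem lineDerivOp_stftAtom (g : 𝓢(Rn d, ℂ)) (x ξ v : Rn d) :
    LineDeriv.lineDerivOp v (stftAtom g x ξ) =
      (-(Complex.I * ((⟪v, ξ⟫_ℝ : ℝ) : ℂ))) • stftAtom g x ξ +
        stftAtom (LineDeriv.lineDerivOp v g) x ξ := by
  ext y
  have h1 : HasDerivAt (fun t : ℝ => Complex.exp (-(Complex.I * ((⟪y + t • v, ξ⟫_ℝ : ℝ) : ℂ))))
      (Complex.exp (-(Complex.I * ((⟪y, ξ⟫_ℝ : ℝ) : ℂ))) *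
        (-(Complex.I * ((⟪v, ξ⟫_ℝ : ℝ) : ℂ)))) 0 := by
    have h0 : HasDerivAt (fun t : ℝ => ⟪y + t • v, ξ⟫_ℝ) (⟪v, ξ⟫_ℝ) 0 := by
      have : (fun t : ℝ => ⟪y + t • v, ξ⟫_ℝ) = fun t : ℝ => ⟪y, ξ⟫_ℝ + t * ⟪v, ξ⟫_ℝ := by
        funext t
        rw [inner_add_left, real_inner_smul_left]
      rw [this]
      simpa using ((hasDerivAt_id (0 : ℝ)).mul_const (⟪v, ξ⟫_ℝ)).const_add (⟪y, ξ⟫_ℝ)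
    have h := ((h0.ofReal_comp.const_mul Complex.I).fun_neg).cexp
    simpa using h
  have h2 : HasDerivAt (fun t : ℝ => (starRingEnd ℂ) (g (y + t • v - x)))
      ((starRingEnd ℂ) (LineDeriv.lineDerivOp v g (y - x))) 0 := by
    have h0 : HasDerivAt (fun t : ℝ => y + t • v - x) v 0 := by
      simpa using (((hasDerivAt_id (0 : ℝ)).smul_const v).const_add y).sub_const x
    have h3 : HasFDerivAt g (fderiv ℝ g (y - x)) (y + (0 : ℝ) • v - x) := by
      simpa using g.hasFDerivAt (y - x)
    have h4 := h3.comp_hasDerivAt (0 : ℝ) h0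
    rw [SchwartzMap.lineDerivOp_apply_eq_fderiv]
    exact (Complex.conjCLE : ℂ →L[ℝ] ℂ).hasFDerivAt.comp_hasDerivAt (0 : ℝ) h4
  rw [SchwartzMap.lineDerivOp_apply, lineDeriv]
  simp_rw [stftAtom_apply]
  have h := h1.fun_mul h2
  rw [h.deriv]
  simp only [add_apply, smul_apply, stftAtom_apply, smul_eq_mul, zero_smul, add_zero]
  ring

/-- Integration by parts against the atom. It trades one power of ξ for a derivative on the function
or on the window, which is the source of all decay in frequency. -/
theorem ofSchwartz_lineDerivOp_stftAtom (g u : 𝓢(Rn d, ℂ)) (x ξ v : Rn d) :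
    Complex.I * ((⟪v, ξ⟫_ℝ : ℝ) : ℂ) * stft g (ofSchwartz u) x ξ =
      stft g (ofSchwartz (LineDeriv.lineDerivOp v u)) x ξ +
        stft (LineDeriv.lineDerivOp v g) (ofSchwartz u) x ξ := by
  have h := SchwartzMap.integral_mul_lineDerivOp_right_eq_neg_left (μ := volume)
    (stftAtom g x ξ) u v
  have h2 : ∫ y, LineDeriv.lineDerivOp v (stftAtom g x ξ) y * u y =
      ofSchwartz u (LineDeriv.lineDerivOp v (stftAtom g x ξ)) := (ofSchwartz_apply _ _).symm
  rw [h2, lineDerivOp_stftAtom, map_add, map_smul] at h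
  simp only [stft]
  rw [ofSchwartz_apply (LineDeriv.lineDerivOp v u), h, smul_eq_mul]
  ring

theorem norm_le_sum_abs (ξ : Rn d) : ‖ξ‖ ≤ ∑ i, |ξ i| := by
  have h := (EuclideanSpace.basisFun (Fin d) ℝ).sum_repr ξ
  calc ‖ξ‖ = ‖∑ i, (EuclideanSpace.basisFun (Fin d) ℝ).repr ξ i •
        (EuclideanSpace.basisFun (Fin d) ℝ) i‖ := by rw [h]
    _ ≤ ∑ i, ‖(EuclideanSpace.basisFun (Fin d) ℝ).repr ξ i •
        (EuclideanSpace.basisFun (Fin d) ℝ) i‖ := norm_sum_le _ _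
    _ = _ := by
      refine Finset.sum_congr rfl fun i _ => ?_
      rw [norm_smul, (EuclideanSpace.basisFun (Fin d) ℝ).norm_eq_one, mul_one]
      simp

theorem one_add_pow_le (K : ℕ) {t : ℝ} (ht : 0 ≤ t) : (1 + t) ^ K ≤ 2 ^ K * (1 + t ^ K) := by
  calc (1 + t) ^ K ≤ 2 ^ (K - 1) * (1 ^ K + t ^ K) := add_pow_le zero_le_one ht K
    _ ≤ _ := by
      rw [one_pow]
      gcongr
      · norm_num
      · omega

theorem one_add_norm_pow_mul_norm_le (K : ℕ) (u : 𝓢(Rn d, ℂ)) (y : Rn d) :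
    (1 + ‖y‖) ^ K * ‖u y‖ ≤
      2 ^ K * (SchwartzMap.seminorm ℂ 0 0 u + SchwartzMap.seminorm ℂ K 0 u) := by
  have h1 := SchwartzMap.norm_le_seminorm ℂ u y
  have h2 := SchwartzMap.norm_pow_mul_le_seminorm ℂ u K y
  have h3 := one_add_pow_le K (norm_nonneg y)
  calc (1 + ‖y‖) ^ K * ‖u y‖ ≤ 2 ^ K * (1 + ‖y‖ ^ K) * ‖u y‖ := by gcongr
    _ = 2 ^ K * (‖u y‖ + ‖y‖ ^ K * ‖u y‖) := by ring
    _ ≤ _ := by gcongr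

theorem continuous_finset_sum_seminorm {ι : Type*} (t : Finset ι)
    (p : ι → Seminorm ℂ 𝓢(Rn d, ℂ)) (hp : ∀ i, Continuous (p i)) :
    Continuous (∑ i ∈ t, p i : Seminorm ℂ 𝓢(Rn d, ℂ)) := by
  classical
  induction t using Finset.induction_on with
  | empty =>
    change Continuous fun _ : 𝓢(Rn d, ℂ) => (0 : ℝ)
    exact continuous_const
  | insert a t ha ih =>
    rw [Finset.sum_insert ha]
    exact (hp a).add ih

theorem seminorm_finset_sum_apply {ι : Type*} (t : Finset ι)
    (p : ι → Seminorm ℂ 𝓢(Rn d, ℂ)) (u : 𝓢(Rn d, ℂ)) :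
    (∑ i ∈ t, p i) u = ∑ i ∈ t, p i u := by
  classical
  induction t using Finset.induction_on with
  | empty => simp
  | insert a t ha ih =>
    rw [Finset.sum_insert ha, Finset.sum_insert ha, ← ih]
    rfl

/-- The short-time Fourier transform of a Schwartz function decays rapidly, with constants that
depend continuously on the function. -/
theorem exists_seminorm_stft_decay (K N : ℕ) (g : 𝓢(Rn d, ℂ)) :
    ∃ p : Seminorm ℂ 𝓢(Rn d, ℂ), Continuous p ∧ ∀ u x ξ,
      (1 + ‖x‖) ^ K * (1 + ‖ξ‖) ^ N * ‖stft g (ofSchwartz u) x ξ‖ ≤ p u := by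
  -- The window must vary, since each integration by parts also differentiates g.
  induction N generalizing g with
  | zero =>
    set q : Seminorm ℂ 𝓢(Rn d, ℂ) :=
      SchwartzMap.seminorm ℂ 0 0 + SchwartzMap.seminorm ℂ K 0 with hq
    have hqc : Continuous q :=
      (continuous_schwartz_seminorm 0 0).add (continuous_schwartz_seminorm K 0)
    have hint : Integrable (fun y => (1 + ‖y‖) ^ K * ‖g y‖) (volume : Measure (Rn d)) := by
      have h1 := g.integrable_pow_mul (volume : Measure (Rn d)) 0
      have h2 := g.integrable_pow_mul (volume : Measure (Rn d)) K
      refine ((h1.add h2).const_mul (2 ^ K)).mono' (by fun_prop) (ae_of_all _ fun y => ?_)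
      rw [Real.norm_of_nonneg (by positivity)]
      have h3 := one_add_pow_le K (norm_nonneg y)
      calc (1 + ‖y‖) ^ K * ‖g y‖ ≤ 2 ^ K * (1 + ‖y‖ ^ K) * ‖g y‖ := by gcongr
        _ = _ := by simp; ring
    set S := ∫ y, (1 + ‖y‖) ^ K * ‖g y‖ with hS
    have hS0 : 0 ≤ S := integral_nonneg fun y => by positivity
    refine ⟨Real.toNNReal (2 ^ K * S) • q, hqc.const_smul (Real.toNNReal (2 ^ K * S)), fun u x ξ => ?_⟩
    have hle : ∀ y, (1 + ‖x‖) ^ K * ‖stftAtom g x ξ y * u y‖ ≤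
        ((1 + ‖y - x‖) ^ K * ‖g (y - x)‖) * (2 ^ K * q u) := by
      intro y
      have h1 := one_add_norm_pow_mul_norm_le K u y
      -- Submultiplicativity of 1 + |·| splits the weight in x between the window, at y - x, and the
      -- function, at y.
      have h4 : 1 + ‖x‖ ≤ (1 + ‖y - x‖) * (1 + ‖y‖) := by
        have : ‖x‖ ≤ ‖y - x‖ + ‖y‖ := by
          have := norm_sub_le y (y - x)
          rw [sub_sub_cancel] at this
          linarith
        nlinarith [norm_nonneg (y - x), norm_nonneg y,
          mul_nonneg (norm_nonneg (y - x)) (norm_nonneg y)]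
      rw [norm_mul, norm_stftAtom_apply]
      calc (1 + ‖x‖) ^ K * (‖g (y - x)‖ * ‖u y‖)
          ≤ ((1 + ‖y - x‖) * (1 + ‖y‖)) ^ K * (‖g (y - x)‖ * ‖u y‖) := by gcongr
        _ = ((1 + ‖y - x‖) ^ K * ‖g (y - x)‖) * ((1 + ‖y‖) ^ K * ‖u y‖) := by
          rw [mul_pow]; ring
        _ ≤ _ := mul_le_mul_of_nonneg_left h1 (by positivity)
    rw [pow_zero, mul_one, stft, ofSchwartz_apply]
    calc (1 + ‖x‖) ^ K * ‖∫ y, stftAtom g x ξ y * u y‖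
        ≤ (1 + ‖x‖) ^ K * ∫ y, ‖stftAtom g x ξ y * u y‖ := by
          gcongr; exact norm_integral_le_integral_norm _
      _ = ∫ y, (1 + ‖x‖) ^ K * ‖stftAtom g x ξ y * u y‖ := (integral_const_mul _ _).symm
      _ ≤ ∫ y, ((1 + ‖y - x‖) ^ K * ‖g (y - x)‖) * (2 ^ K * q u) :=
          integral_mono_of_nonneg (ae_of_all _ fun y => by positivity)
            ((hint.comp_sub_right x).mul_const _) (ae_of_all _ hle)
      _ = S * (2 ^ K * q u) := by
          rw [integral_mul_const, hS, integral_sub_right_eq_self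
            (fun y => (1 + ‖y‖) ^ K * ‖g y‖) x]
      _ = (2 ^ K * S) * q u := by ring
      _ = (Real.toNNReal (2 ^ K * S) : ℝ) * q u := by rw [Real.coe_toNNReal _ (by positivity)]
  | succ N ih =>
    obtain ⟨p, hp, hpb⟩ := ih g
    let e := fun i => EuclideanSpace.basisFun (Fin d) ℝ i
    choose r hr hrb using fun i : Fin d => ih (LineDeriv.lineDerivOp (e i) g)
    let D := fun i => LineDeriv.lineDerivOpCLM ℂ 𝓢(Rn d, ℂ) (e i)
    refine ⟨p + ∑ i, (p.comp (D i).toLinearMap + r i), hp.add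
      (continuous_finset_sum_seminorm _ _ fun i => (hp.comp (D i).continuous).add (hr i)),
      fun u x ξ => ?_⟩
    have hi : ∀ i, (1 + ‖x‖) ^ K * (1 + ‖ξ‖) ^ N * (|ξ i| * ‖stft g (ofSchwartz u) x ξ‖) ≤
        (p.comp (D i).toLinearMap + r i) u := by
      intro i
      have h := congrArg norm (ofSchwartz_lineDerivOp_stftAtom g u x ξ (e i))
      have he : ⟪e i, ξ⟫_ℝ = ξ i := by
        simp only [e, EuclideanSpace.basisFun_apply, EuclideanSpace.inner_single_left]
        simp
      rw [he, norm_mul, norm_mul, Complex.norm_I, one_mul, Complex.norm_real, Real.norm_eq_abs] at h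
      rw [h]
      calc _ ≤ (1 + ‖x‖) ^ K * (1 + ‖ξ‖) ^ N *
            (‖stft g (ofSchwartz (LineDeriv.lineDerivOp (e i) u)) x ξ‖ +
              ‖stft (LineDeriv.lineDerivOp (e i) g) (ofSchwartz u) x ξ‖) := by
            gcongr; exact norm_add_le _ _
        _ ≤ _ := by
            rw [mul_add]
            exact add_le_add (hpb _ x ξ) (hrb i u x ξ)
    calc (1 + ‖x‖) ^ K * (1 + ‖ξ‖) ^ (N + 1) * ‖stft g (ofSchwartz u) x ξ‖
        = (1 + ‖x‖) ^ K * (1 + ‖ξ‖) ^ N * ((1 + ‖ξ‖) * ‖stft g (ofSchwartz u) x ξ‖) := by ring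
      _ ≤ (1 + ‖x‖) ^ K * (1 + ‖ξ‖) ^ N * ((1 + ∑ i, |ξ i|) * ‖stft g (ofSchwartz u) x ξ‖) := by
          gcongr; exact norm_le_sum_abs ξ
      _ = (1 + ‖x‖) ^ K * (1 + ‖ξ‖) ^ N * ‖stft g (ofSchwartz u) x ξ‖ +
          ∑ i, (1 + ‖x‖) ^ K * (1 + ‖ξ‖) ^ N * (|ξ i| * ‖stft g (ofSchwartz u) x ξ‖) := by
          rw [← Finset.mul_sum, ← Finset.sum_mul]; ring
      _ ≤ p u + ∑ i, (p.comp (D i).toLinearMap + r i) u :=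
          add_le_add (hpb u x ξ) (Finset.sum_le_sum fun i _ => hi i)
      _ = _ := by rw [← seminorm_finset_sum_apply]; rfl

/-- By the Leibniz rule: derivatives of the exponential cost at most n powers of 1 + |ξ|, and
translating the window by x costs (1 + |x|)^K. -/
theorem exists_seminorm_stftAtom_growth_aux (g : 𝓢(Rn d, ℂ)) (K n : ℕ) :
    ∃ C : ℝ, 0 ≤ C ∧ ∀ x ξ : Rn d,
      SchwartzMap.seminorm ℂ K n (stftAtom g x ξ) ≤ C * ((1 + ‖x‖) ^ K * (1 + ‖ξ‖) ^ n) := by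
  set h := conjSchwartz g with hh
  set S := 2 ^ K * (Finset.Iic (K, n)).sup (fun m => SchwartzMap.seminorm ℂ m.1 m.2) h with hS
  have hS0 : 0 ≤ S := by positivity
  refine ⟨∑ i ∈ Finset.range (n + 1), (n.choose i : ℝ) * S, by positivity, fun x ξ => ?_⟩
  refine SchwartzMap.seminorm_le_bound ℂ K n _ (by positivity) fun y => ?_
  have hfun : (stftAtom g x ξ : Rn d → ℂ) = fun y => expNeg ξ y * h (y - x) := by
    funext y
    rw [stftAtom, SchwartzMap.smulLeftCLM_apply_apply (hasTemperateGrowth_expNeg ξ)]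
    simp [hh]
  have hsm : ContDiff ℝ ∞ (fun y => h (y - x)) :=
    (h.smooth ⊤).comp (contDiff_id.sub contDiff_const)
  have hle := norm_iteratedFDeriv_mul_le (contDiff_expNeg ξ) hsm y (n := n)
    (by exact_mod_cast le_top)
  rw [hfun, Finset.sum_mul]
  calc ‖y‖ ^ K * ‖iteratedFDeriv ℝ n (fun y => expNeg ξ y * h (y - x)) y‖
      ≤ ‖y‖ ^ K * ∑ i ∈ Finset.range (n + 1), (n.choose i : ℝ) *
          ‖iteratedFDeriv ℝ i (expNeg ξ) y‖ *
          ‖iteratedFDeriv ℝ (n - i) (fun y => h (y - x)) y‖ := by gcongr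
    _ = ∑ i ∈ Finset.range (n + 1), (n.choose i : ℝ) *
          ‖iteratedFDeriv ℝ i (expNeg ξ) y‖ *
          (‖y‖ ^ K * ‖iteratedFDeriv ℝ (n - i) (fun y => h (y - x)) y‖) := by
        rw [Finset.mul_sum]
        exact Finset.sum_congr rfl fun i _ => by ring
    _ ≤ _ := by
        refine Finset.sum_le_sum fun i hi => ?_
        have hin : i ≤ n := by simpa [Nat.lt_succ_iff] using hi
        have h1 : ‖iteratedFDeriv ℝ i (expNeg ξ) y‖ ≤ (1 + ‖ξ‖) ^ n := by
          refine (norm_iteratedFDeriv_expNeg_le ξ i y).trans ?_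
          calc ‖ξ‖ ^ i ≤ (1 + ‖ξ‖) ^ i := by gcongr; linarith
            _ ≤ _ := pow_le_pow_right₀ (by linarith [norm_nonneg ξ]) hin
        have h2 : ‖y‖ ^ K * ‖iteratedFDeriv ℝ (n - i) (fun y => h (y - x)) y‖ ≤
            (1 + ‖x‖) ^ K * S := by
          rw [iteratedFDeriv_comp_sub]
          have h3 := SchwartzMap.one_add_le_sup_seminorm_apply (𝕜 := ℂ) (m := (K, n))
            (k := K) (n := n - i) le_rfl (Nat.sub_le n i) h (y - x)
          have h4 : ‖y‖ ≤ (1 + ‖x‖) * (1 + ‖y - x‖) := by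
            have : ‖y‖ ≤ ‖y - x‖ + ‖x‖ := by simpa using norm_add_le (y - x) x
            nlinarith [norm_nonneg (y - x), norm_nonneg x,
              mul_nonneg (norm_nonneg x) (norm_nonneg (y - x))]
          calc ‖y‖ ^ K * ‖iteratedFDeriv ℝ (n - i) (⇑h) (y - x)‖
              ≤ ((1 + ‖x‖) * (1 + ‖y - x‖)) ^ K * ‖iteratedFDeriv ℝ (n - i) (⇑h) (y - x)‖ := by
                gcongr
            _ = (1 + ‖x‖) ^ K * ((1 + ‖y - x‖) ^ K * ‖iteratedFDeriv ℝ (n - i) (⇑h) (y - x)‖) := by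
                rw [mul_pow]; ring
            _ ≤ _ := by gcongr
        calc _ ≤ (n.choose i : ℝ) * (1 + ‖ξ‖) ^ n * ((1 + ‖x‖) ^ K * S) := by gcongr
          _ = _ := by ring

/-- The weight `(1 + |x|)^N (1 + |ξ|)^N`. -/
def phaseWeight (N : ℕ) (x ξ : Rn d) : ℝ := (1 + ‖x‖) ^ N * (1 + ‖ξ‖) ^ N

theorem phaseWeight_pos (N : ℕ) (x ξ : Rn d) : 0 < phaseWeight N x ξ := by
  unfold phaseWeight; positivity

theorem phaseWeight_add (M N : ℕ) (x ξ : Rn d) :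
    phaseWeight (M + N) x ξ = phaseWeight M x ξ * phaseWeight N x ξ := by
  unfold phaseWeight; ring

theorem phaseWeight_mono {M N : ℕ} (h : M ≤ N) (x ξ : Rn d) :
    phaseWeight M x ξ ≤ phaseWeight N x ξ := by
  unfold phaseWeight
  gcongr <;> linarith [norm_nonneg x, norm_nonneg ξ]

/-- Time-frequency shifts have seminorms of polynomial growth. -/
theorem exists_seminorm_stftAtom_growth (g : 𝓢(Rn d, ℂ)) (p : Seminorm ℂ 𝓢(Rn d, ℂ))
    (hp : Continuous p) :
    ∃ (C : ℝ) (N : ℕ), 0 ≤ C ∧ ∀ x ξ : Rn d, p (stftAtom g x ξ) ≤ C * phaseWeight N x ξ := by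
  obtain ⟨t, C, -, hC⟩ := Seminorm.bound_of_continuous (schwartz_withSeminorms ℂ (Rn d) ℂ) p hp
  choose D hD0 hD using fun i : ℕ × ℕ => exists_seminorm_stftAtom_growth_aux g i.1 i.2
  refine ⟨C * ∑ i ∈ t, D i, ∑ i ∈ t, (i.1 + i.2),
    mul_nonneg C.2 (Finset.sum_nonneg fun i _ => hD0 i), fun x ξ => ?_⟩
  refine (hC _).trans ?_
  change (C : ℝ) * _ ≤ _
  rw [mul_assoc]
  gcongr
  refine Seminorm.finset_sup_apply_le
    (mul_nonneg (Finset.sum_nonneg fun i _ => hD0 i) (phaseWeight_pos _ _ _).le) fun i hi => ?_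
  have h1 : D i ≤ ∑ i ∈ t, D i := Finset.single_le_sum (fun i _ => hD0 i) hi
  have h2 : i.1 + i.2 ≤ ∑ i ∈ t, (i.1 + i.2) :=
    Finset.single_le_sum (f := fun i : ℕ × ℕ => i.1 + i.2) (fun i _ => Nat.zero_le _) hi
  refine (hD i x ξ).trans ?_
  have hx := norm_nonneg x
  have hξ := norm_nonneg ξ
  have h3 : (1 + ‖x‖) ^ i.1 * (1 + ‖ξ‖) ^ i.2 ≤ phaseWeight (∑ i ∈ t, (i.1 + i.2)) x ξ := by
    refine le_trans ?_ (phaseWeight_mono h2 x ξ)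
    unfold phaseWeight
    gcongr <;> linarith
  exact mul_le_mul h1 h3 (by positivity) (Finset.sum_nonneg fun i _ => hD0 i)

theorem exists_stft_decay (N : ℕ) (g : 𝓢(Rn d, ℂ)) :
    ∃ p : Seminorm ℂ 𝓢(Rn d, ℂ), Continuous p ∧ ∀ u x ξ,
      ‖stft g (ofSchwartz u) x ξ‖ ≤ p u * (phaseWeight N x ξ)⁻¹ := by
  obtain ⟨p, hp, h⟩ := exists_seminorm_stft_decay N N g
  refine ⟨p, hp, fun u x ξ => ?_⟩
  rw [← div_eq_mul_inv, le_div_iff₀ (phaseWeight_pos N x ξ), mul_comm]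
  exact h u x ξ

theorem exists_integrable_phaseWeight_inv :
    ∃ M : ℕ, Integrable (fun z : Rn d × Rn d => (phaseWeight M z.1 z.2)⁻¹) volume := by
  -- In dimension d, (1 + |x|)^{-r} is integrable as soon as r > d; the weight is a product of one
  -- such factor in x and one in ξ.
  refine ⟨d + 1, ?_⟩
  have h := integrable_one_add_norm (E := Rn d) (μ := volume) (r := (d + 1 : ℝ)) (by simp)
  have h2 := h.mul_prod h
  refine h2.congr (ae_of_all _ fun z => ?_)
  simp only [phaseWeight, mul_inv]
  rw [Real.rpow_neg (by positivity), Real.rpow_neg (by positivity)]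
  norm_cast

/-! ### Inversion of the short-time Fourier transform -/

/-- The time-frequency shift `y ↦ exp (i y · ξ) g (y - x)` of the window. -/
def gaborAtom (g : 𝓢(Rn d, ℂ)) (x ξ : Rn d) : 𝓢(Rn d, ℂ) := stftAtom (conjSchwartz g) x (-ξ)

theorem gaborAtom_apply (g : 𝓢(Rn d, ℂ)) (x ξ y : Rn d) :
    gaborAtom g x ξ y = Complex.exp (Complex.I * ((⟪y, ξ⟫_ℝ : ℝ) : ℂ)) * g (y - x) := by
  rw [gaborAtom, stftAtom_apply, conjSchwartz_apply]
  simp [inner_neg_right]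

theorem conj_stftAtom_apply (g : 𝓢(Rn d, ℂ)) (x ξ y : Rn d) :
    (starRingEnd ℂ) (stftAtom g x ξ y) = gaborAtom g x ξ y := by
  rw [gaborAtom_apply, stftAtom_apply, map_mul, ← Complex.exp_conj]
  simp

theorem continuous_gaborAtom (g : 𝓢(Rn d, ℂ)) :
    Continuous fun z : Rn d × Rn d => gaborAtom g z.1 z.2 :=
  (continuous_stftAtom (conjSchwartz g)).comp
    (f := fun z : Rn d × Rn d => (z.1, -z.2)) (by fun_prop)

theorem phaseWeight_neg (N : ℕ) (x ξ : Rn d) : phaseWeight N x (-ξ) = phaseWeight N x ξ := by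
  simp [phaseWeight]

theorem exists_gabor_decay (N : ℕ) (g : 𝓢(Rn d, ℂ)) :
    ∃ p : Seminorm ℂ 𝓢(Rn d, ℂ), Continuous p ∧ ∀ u x ξ,
      ‖ofSchwartz u (gaborAtom g x ξ)‖ ≤ p u * (phaseWeight N x ξ)⁻¹ := by
  obtain ⟨p, hp, h⟩ := exists_stft_decay N (conjSchwartz g)
  refine ⟨p, hp, fun u x ξ => ?_⟩
  have := h u x (-ξ)
  rwa [phaseWeight_neg] at this

theorem continuous_ofSchwartz_gaborAtom (g u : 𝓢(Rn d, ℂ)) :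
    Continuous fun z : Rn d × Rn d => ofSchwartz u (gaborAtom g z.1 z.2) :=
  (ofSchwartz u).continuous.comp (continuous_gaborAtom g)

/-- The seminorms of the atoms grow polynomially, of some order N, while the coefficients decay
faster than any power. Decay of order N + M absorbs the growth and leaves an integrable function. -/
theorem schwartzIntegrable_smul_stftAtom (g u : 𝓢(Rn d, ℂ)) :
    SchwartzIntegrable
      (fun z : Rn d × Rn d => ofSchwartz u (gaborAtom g z.1 z.2) • stftAtom g z.1 z.2) volume := by
  refine ⟨(continuous_ofSchwartz_gaborAtom g u).smul (continuous_stftAtom g), fun p hp => ?_⟩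
  obtain ⟨C, N, hC, hN⟩ := exists_seminorm_stftAtom_growth g p hp
  obtain ⟨M, hM⟩ := exists_integrable_phaseWeight_inv (d := d)
  obtain ⟨r, hr, hrb⟩ := exists_gabor_decay (N + M) g
  refine (hM.const_mul (r u * C)).mono' ?_ (ae_of_all _ fun z => ?_)
  · exact (hp.comp ((continuous_ofSchwartz_gaborAtom g u).smul
      (continuous_stftAtom g))).aestronglyMeasurable
  · rw [Real.norm_of_nonneg (apply_nonneg _ _), map_smul_eq_mul]
    have h1 := phaseWeight_pos N z.1 z.2
    have h2 := phaseWeight_pos M z.1 z.2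
    calc _ ≤ (r u * (phaseWeight (N + M) z.1 z.2)⁻¹) * (C * phaseWeight N z.1 z.2) := by
          gcongr
          · exact mul_nonneg (apply_nonneg _ _) (inv_nonneg.2 (phaseWeight_pos _ _ _).le)
          · exact hrb u z.1 z.2
          · exact hN z.1 z.2
      _ = _ := by
          rw [phaseWeight_add]
          field_simp

/-- The constant `(2π)^d ‖g‖²` of the inversion formula. -/
def inversionConst (g : 𝓢(Rn d, ℂ)) : ℝ := (2 * Real.pi) ^ d * ∫ y, ‖g y‖ ^ 2

theorem inversionConst_pos {g : 𝓢(Rn d, ℂ)} (hg : g ≠ 0) : 0 < inversionConst g := by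
  refine mul_pos (by positivity) ?_
  have hc : Continuous fun y => ‖g y‖ ^ 2 := by fun_prop
  have hint : Integrable (fun y => ‖g y‖ ^ 2) (volume : Measure (Rn d)) :=
    (memLp_two_iff_integrable_sq_norm g.continuous.aestronglyMeasurable).1 (g.memLp 2 volume)
  obtain ⟨y, hy⟩ : ∃ y, g y ≠ 0 := by
    by_contra! h
    exact hg (SchwartzMap.ext h)
  exact integral_pos_of_integrable_nonneg_nonzero hc hint (fun _ => by positivity) (x := y)
    (by positivity)

/-- Fourier inversion in the normalisation without 2π in the exponent; the substitution ξ ↦ 2πξ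
reduces it to the standard one and produces the Jacobian (2π)^d. -/
theorem integral_fourierInv_scaled (w : 𝓢(Rn d, ℂ)) (y : Rn d) :
    ∫ ξ : Rn d, (∫ t, Complex.exp (Complex.I * ((⟪t, ξ⟫_ℝ : ℝ) : ℂ)) * w t) *
      Complex.exp (-(Complex.I * ((⟪y, ξ⟫_ℝ : ℝ) : ℂ))) = (2 * Real.pi) ^ d * w y := by
  have hpi : (0 : ℝ) < 2 * Real.pi := by positivity
  have hsc : ∀ ξ : Rn d, (∫ t, Complex.exp (Complex.I * ((⟪t, (2 * Real.pi) • ξ⟫_ℝ : ℝ) : ℂ)) * w t)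
      = FourierTransformInv.fourierInv w ξ := by
    intro ξ
    rw [SchwartzMap.fourierInv_coe, Real.fourierInv_eq']
    refine integral_congr_ae (ae_of_all _ fun t => ?_)
    simp only [smul_eq_mul, real_inner_smul_right]
    congr 2
    push_cast; ring
  have h := Measure.integral_comp_smul (volume : Measure (Rn d)) (fun ξ : Rn d =>
    (∫ t, Complex.exp (Complex.I * ((⟪t, ξ⟫_ℝ : ℝ) : ℂ)) * w t) *
      Complex.exp (-(Complex.I * ((⟪y, ξ⟫_ℝ : ℝ) : ℂ)))) (2 * Real.pi)
  have h2 : ∫ ξ : Rn d, (∫ t, Complex.exp (Complex.I * ((⟪t, (2 * Real.pi) • ξ⟫_ℝ : ℝ) : ℂ)) * w t) *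
      Complex.exp (-(Complex.I * ((⟪y, (2 * Real.pi) • ξ⟫_ℝ : ℝ) : ℂ))) = w y := by
    simp_rw [hsc]
    have h3 : FourierTransform.fourier (FourierTransformInv.fourierInv w) y = w y := by
      rw [FourierTransform.fourier_fourierInv_eq]
    rw [SchwartzMap.fourier_coe, Real.fourier_eq'] at h3
    rw [← h3]
    refine integral_congr_ae (ae_of_all _ fun t => ?_)
    simp only [smul_eq_mul, real_inner_smul_right]
    rw [mul_comm, real_inner_comm]
    congr 2
    push_cast; ring
  rw [h2] at h
  have hfin : Module.finrank ℝ (Rn d) = d := by simp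
  rw [hfin, abs_of_pos (by positivity)] at h
  rw [h, Complex.real_smul]
  push_cast
  rw [← mul_assoc, mul_inv_cancel₀, one_mul]
  exact pow_ne_zero _ (mul_ne_zero two_ne_zero (by exact_mod_cast Real.pi_ne_zero))

/-- For fixed x the integral over ξ is Fourier inversion for t ↦ u(t) g(t - x), evaluated at y and
multiplied by the conjugate of g(y - x). What remains is (2π)^d u(y) |g(y - x)|², and the integral
over x gives ‖g‖². -/
theorem integral_stftAtom_eval (g u : 𝓢(Rn d, ℂ)) (y : Rn d) :
    ∫ z : Rn d × Rn d, ofSchwartz u (gaborAtom g z.1 z.2) * stftAtom g z.1 z.2 y =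
      inversionConst g * u y := by
  have hI := (schwartzIntegrable_smul_stftAtom g u).integrable_eval y
  simp only [smul_apply, smul_eq_mul] at hI
  rw [Measure.volume_eq_prod] at hI ⊢
  rw [integral_prod _ hI]
  have hx : ∀ x : Rn d, ∫ ξ, ofSchwartz u (gaborAtom g x ξ) * stftAtom g x ξ y =
      ((2 * Real.pi) ^ d * u y) * ((‖g (y - x)‖ ^ 2 : ℝ) : ℂ) := by
    intro x
    let w : 𝓢(Rn d, ℂ) := SchwartzMap.smulLeftCLM ℂ u (SchwartzMap.compSubConstCLM ℂ x g)
    have hw : ∀ t, w t = u t * g (t - x) := fun t => by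
      simp only [w]
      rw [SchwartzMap.smulLeftCLM_apply_apply u.hasTemperateGrowth]
      simp
    have h := integral_fourierInv_scaled w y
    have h2 : ∀ ξ, ofSchwartz u (gaborAtom g x ξ) * stftAtom g x ξ y =
        ((∫ t, Complex.exp (Complex.I * ((⟪t, ξ⟫_ℝ : ℝ) : ℂ)) * w t) *
          Complex.exp (-(Complex.I * ((⟪y, ξ⟫_ℝ : ℝ) : ℂ)))) * (starRingEnd ℂ) (g (y - x)) := by
      intro ξ
      rw [ofSchwartz_apply, stftAtom_apply, ← mul_assoc]
      congr 2
      refine integral_congr_ae (ae_of_all _ fun t => ?_)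
      simp only [gaborAtom_apply, hw]
      ring
    simp_rw [h2]
    rw [integral_mul_const, h, hw, mul_assoc, mul_assoc, Complex.mul_conj, Complex.normSq_eq_norm_sq,
      mul_assoc]
  simp_rw [hx]
  rw [integral_const_mul, integral_sub_left_eq_self (fun t => ((‖g t‖ ^ 2 : ℝ) : ℂ)) volume y,
    integral_complex_ofReal, inversionConst]
  push_cast
  ring

/-- The inversion formula of the short-time Fourier transform, tested against Schwartz functions. -/
theorem stft_inversion (g : 𝓢(Rn d, ℂ)) (f : 𝓢'(Rn d, ℂ)) (u : 𝓢(Rn d, ℂ)) :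
    Integrable (fun z : Rn d × Rn d => stft g f z.1 z.2 * ofSchwartz u (gaborAtom g z.1 z.2)) ∧
    ∫ z : Rn d × Rn d, stft g f z.1 z.2 * ofSchwartz u (gaborAtom g z.1 z.2) =
      inversionConst g * f u := by
  let f' : 𝓢(Rn d, ℂ) →L[ℂ] ℂ := ⟨f.toLinearMap, f.continuous⟩
  -- The multiple c u of u is the pointwise integral of the weighted atoms; f applied inside that
  -- integral turns each atom into a value of the transform of f.
  have h := (schwartzIntegrable_smul_stftAtom g u).integrable_integral_apply
    (Ψ := (inversionConst g : ℂ) • u) (by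
      intro y
      simpa using integral_stftAtom_eval g u y) f'
  have hf : ∀ v, f' v = f v := fun _ => rfl
  simp only [map_smul, hf, smul_eq_mul] at h
  simpa only [stft, mul_comm] using h

theorem eq_zero_of_stft_eq_zero {g : 𝓢(Rn d, ℂ)} (hg : g ≠ 0) {f : 𝓢'(Rn d, ℂ)}
    (hf : ∀ x ξ, stft g f x ξ = 0) : f = 0 := by
  ext u
  have h := (stft_inversion g f u).2
  simp only [hf, zero_mul, integral_zero] at h
  have hc : (inversionConst g : ℂ) ≠ 0 := by exact_mod_cast (inversionConst_pos hg).ne'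
  simpa using (mul_eq_zero.1 h.symm).resolve_left hc

/-! ### Further properties of mixed norms -/

section MixedNorm

variable {X Y : Type*} [MeasurableSpace X] [MeasurableSpace Y] {μ : Measure X} {ν : Measure Y}

theorem tendsto_eLpNorm_zero {p : ℝ≥0∞} (hp : 1 ≤ p) (hpt : p ≠ ⊤) {u : ℕ → X → ℝ≥0∞}
    (hu : ∀ n, Measurable (u n)) {v : X → ℝ≥0∞} (hv : eLpNorm v p μ ≠ ⊤)
    (hle : ∀ n x, u n x ≤ v x)
    (hlim : ∀ᵐ x ∂μ, Filter.Tendsto (fun n => u n x) Filter.atTop (𝓝 0)) :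
    Filter.Tendsto (fun n => eLpNorm (u n) p μ) Filter.atTop (𝓝 0) := by
  have hp0 : p ≠ 0 := (zero_lt_one.trans_le hp).ne'
  have ha : 0 < p.toReal := ENNReal.toReal_pos hp0 hpt
  simp only [eLpNorm_eq_lintegral_rpow_enorm_toReal hp0 hpt, enorm_eq_self] at hv ⊢
  have hv' : ∫⁻ x, v x ^ p.toReal ∂μ ≠ ⊤ := by
    intro h
    rw [h, ENNReal.top_rpow_of_pos (by positivity)] at hv
    exact hv rfl
  have h := tendsto_lintegral_of_dominated_convergence (μ := μ) (f := fun _ => 0)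
    (F := fun n x => u n x ^ p.toReal) (fun x => v x ^ p.toReal) (fun n => (hu n).pow_const _)
    (fun n => ae_of_all _ fun x => ENNReal.rpow_le_rpow (hle n x) ha.le) hv' (by
      filter_upwards [hlim] with x hx
      have := ((ENNReal.continuous_rpow_const (y := p.toReal)).tendsto 0).comp hx
      rwa [ENNReal.zero_rpow_of_pos ha] at this)
  rw [lintegral_zero] at h
  have h2 := ((ENNReal.continuous_rpow_const (y := 1 / p.toReal)).tendsto 0).comp h
  rwa [ENNReal.zero_rpow_of_pos (by positivity)] at h2

/-- Dominated convergence in the inner variable and then in the outer one. The inner step is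
available for almost every y only, where the inner norm of v is finite. Both steps need finite
exponents. -/
theorem tendsto_mixedNorm_zero [SFinite μ] [SFinite ν] {p q : ℝ≥0∞} (hp : 1 ≤ p) (hpt : p ≠ ⊤)
    (hq : 1 ≤ q) (hqt : q ≠ ⊤) {u : ℕ → X → Y → ℝ≥0∞}
    (hu : ∀ n, Measurable (Function.uncurry (u n))) {v : X → Y → ℝ≥0∞}
    (hvm : Measurable (Function.uncurry v)) (hv : mixedNorm μ ν p q v ≠ ⊤)
    (hle : ∀ n x y, u n x y ≤ v x y)
    (hlim : ∀ x y, Filter.Tendsto (fun n => u n x y) Filter.atTop (𝓝 0)) :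
    Filter.Tendsto (fun n => mixedNorm μ ν p q (u n)) Filter.atTop (𝓝 0) := by
  have hq0 : q ≠ 0 := (zero_lt_one.trans_le hq).ne'
  refine tendsto_eLpNorm_zero hq hqt (fun n => measurable_eLpNorm_left (hu n) hp hpt) hv
    (fun n y => eLpNorm_mono_enorm fun x => by simpa using hle n x y) ?_
  have hfin : ∀ᵐ y ∂ν, eLpNorm (fun x => v x y) p μ < ⊤ := by
    have hm := measurable_eLpNorm_left (μ := μ) hvm hp hpt
    unfold mixedNorm at hv
    rw [eLpNorm_eq_lintegral_rpow_enorm_toReal hq0 hqt] at hv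
    simp only [enorm_eq_self] at hv
    have hqr := ENNReal.toReal_pos hq0 hqt
    have hv' : ∫⁻ y, eLpNorm (fun x => v x y) p μ ^ q.toReal ∂ν ≠ ⊤ := by
      intro h
      rw [h, ENNReal.top_rpow_of_pos (by positivity)] at hv
      exact hv rfl
    filter_upwards [ae_lt_top (hm.pow_const _) hv'] with y hy
    by_contra h
    rw [not_lt, top_le_iff] at h
    rw [h, ENNReal.top_rpow_of_pos hqr] at hy
    exact lt_irrefl _ hy
  filter_upwards [hfin] with y hy
  exact tendsto_eLpNorm_zero hp hpt
    (fun n => (hu n).comp (measurable_id.prodMk measurable_const)) hy.ne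
    (fun n x => hle n x y) (ae_of_all _ fun x => hlim x y)

/-- Hölder in x for each y, then in y. Measurability of the inner norms is a separate hypothesis
because for exponent ∞ it does not follow from `measurable_eLpNorm_left`; for transforms it comes
from continuity. -/
theorem lintegral_prod_mul_le_mixedNorm [SFinite μ] [SFinite ν] {p q p' q' : ℝ≥0∞}
    [p.HolderConjugate p'] [q.HolderConjugate q'] {u v : X → Y → ℝ≥0∞}
    (hu : Measurable (Function.uncurry u)) (hv : Measurable (Function.uncurry v))
    (hu' : Measurable fun y => eLpNorm (fun x => u x y) p μ)
    (hv' : Measurable fun y => eLpNorm (fun x => v x y) p' μ) :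
    ∫⁻ z, u z.1 z.2 * v z.1 z.2 ∂(μ.prod ν) ≤
      mixedNorm μ ν p q u * mixedNorm μ ν p' q' v := by
  rw [lintegral_prod_symm (fun z : X × Y => u z.1 z.2 * v z.1 z.2) (hu.mul hv).aemeasurable]
  refine le_trans (lintegral_mono fun y => ?_) (lintegral_mul_le_eLpNorm_mul_eLpNorm hu' hv')
  exact lintegral_mul_le_eLpNorm_mul_eLpNorm
    (hu.comp (measurable_id.prodMk measurable_const))
    (hv.comp (measurable_id.prodMk measurable_const))

theorem eLpNorm_comp_add_right {G : Type*} [MeasurableSpace G] [AddGroup G] [MeasurableAdd G]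
    {μ : Measure G} [μ.IsAddRightInvariant] {p : ℝ≥0∞} (hp : 1 ≤ p) (hpt : p ≠ ⊤)
    (u : G → ℝ≥0∞) (a : G) : eLpNorm (fun x => u (x + a)) p μ = eLpNorm u p μ := by
  have hp0 : p ≠ 0 := (zero_lt_one.trans_le hp).ne'
  rw [eLpNorm_eq_lintegral_rpow_enorm_toReal hp0 hpt, eLpNorm_eq_lintegral_rpow_enorm_toReal hp0 hpt]
  simp only [enorm_eq_self]
  rw [lintegral_add_right_eq_self (fun x => u x ^ p.toReal) a]

theorem mixedNorm_comp_add_right {G : Type*} [MeasurableSpace G] [AddGroup G] [MeasurableAdd G]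
    {μ : Measure G} [μ.IsAddRightInvariant] {p q : ℝ≥0∞} (hp : 1 ≤ p) (hpt : p ≠ ⊤)
    (hq : 1 ≤ q) (hqt : q ≠ ⊤) (u : G → G → ℝ≥0∞) (a b : G) :
    mixedNorm μ μ p q (fun x y => u (x + a) (y + b)) = mixedNorm μ μ p q u := by
  unfold mixedNorm
  rw [← eLpNorm_comp_add_right hq hqt (fun y => eLpNorm (fun x => u x y) p μ) b]
  congr 1
  funext y
  exact eLpNorm_comp_add_right hp hpt (fun x => u x (y + b)) a

theorem mixedNorm_mul_le {p q : ℝ≥0∞} (a : X → ℝ≥0∞) {b : Y → ℝ≥0∞} (hb : ∀ y, b y ≠ ⊤)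
    (ha : eLpNorm a p μ ≠ ⊤) :
    mixedNorm μ ν p q (fun x y => a x * b y) ≤ eLpNorm a p μ * eLpNorm b q ν := by
  refine le_trans (eLpNorm_mono_enorm fun y => ?_) (eLpNorm_const_mul_ennreal _ ha b)
  simp only [enorm_eq_self]
  refine le_trans (le_of_eq ?_) ((eLpNorm_const_mul_ennreal (b y) (hb y) a).trans_eq (mul_comm _ _))
  simp_rw [mul_comm]

end MixedNorm

/-! ### Analysis of modulation spaces -/

theorem polyWeight_pos (s : ℝ) (x ξ : Rn d) : 0 < polyWeight s x ξ := by
  unfold polyWeight; positivity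

theorem polyWeight_mul_neg (s : ℝ) (x ξ : Rn d) : polyWeight s x ξ * polyWeight (-s) x ξ = 1 := by
  unfold polyWeight
  rw [← Real.rpow_add (by positivity)]
  simp [neg_div]

theorem polyWeight_le_phaseWeight (s : ℝ) :
    ∃ k : ℕ, ∀ x ξ : Rn d, polyWeight s x ξ ≤ phaseWeight k x ξ := by
  obtain ⟨k, hk⟩ := exists_nat_ge |s|
  refine ⟨k, fun x ξ => ?_⟩
  have h1 : (1 : ℝ) ≤ 1 + ‖x‖ ^ 2 + ‖ξ‖ ^ 2 := by nlinarith [sq_nonneg ‖x‖, sq_nonneg ‖ξ‖]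
  have h2 : 1 + ‖x‖ ^ 2 + ‖ξ‖ ^ 2 ≤ ((1 + ‖x‖) * (1 + ‖ξ‖)) ^ 2 := by
    have hx := norm_nonneg x
    have hξ := norm_nonneg ξ
    have : 0 ≤ ‖x‖ * ‖ξ‖ := mul_nonneg hx hξ
    nlinarith [sq_nonneg (‖x‖ * ‖ξ‖), mul_nonneg hx this, mul_nonneg hξ this]
  have h3 : (1 : ℝ) ≤ (1 + ‖x‖) * (1 + ‖ξ‖) := by
    nlinarith [norm_nonneg x, norm_nonneg ξ, mul_nonneg (norm_nonneg x) (norm_nonneg ξ)]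
  calc polyWeight s x ξ ≤ (1 + ‖x‖ ^ 2 + ‖ξ‖ ^ 2) ^ ((k : ℝ) / 2) :=
        Real.rpow_le_rpow_of_exponent_le h1 (by linarith [le_abs_self s])
    _ ≤ (((1 + ‖x‖) * (1 + ‖ξ‖)) ^ 2) ^ ((k : ℝ) / 2) := by gcongr
    _ = ((1 + ‖x‖) * (1 + ‖ξ‖)) ^ k := by
        rw [← Real.rpow_natCast _ 2, ← Real.rpow_mul (by positivity), ← Real.rpow_natCast _ k]
        congr 1
        push_cast; ring
    _ = phaseWeight k x ξ := by rw [mul_pow]; rfl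

/-- Peetre's inequality. -/
theorem polyWeight_le_mul (s : ℝ) (x ξ a b : Rn d) :
    polyWeight s x ξ ≤ 2 ^ (|s| / 2) * polyWeight |s| a b * polyWeight s (x + a) (ξ + b) := by
  have key : ∀ u v : Rn d × Rn d, 1 + ‖u.1‖ ^ 2 + ‖u.2‖ ^ 2 ≤
      2 * (1 + ‖v.1‖ ^ 2 + ‖v.2‖ ^ 2) * (1 + ‖u.1 + v.1‖ ^ 2 + ‖u.2 + v.2‖ ^ 2) := by
    intro u v
    have h : ∀ y w : Rn d, ‖y‖ ^ 2 ≤ 2 * ‖w‖ ^ 2 + 2 * ‖y + w‖ ^ 2 := by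
      intro y w
      have h1 : ‖y‖ ≤ ‖y + w‖ + ‖w‖ := by
        simpa using norm_sub_le (y + w) w
      nlinarith [norm_nonneg y, norm_nonneg w, norm_nonneg (y + w), sq_nonneg (‖y + w‖ - ‖w‖)]
    have h1 := h u.1 v.1
    have h2 := h u.2 v.2
    have h3 : 0 ≤ (‖v.1‖ ^ 2 + ‖v.2‖ ^ 2) * (‖u.1 + v.1‖ ^ 2 + ‖u.2 + v.2‖ ^ 2) := by positivity
    nlinarith
  unfold polyWeight
  set A := 1 + ‖x‖ ^ 2 + ‖ξ‖ ^ 2 with hA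
  set B := 1 + ‖a‖ ^ 2 + ‖b‖ ^ 2 with hB
  set D := 1 + ‖x + a‖ ^ 2 + ‖ξ + b‖ ^ 2 with hD
  have hA0 : 0 < A := by positivity
  have hB0 : 0 < B := by positivity
  have hD0 : 0 < D := by positivity
  rcases le_total 0 s with hs | hs
  · rw [abs_of_nonneg hs, ← Real.mul_rpow (by norm_num) hB0.le, ← Real.mul_rpow (by positivity) hD0.le]
    exact Real.rpow_le_rpow hA0.le (key (x, ξ) (a, b)) (by linarith)
  -- For s ≤ 0 the roles of the two points are exchanged: the elementary inequality is used at the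
  -- shifted point with shift (-a, -b) and raised to the power -s/2 ≥ 0.
  · have hk : D ≤ 2 * B * A := by
      have := key (x + a, ξ + b) (-a, -b)
      simpa [hA, hB, hD] using this
    have h1 : D ^ (-s / 2) ≤ (2 * B * A) ^ (-s / 2) :=
      Real.rpow_le_rpow hD0.le hk (by linarith)
    rw [abs_of_nonpos hs]
    rw [Real.mul_rpow (by positivity) hA0.le, Real.mul_rpow (by norm_num) hB0.le] at h1
    have h2 : A ^ (-s / 2) * A ^ (s / 2) = 1 := by
      rw [← Real.rpow_add hA0]; simp [neg_div]
    have h3 : D ^ (-s / 2) * D ^ (s / 2) = 1 := by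
      rw [← Real.rpow_add hD0]; simp [neg_div]
    calc A ^ (s / 2) = (D ^ (-s / 2) * D ^ (s / 2)) * A ^ (s / 2) := by rw [h3, one_mul]
      _ ≤ (2 ^ (-s / 2) * B ^ (-s / 2) * A ^ (-s / 2) * D ^ (s / 2)) * A ^ (s / 2) := by gcongr
      _ = (2 ^ (-s / 2) * B ^ (-s / 2) * D ^ (s / 2)) * (A ^ (-s / 2) * A ^ (s / 2)) := by ring
      _ = _ := by rw [h2, mul_one]

theorem modNorm_eq_mixedNorm (g : 𝓢(Rn d, ℂ)) (p q : ℝ≥0∞) (s : ℝ) (f : 𝓢'(Rn d, ℂ)) :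
    modNorm g p q s f =
      mixedNorm volume volume p q fun x ξ => ‖polyWeight s x ξ • stft g f x ξ‖ₑ := by
  unfold modNorm mixedNorm
  congr 1

theorem eq_zero_of_modNorm_eq_zero {g : 𝓢(Rn d, ℂ)} (hg : g ≠ 0) {p q : ℝ≥0∞} (hp : 1 ≤ p)
    (hq : 1 ≤ q) {s : ℝ} {f : 𝓢'(Rn d, ℂ)} (hf : modNorm g p q s f = 0) : f = 0 := by
  have hp0 : p ≠ 0 := (zero_lt_one.trans_le hp).ne'
  have hq0 : q ≠ 0 := (zero_lt_one.trans_le hq).ne'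
  have hc := continuous_weighted_stft g s f
  unfold modNorm at hf
  rw [eLpNorm_eq_zero_iff (measurable_eLpNorm_slice g p hp s f).aestronglyMeasurable hq0] at hf
  -- Continuity turns vanishing almost everywhere into vanishing everywhere, first in x for almost
  -- every ξ and afterwards in ξ for every x.
  have h1 : ∀ᵐ ξ ∂(volume : Measure (Rn d)), ∀ x : Rn d, stft g f x ξ = 0 := by
    filter_upwards [hf] with ξ hξ x
    have hcx : Continuous fun x : Rn d => polyWeight s x ξ • stft g f x ξ :=
      hc.comp (f := fun x : Rn d => (x, ξ)) (by fun_prop)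
    rw [Pi.zero_apply, eLpNorm_eq_zero_iff hcx.aestronglyMeasurable hp0] at hξ
    have h := congrFun ((Continuous.ae_eq_iff_eq volume hcx continuous_const).1 hξ) x
    exact (smul_eq_zero.1 h).resolve_left (polyWeight_pos s x ξ).ne'
  refine eq_zero_of_stft_eq_zero hg fun x ξ => ?_
  have hcξ : Continuous fun ξ : Rn d => stft g f x ξ :=
    (continuous_stft g f).comp (f := fun ξ : Rn d => (x, ξ)) (by fun_prop)
  have h2 : (fun ξ : Rn d => stft g f x ξ) =ᵐ[volume] fun _ => 0 := by
    filter_upwards [h1] with ξ hξ using hξ x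
  exact congrFun ((Continuous.ae_eq_iff_eq volume hcξ continuous_const).1 h2) ξ

/-- The pairing of distributions with test functions is bilinear, whereas the transform conjugates
the window. This is why the conjugate of the test function appears in the duality estimate. -/
theorem stft_conjSchwartz (g u : 𝓢(Rn d, ℂ)) (x ξ : Rn d) :
    stft g (ofSchwartz (conjSchwartz u)) x ξ =
      (starRingEnd ℂ) (ofSchwartz u (gaborAtom g x ξ)) := by
  rw [stft, ofSchwartz_apply, ofSchwartz_apply, ← integral_conj]
  refine integral_congr_ae (ae_of_all _ fun y => ?_)
  simp [← conj_stftAtom_apply, conjSchwartz_apply]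

/-- Modulation spaces with dual exponents and weights are in duality. -/
theorem enorm_apply_le_modNorm_mul_modNorm (g : 𝓢(Rn d, ℂ)) {p q : ℝ≥0∞} [hp : Fact (1 ≤ p)]
    [hq : Fact (1 ≤ q)] (s : ℝ) (f : 𝓢'(Rn d, ℂ)) (u : 𝓢(Rn d, ℂ)) :
    ‖(inversionConst g : ℂ) * f u‖ₑ ≤ modNorm g p q s f *
      modNorm g p.conjExponent q.conjExponent (-s) (ofSchwartz (conjSchwartz u)) := by
  set f' := ofSchwartz (conjSchwartz u) with hf'
  have hc := continuous_weighted_stft g s f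
  have hc' := continuous_weighted_stft g (-s) f'
  have hp' : 1 ≤ p.conjExponent := by simp [ENNReal.conjExponent]
  have hen : ∀ (p : ℝ≥0∞) (h : Rn d → ℂ),
      eLpNorm (fun x => ‖h x‖ₑ) p volume = eLpNorm h p volume := fun p h =>
    eLpNorm_congr_enorm_ae (ae_of_all _ fun x => by simp)
  rw [← (stft_inversion g f u).2, modNorm_eq_mixedNorm, modNorm_eq_mixedNorm]
  refine (enorm_integral_le_lintegral_enorm _).trans ?_
  -- Since v_s v_{-s} = 1, the two weights may be inserted, one with each transform, before Hölder's
  -- inequality.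
  refine le_trans (le_of_eq ?_) (lintegral_prod_mul_le_mixedNorm (p := p) (q := q) hc.enorm.measurable
    hc'.enorm.measurable ?_ ?_)
  · rw [Measure.volume_eq_prod]
    refine lintegral_congr fun z => ?_
    rw [← enorm_mul, hf', stft_conjSchwartz]
    simp only [enorm_mul, enorm_smul, RCLike.enorm_conj]
    have h1 : ‖polyWeight s z.1 z.2‖ₑ * ‖polyWeight (-s) z.1 z.2‖ₑ = 1 := by
      rw [← enorm_mul, polyWeight_mul_neg, enorm_one]
    calc _ = (‖polyWeight s z.1 z.2‖ₑ * ‖polyWeight (-s) z.1 z.2‖ₑ) *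
        (‖stft g f z.1 z.2‖ₑ * ‖ofSchwartz u (gaborAtom g z.1 z.2)‖ₑ) := by rw [h1, one_mul]
      _ = _ := by ring
  · simp_rw [hen]
    exact measurable_eLpNorm_slice g p hp.out s f
  · simp_rw [hen]
    exact measurable_eLpNorm_slice g _ hp' (-s) f'

/-- A decay of order k absorbs the weight, and a further decay of order n leaves a product of a
function in L^p and one in L^q. Infinite exponents are included, because dual exponents may be
infinite. -/
theorem exists_mixedNorm_le_of_decay (p q : ℝ≥0∞) (s : ℝ) :
    ∃ (N : ℕ) (C : ℝ≥0∞), C ≠ ⊤ ∧ ∀ (b : ℝ), 0 ≤ b → ∀ h : Rn d → Rn d → ℂ,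
      (∀ x ξ, ‖h x ξ‖ ≤ b * (phaseWeight N x ξ)⁻¹) →
      mixedNorm volume volume p q (fun x ξ => ‖polyWeight s x ξ • h x ξ‖ₑ) ≤
        ENNReal.ofReal b * C := by
  obtain ⟨k, hk⟩ := polyWeight_le_phaseWeight (d := d) s
  have hfin : ∀ p : ℝ≥0∞, ∃ m : ℕ, ∀ n, m ≤ n →
      eLpNorm (fun x : Rn d => ENNReal.ofReal ((1 + ‖x‖) ^ n)⁻¹) p volume ≠ ⊤ := by
    intro p
    obtain ⟨m, hm⟩ := Measure.HasTemperateGrowth.exists_eLpNorm_lt_top (E := Rn d) p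
      (μ := volume) inferInstance
    refine ⟨m, fun n hn => ne_top_of_le_ne_top hm.ne (eLpNorm_mono_enorm fun x => ?_)⟩
    rw [enorm_eq_self, Real.enorm_eq_ofReal (by positivity), Real.rpow_neg (by positivity),
      Real.rpow_natCast]
    gcongr
    linarith [norm_nonneg x]
  obtain ⟨m₁, hm₁⟩ := hfin p
  obtain ⟨m₂, hm₂⟩ := hfin q
  set n := max m₁ m₂
  have h1 := hm₁ n (le_max_left _ _)
  have h2 := hm₂ n (le_max_right _ _)
  refine ⟨k + n, _, ENNReal.mul_ne_top h1 h2, fun b hb h hh => ?_⟩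
  refine le_trans (mixedNorm_mono fun x ξ => ?_)
    ((mixedNorm_const_mul_le (ENNReal.ofReal b) ENNReal.ofReal_ne_top _).trans
      (mul_le_mul_right (mixedNorm_mul_le _ (fun _ => ENNReal.ofReal_ne_top) h1) _))
  rw [← ENNReal.ofReal_mul (by positivity), ← ENNReal.ofReal_mul hb, ← ofReal_norm]
  refine ENNReal.ofReal_le_ofReal ?_
  rw [norm_smul, Real.norm_of_nonneg (polyWeight_pos _ _ _).le]
  have h3 := phaseWeight_pos k x ξ
  have h4 := phaseWeight_pos n x ξ
  calc polyWeight s x ξ * ‖h x ξ‖ ≤ phaseWeight k x ξ * (b * (phaseWeight (k + n) x ξ)⁻¹) := by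
        gcongr
        · exact hk x ξ
        · exact hh x ξ
    _ = b * (phaseWeight n x ξ)⁻¹ := by rw [phaseWeight_add]; field_simp
    _ = _ := by rw [phaseWeight, mul_inv]

theorem exists_modNorm_ofSchwartz_le (g : 𝓢(Rn d, ℂ)) (p q : ℝ≥0∞) (s : ℝ) :
    ∃ P : Seminorm ℂ 𝓢(Rn d, ℂ), Continuous P ∧ ∀ u,
      modNorm g p q s (ofSchwartz u) ≤ ENNReal.ofReal (P u) ∧
      modNorm g p q s (ofSchwartz (conjSchwartz u)) ≤ ENNReal.ofReal (P u) := by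
  obtain ⟨N, C, hC, h⟩ := exists_mixedNorm_le_of_decay (d := d) p q s
  obtain ⟨P₁, hP₁, h₁⟩ := exists_stft_decay N g
  obtain ⟨P₂, hP₂, h₂⟩ := exists_gabor_decay N g
  have hP : Continuous (P₁ + P₂) := hP₁.add hP₂
  have hw : ∀ x ξ : Rn d, 0 ≤ (phaseWeight N x ξ)⁻¹ := fun x ξ =>
    (inv_pos.2 (phaseWeight_pos N x ξ)).le
  refine ⟨C.toNNReal • (P₁ + P₂), hP.const_smul C.toNNReal, fun u => ?_⟩
  have hr : ENNReal.ofReal ((C.toNNReal • (P₁ + P₂)) u) = ENNReal.ofReal ((P₁ + P₂) u) * C := by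
    change ENNReal.ofReal ((C.toNNReal : ℝ) * (P₁ + P₂) u) = _
    rw [ENNReal.ofReal_mul (by positivity), ENNReal.ofReal_coe_nnreal, ENNReal.coe_toNNReal hC,
      mul_comm]
  rw [hr, modNorm_eq_mixedNorm, modNorm_eq_mixedNorm]
  refine ⟨h _ (apply_nonneg _ _) _ fun x ξ => (h₁ u x ξ).trans ?_,
    h _ (apply_nonneg _ _) _ fun x ξ => ?_⟩
  · exact mul_le_mul_of_nonneg_right (le_add_of_nonneg_right (apply_nonneg P₂ u)) (hw x ξ)
  · rw [stft_conjSchwartz, RCLike.norm_conj]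
    exact (h₂ u x ξ).trans
      (mul_le_mul_of_nonneg_right (le_add_of_nonneg_left (apply_nonneg P₁ u)) (hw x ξ))

/-! ### Evaluation functionals, the inclusion of Schwartz functions, and completeness -/

namespace ModulationSpace

variable {g : 𝓢(Rn d, ℂ)} {p q : ℝ≥0∞} [hp : Fact (1 ≤ p)] [hq : Fact (1 ≤ q)] {s : ℝ}

theorem toDistribution_injective :
    Function.Injective (toDistribution : ModulationSpace g p q s →ₗ[ℂ] 𝓢'(Rn d, ℂ)) :=
  Subtype.val_injective

/-- A tempered distribution of finite modulation norm as an element of the modulation space. -/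
def ofDistribution (f : 𝓢'(Rn d, ℂ)) (hf : modNorm g p q s f < ⊤) : ModulationSpace g p q s :=
  ⟨f, hf⟩

theorem ofReal_norm_eq_modNorm (f : ModulationSpace g p q s) :
    ENNReal.ofReal ‖f‖ = modNorm g p q s (toDistribution f) := by
  rw [norm_def, ENNReal.ofReal_toReal (modNorm_lt_top f).ne]

variable (g p q s) in
/-- The norm of (the conjugate of) a Schwartz function in the dual modulation space. -/
def dualNorm (u : 𝓢(Rn d, ℂ)) : ℝ :=
  (modNorm g p.conjExponent q.conjExponent (-s) (ofSchwartz (conjSchwartz u))).toReal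

theorem norm_toDistribution_apply_le (hg : g ≠ 0) (f : ModulationSpace g p q s)
    (u : 𝓢(Rn d, ℂ)) :
    ‖toDistribution f u‖ ≤ (inversionConst g)⁻¹ * dualNorm g p q s u * ‖f‖ := by
  have hc := inversionConst_pos hg
  have h := enorm_apply_le_modNorm_mul_modNorm g (p := p) (q := q) s (toDistribution f) u
  obtain ⟨P, -, hP⟩ := exists_modNorm_ofSchwartz_le g p.conjExponent q.conjExponent (-s)
  have hfin : modNorm g p.conjExponent q.conjExponent (-s) (ofSchwartz (conjSchwartz u)) ≠ ⊤ :=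
    ne_top_of_le_ne_top ENNReal.ofReal_ne_top (hP u).2
  have h2 := ENNReal.toReal_mono (ENNReal.mul_ne_top (modNorm_lt_top f).ne hfin) h
  rw [ENNReal.toReal_mul, toReal_enorm, norm_mul, Complex.norm_real,
    Real.norm_of_nonneg hc.le] at h2
  rw [mul_assoc, ← div_eq_inv_mul, le_div_iff₀ hc]
  calc _ = inversionConst g * ‖toDistribution f u‖ := mul_comm _ _
    _ ≤ _ := h2
    _ = _ := mul_comm _ _

/-- One seminorm serves all f. It lets absolutely summable series be summed as distributions, and it
bounds the functionals of the resolution below uniformly on compact sets. -/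
theorem exists_seminorm_eval_bound (g : 𝓢(Rn d, ℂ)) (p q : ℝ≥0∞) [hp : Fact (1 ≤ p)]
    [hq : Fact (1 ≤ q)] (s : ℝ) (hg : g ≠ 0) :
    ∃ P : Seminorm ℂ 𝓢(Rn d, ℂ), Continuous P ∧
      ∀ (f : ModulationSpace g p q s) u, ‖toDistribution f u‖ ≤ ‖f‖ * P u := by
  obtain ⟨P, hPc, hP⟩ := exists_modNorm_ofSchwartz_le g p.conjExponent q.conjExponent (-s)
  have hc := inversionConst_pos hg
  refine ⟨Real.toNNReal (inversionConst g)⁻¹ • P, hPc.const_smul (Real.toNNReal _), fun f u => ?_⟩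
  refine (norm_toDistribution_apply_le hg f u).trans ?_
  change _ ≤ ‖f‖ * ((Real.toNNReal (inversionConst g)⁻¹ : ℝ) * P u)
  rw [Real.coe_toNNReal _ (inv_pos.2 hc).le, mul_comm ‖f‖]
  have h := ENNReal.toReal_mono ENNReal.ofReal_ne_top (hP u).2
  rw [ENNReal.toReal_ofReal (apply_nonneg _ _)] at h
  have := (inv_pos.2 hc).le
  gcongr
  exact h

/-- The evaluation of the elements of a modulation space at a Schwartz function. -/
def evalCLM (hg : g ≠ 0) (u : 𝓢(Rn d, ℂ)) : ModulationSpace g p q s →L[ℂ] ℂ :=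
  LinearMap.mkContinuous
    { toFun := fun f => toDistribution f u
      map_add' := fun f₁ f₂ => by simp
      map_smul' := fun c f => by simp }
    ((inversionConst g)⁻¹ * dualNorm g p q s u) fun f => norm_toDistribution_apply_le hg f u

theorem evalCLM_apply (hg : g ≠ 0) (u : 𝓢(Rn d, ℂ)) (f : ModulationSpace g p q s) :
    evalCLM hg u f = toDistribution f u := rfl

theorem norm_evalCLM_le (hg : g ≠ 0) (u : 𝓢(Rn d, ℂ)) :
    ‖(evalCLM hg u : ModulationSpace g p q s →L[ℂ] ℂ)‖ ≤
      (inversionConst g)⁻¹ * dualNorm g p q s u :=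
  LinearMap.mkContinuous_norm_le _
    (mul_nonneg (inv_pos.2 (inversionConst_pos hg)).le ENNReal.toReal_nonneg) _

variable (g p q s) in
/-- The inclusion of the Schwartz space into a modulation space. -/
def schwartzCLM : 𝓢(Rn d, ℂ) →L[ℂ] ModulationSpace g p q s :=
  let L : 𝓢(Rn d, ℂ) →ₗ[ℂ] ModulationSpace g p q s :=
    { toFun := fun u => ofDistribution (ofSchwartz u) (by
        obtain ⟨P, -, hP⟩ := exists_modNorm_ofSchwartz_le g p q s
        exact (hP u).1.trans_lt ENNReal.ofReal_lt_top)
      map_add' := fun u v => toDistribution_injective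
        (map_add (SchwartzMap.toTemperedDistributionCLM (Rn d) ℂ volume) u v)
      map_smul' := fun c u => toDistribution_injective
        (map_smul (SchwartzMap.toTemperedDistributionCLM (Rn d) ℂ volume) c u) }
  ⟨L, by
    obtain ⟨P, hPc, hP⟩ := exists_modNorm_ofSchwartz_le g p q s
    refine continuous_of_continuousAt_zero L ?_
    rw [ContinuousAt, map_zero, tendsto_zero_iff_norm_tendsto_zero]
    have h := hPc.tendsto 0
    rw [map_zero] at h
    refine squeeze_zero (fun _ => norm_nonneg _) (fun u => ?_) h
    have h2 := ENNReal.toReal_mono ENNReal.ofReal_ne_top (hP u).1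
    rwa [ENNReal.toReal_ofReal (apply_nonneg _ _)] at h2⟩

theorem toDistribution_schwartzCLM (u : 𝓢(Rn d, ℂ)) :
    toDistribution (schwartzCLM g p q s u) = ofSchwartz u := rfl

/-- Convergence tested on Schwartz functions suffices: on the atoms it gives the pointwise sum of
the transforms, and Minkowski's inequality for counting measure does the rest. -/
theorem modNorm_le_tsum (g : 𝓢(Rn d, ℂ)) {p q : ℝ≥0∞} (hp : 1 ≤ p) (hq : 1 ≤ q) (hpt : p ≠ ⊤)
    (hqt : q ≠ ⊤) (s : ℝ) {f : ℕ → 𝓢'(Rn d, ℂ)} {F : 𝓢'(Rn d, ℂ)}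
    (h : ∀ u, HasSum (fun n => f n u) (F u)) : modNorm g p q s F ≤ ∑' n, modNorm g p q s (f n) := by
  simp_rw [modNorm_eq_mixedNorm]
  rw [← lintegral_count (fun n => mixedNorm volume volume p q
    fun x ξ => ‖polyWeight s x ξ • stft g (f n) x ξ‖ₑ)]
  refine le_trans (mixedNorm_mono fun x ξ => ?_) (mixedNorm_lintegral_le
    (h := fun x ξ n => ‖polyWeight s x ξ • stft g (f n) x ξ‖ₑ) ?_ hp hpt hq hqt)
  · rw [lintegral_count, stft, ← (h (stftAtom g x ξ)).tsum_eq, enorm_smul]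
    simp_rw [enorm_smul]
    rw [ENNReal.tsum_mul_left]
    gcongr
    exact enorm_tsum_le_tsum_enorm
  · exact measurable_from_prod_countable_left fun n =>
      (continuous_weighted_stft g s (f n)).enorm.measurable

/-- The sum is first formed as a tempered distribution. `modNorm_le_tsum` shows that it has finite
norm and, applied to the tails, that the partial sums converge to it in norm. -/
theorem exists_tendsto_of_summable_norm (hg : g ≠ 0) (hpt : p ≠ ⊤) (hqt : q ≠ ⊤)
    (f : ℕ → ModulationSpace g p q s) (hf : Summable fun n => ‖f n‖) :
    ∃ a, Filter.Tendsto (fun n => ∑ i ∈ Finset.range n, f i) Filter.atTop (𝓝 a) := by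
  obtain ⟨P, hPc, hP⟩ := exists_seminorm_eval_bound g p q s hg
  have hsum : ∀ u, Summable fun n => toDistribution (f n) u := fun u =>
    Summable.of_norm_bounded (hf.mul_right (P u)) fun n => hP (f n) u
  let L : 𝓢(Rn d, ℂ) →ₗ[ℂ] ℂ :=
    { toFun := fun u => ∑' n, toDistribution (f n) u
      map_add' := fun u v => by
        simp_rw [map_add]
        exact (hsum u).tsum_add (hsum v)
      map_smul' := fun c u => by
        simp_rw [map_smul, smul_eq_mul]
        rw [tsum_mul_left]
        rfl }
  have hL : Continuous L := by
    refine continuous_of_continuousAt_zero L ?_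
    rw [ContinuousAt, map_zero, tendsto_zero_iff_norm_tendsto_zero]
    have h := (hPc.tendsto 0).const_mul (∑' n, ‖f n‖)
    rw [map_zero, mul_zero] at h
    refine squeeze_zero (fun _ => norm_nonneg _) (fun u => ?_) h
    rw [← tsum_mul_right]
    exact tsum_of_norm_bounded (hf.mul_right (P u)).hasSum fun n => hP (f n) u
  let F : 𝓢'(Rn d, ℂ) := ContinuousLinearMap.toPointwiseConvergenceCLM _ _ _ _ ⟨L, hL⟩
  have hF : ∀ u, HasSum (fun n => toDistribution (f n) u) (F u) := fun u => (hsum u).hasSum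
  have hfin : ∑' n, modNorm g p q s (toDistribution (f n)) ≠ ⊤ := by
    simp_rw [← ofReal_norm_eq_modNorm]
    exact hf.tsum_ofReal_ne_top
  have hFlt : modNorm g p q s F < ⊤ :=
    (modNorm_le_tsum g hp.out hq.out hpt hqt s hF).trans_lt hfin.lt_top
  refine ⟨ofDistribution F hFlt, ?_⟩
  rw [tendsto_iff_norm_sub_tendsto_zero]
  have h0 := (ENNReal.tendsto_toReal ENNReal.zero_ne_top).comp
    (ENNReal.tendsto_sum_nat_add (fun n => modNorm g p q s (toDistribution (f n))) hfin)
  rw [ENNReal.toReal_zero] at h0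
  refine squeeze_zero (fun _ => norm_nonneg _) (fun n => ?_) h0
  rw [norm_sub_rev, norm_def]
  refine ENNReal.toReal_mono ?_ (modNorm_le_tsum g hp.out hq.out hpt hqt s fun u => ?_)
  · refine ne_top_of_le_ne_top hfin ?_
    exact ENNReal.tsum_comp_le_tsum_of_injective (add_left_injective n) _
  · have h := (hasSum_nat_add_iff' n).2 (hF u)
    have hv : toDistribution (ofDistribution F hFlt - ∑ i ∈ Finset.range n, f i) u =
        F u - ∑ i ∈ Finset.range n, toDistribution (f i) u := by
      simp_rw [← evalCLM_apply hg, map_sub, map_sum]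
      rfl
    rw [hv]
    exact h

/-- The modulation space as a normed group, for a nonzero window. -/
abbrev normedAddCommGroup (hg : g ≠ 0) : NormedAddCommGroup (ModulationSpace g p q s) :=
  NormedAddCommGroup.ofSeparation fun f hf => toDistribution_injective <| by
    rw [map_zero]
    refine eq_zero_of_modNorm_eq_zero hg hp.out hq.out (s := s) ?_
    rw [← ofReal_norm_eq_modNorm, hf, ENNReal.ofReal_zero]

theorem completeSpace (hg : g ≠ 0) (hpt : p ≠ ⊤) (hqt : q ≠ ⊤) :
    CompleteSpace (ModulationSpace g p q s) :=
  letI := normedAddCommGroup (p := p) (q := q) (s := s) hg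
  NormedAddCommGroup.completeSpace_of_summable_imp_tendsto
    (exists_tendsto_of_summable_norm hg hpt hqt)

end ModulationSpace

/-! ### Boundedness of synthesis -/

/-- Translating the integration variable by t changes the pairing of two time-frequency shifts only
by a unimodular factor. So the reproducing kernel is dominated by a convolution kernel on phase
space. -/
theorem norm_ofSchwartz_stftAtom_gaborAtom (g : 𝓢(Rn d, ℂ)) (t η x ξ : Rn d) :
    ‖ofSchwartz (stftAtom g t η) (gaborAtom g x ξ)‖ =
      ‖ofSchwartz (conjSchwartz g) (gaborAtom g (x - t) (ξ - η))‖ := by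
  have hunit : ‖Complex.exp (((⟪t, ξ⟫_ℝ - ⟪t, η⟫_ℝ : ℝ) : ℂ) * Complex.I)‖ = 1 :=
    Complex.norm_exp_ofReal_mul_I _
  rw [ofSchwartz_apply, ofSchwartz_apply,
    ← integral_add_right_eq_self (fun y => gaborAtom g x ξ y * stftAtom g t η y) t]
  rw [← one_mul (‖∫ y, gaborAtom g (x - t) (ξ - η) y * conjSchwartz g y‖), ← hunit, ← norm_mul,
    ← integral_const_mul]
  congr 1
  refine integral_congr_ae (ae_of_all _ fun y => ?_)
  simp only [gaborAtom_apply, stftAtom_apply, conjSchwartz_apply, add_sub_cancel_right]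
  rw [show y + t - x = y - (x - t) by abel]
  have : Complex.exp (Complex.I * ((⟪y + t, ξ⟫_ℝ : ℝ) : ℂ)) *
      Complex.exp (-(Complex.I * ((⟪y + t, η⟫_ℝ : ℝ) : ℂ))) =
      Complex.exp (((⟪t, ξ⟫_ℝ - ⟪t, η⟫_ℝ : ℝ) : ℂ) * Complex.I) *
        Complex.exp (Complex.I * ((⟪y, ξ - η⟫_ℝ : ℝ) : ℂ)) := by
    rw [← Complex.exp_add, ← Complex.exp_add, inner_add_left, inner_add_left, inner_sub_right]
    congr 1
    push_cast; ring
  linear_combination (g (y - (x - t)) * (starRingEnd ℂ) (g y)) * this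

/-- Synthesis from a mixed-norm space is bounded into the modulation space. -/
theorem exists_modNorm_le_of_synthesis {g : 𝓢(Rn d, ℂ)} (hg : g ≠ 0) {p q : ℝ≥0∞} (hp : 1 ≤ p)
    (hq : 1 ≤ q) (hpt : p ≠ ⊤) (hqt : q ≠ ⊤) (s : ℝ) :
    ∃ C : ℝ≥0∞, C ≠ ⊤ ∧ ∀ H : Rn d × Rn d → ℂ, Measurable H → ∀ f : 𝓢'(Rn d, ℂ),
      (∀ u, (inversionConst g : ℂ) * f u = ∫ z, H z * ofSchwartz u (gaborAtom g z.1 z.2)) →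
      modNorm g p q s f ≤
        C * mixedNorm volume volume p q fun x ξ => ‖polyWeight s x ξ • H (x, ξ)‖ₑ := by
  have : (volume : Measure (Rn d × Rn d)).IsAddRightInvariant := by
    rw [Measure.volume_eq_prod]
    infer_instance
  set c := ‖(inversionConst g : ℂ)‖ₑ with hc
  have hc0 : c ≠ 0 := by
    rw [hc, enorm_ne_zero]
    exact_mod_cast (inversionConst_pos hg).ne'
  have hct : c ≠ ⊤ := enorm_ne_top
  -- The convolution kernel together with the factor that Peetre's inequality charges for moving v_s
  -- from (x, ξ) to (x, ξ) + z. It is integrable because the transform of a Schwartz function decays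
  -- rapidly.
  let K : Rn d × Rn d → ℝ := fun z => 2 ^ (|s| / 2) * polyWeight |s| z.1 z.2 *
    ‖ofSchwartz (conjSchwartz g) (gaborAtom g z.1 z.2)‖
  have hKc : Continuous K := (continuous_const.mul (continuous_polyWeight |s|)).mul
    (continuous_ofSchwartz_gaborAtom g (conjSchwartz g)).norm
  have hK0 : ∀ z, 0 ≤ K z := fun z => mul_nonneg
    (mul_nonneg (by positivity) (polyWeight_pos _ _ _).le) (norm_nonneg _)
  have hKint : Integrable K := by
    obtain ⟨k, hk⟩ := polyWeight_le_phaseWeight (d := d) |s|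
    obtain ⟨M, hM⟩ := exists_integrable_phaseWeight_inv (d := d)
    obtain ⟨r, hr, hrb⟩ := exists_gabor_decay (k + M) g
    refine (hM.const_mul (2 ^ (|s| / 2) * r (conjSchwartz g))).mono' hKc.aestronglyMeasurable
      (ae_of_all _ fun z => ?_)
    rw [Real.norm_of_nonneg (hK0 z)]
    have h1 := phaseWeight_pos k z.1 z.2
    have h2 := phaseWeight_pos M z.1 z.2
    calc K z ≤ 2 ^ (|s| / 2) * phaseWeight k z.1 z.2 *
          (r (conjSchwartz g) * (phaseWeight (k + M) z.1 z.2)⁻¹) := by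
          refine mul_le_mul ?_ (hrb _ _ _) (norm_nonneg _) (by positivity)
          gcongr
          exact hk _ _
      _ = _ := by rw [phaseWeight_add]; field_simp
  set S := ∫⁻ z, ENNReal.ofReal (K z) with hS
  have hSt : S ≠ ⊤ := by
    rw [hS, ← ofReal_integral_eq_lintegral_ofReal hKint (ae_of_all _ hK0)]
    exact ENNReal.ofReal_ne_top
  refine ⟨c⁻¹ * S, ENNReal.mul_ne_top (ENNReal.inv_ne_top.2 hc0) hSt, fun H hH f hf => ?_⟩
  set U : Rn d → Rn d → ℝ≥0∞ := fun x ξ => ‖polyWeight s x ξ • H (x, ξ)‖ₑ with hU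
  have hUm : Measurable (Function.uncurry U) :=
    ((continuous_polyWeight s).measurable.smul hH).enorm
  have hpt' : ∀ x ξ, ‖polyWeight s x ξ • stft g f x ξ‖ₑ ≤
      c⁻¹ * ∫⁻ z : Rn d × Rn d, ENNReal.ofReal (K z) * U (x + z.1) (ξ + z.2) := by
    intro x ξ
    rw [← one_mul ‖polyWeight s x ξ • stft g f x ξ‖ₑ, ← ENNReal.inv_mul_cancel hc0 hct, mul_assoc]
    gcongr
    rw [enorm_smul, mul_left_comm, hc, ← enorm_mul, stft, hf]
    calc ‖polyWeight s x ξ‖ₑ *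
          ‖∫ z, H z * ofSchwartz (stftAtom g x ξ) (gaborAtom g z.1 z.2)‖ₑ
        ≤ ‖polyWeight s x ξ‖ₑ *
          ∫⁻ z, ‖H z * ofSchwartz (stftAtom g x ξ) (gaborAtom g z.1 z.2)‖ₑ := by
          gcongr; exact enorm_integral_le_lintegral_enorm _
      _ = ‖polyWeight s x ξ‖ₑ * ∫⁻ z : Rn d × Rn d, ‖H (z + (x, ξ)) *
          ofSchwartz (stftAtom g x ξ) (gaborAtom g (z.1 + x) (z.2 + ξ))‖ₑ := by
          rw [← lintegral_add_right_eq_self _ (x, ξ)]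
          rfl
      _ ≤ _ := by
          rw [← lintegral_const_mul' _ _ enorm_ne_top]
          refine lintegral_mono fun z => ?_
          change _ ≤ ENNReal.ofReal (K z) *
            ‖polyWeight s (x + z.1) (ξ + z.2) • H (x + z.1, ξ + z.2)‖ₑ
          rw [← ofReal_norm, ← ofReal_norm, ← ofReal_norm, ← ENNReal.ofReal_mul (norm_nonneg _),
            ← ENNReal.ofReal_mul (hK0 z)]
          refine ENNReal.ofReal_le_ofReal ?_
          rw [norm_mul, norm_ofSchwartz_stftAtom_gaborAtom, norm_smul, add_sub_cancel_right,
            add_sub_cancel_right, Real.norm_of_nonneg (polyWeight_pos _ _ _).le,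
            Real.norm_of_nonneg (polyWeight_pos _ _ _).le]
          have hz : z + (x, ξ) = (x + z.1, ξ + z.2) := by
            ext1 <;> simp [add_comm]
          rw [hz]
          calc _ ≤ (2 ^ (|s| / 2) * polyWeight |s| z.1 z.2 * polyWeight s (x + z.1) (ξ + z.2)) *
              (‖H (x + z.1, ξ + z.2)‖ *
                ‖ofSchwartz (conjSchwartz g) (gaborAtom g z.1 z.2)‖) := by
                gcongr
                exact polyWeight_le_mul s x ξ z.1 z.2
            _ = _ := by simp only [K]; ring
  rw [modNorm_eq_mixedNorm, mul_assoc]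
  refine (mixedNorm_mono hpt').trans ((mixedNorm_const_mul_le _ (ENNReal.inv_ne_top.2 hc0) _).trans ?_)
  gcongr
  have hm : Measurable fun w : (Rn d × Rn d) × (Rn d × Rn d) =>
      ENNReal.ofReal (K w.2) * U (w.1.1 + w.2.1) (w.1.2 + w.2.2) :=
    (hKc.measurable.ennreal_ofReal.comp measurable_snd).mul
      (hUm.comp (f := fun w : (Rn d × Rn d) × (Rn d × Rn d) =>
        (w.1.1 + w.2.1, w.1.2 + w.2.2)) (by fun_prop))
  -- Young's inequality: the mixed norm passes under the integral over z by Minkowski, and each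
  -- translate of U has the same mixed norm.
  refine (mixedNorm_lintegral_le
    (h := fun x ξ (z : Rn d × Rn d) => ENNReal.ofReal (K z) * U (x + z.1) (ξ + z.2))
    hm hp hpt hq hqt).trans ?_
  rw [hS, ← lintegral_mul_const _ hKc.measurable.ennreal_ofReal]
  refine lintegral_mono fun z => ?_
  refine (mixedNorm_const_mul_le _ ENNReal.ofReal_ne_top _).trans (le_of_eq ?_)
  rw [mixedNorm_comp_add_right hp hpt hq hqt]

/-! ### Traces of nuclear operators -/

section Localization

variable {B Z : Type*} [NormedAddCommGroup B] [NormedSpace ℂ B]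
  [TopologicalSpace Z] [T2Space Z] [MeasurableSpace Z] [BorelSpace Z]

/-- A resolution of the identity of `B` by localised integrals of rank-one operators. -/
structure IsResolution (μ : Measure Z) (K : ℕ → Set Z) (b : Z → B) (l : Z → B →L[ℂ] ℂ) :
    Prop where
  isCompact : ∀ n, IsCompact (K n)
  continuous_vec : Continuous b
  continuous_apply : ∀ y, Continuous fun z => l z y
  exists_bound : ∀ n, ∃ C, ∀ z ∈ K n, ‖l z‖ ≤ C
  tendsto : ∀ y, Filter.Tendsto (fun n => ∫ z in K n, l z y • b z ∂μ) Filter.atTop (𝓝 y)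
  exists_uniform_bound : ∃ C, ∀ n y, ‖∫ z in K n, l z y • b z ∂μ‖ ≤ C * ‖y‖

variable {μ : Measure Z} [IsFiniteMeasureOnCompacts μ] {K : ℕ → Set Z} {b : Z → B}
  {l : Z → B →L[ℂ] ℂ}

theorem IsResolution.integrableOn (h : IsResolution μ K b l) (n : ℕ) (y : B) :
    IntegrableOn (fun z => l z y • b z) (K n) μ :=
  ((h.continuous_apply y).smul h.continuous_vec).continuousOn.integrableOn_compact (h.isCompact n)

variable [CompleteSpace B]

theorem IsResolution.eq_zero (h : IsResolution μ K b l) {T : B →L[ℂ] B} (hT : ∀ z, T (b z) = 0) :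
    T = 0 := by
  ext y
  have h1 := (T.continuous.tendsto y).comp (h.tendsto y)
  refine tendsto_nhds_unique h1 ?_
  have h2 : ∀ n, T (∫ z in K n, l z y • b z ∂μ) = 0 := fun n => by
    rw [← T.integral_comp_comm (h.integrableOn n y)]
    simp [hT]
  simp [Function.comp_def, h2]

/-- The localised integrals depend on T alone, so this shows that all nuclear representations have
the same trace. They equal ∑ x'_k(P_n y_k), where P_n is the n-th partial resolution; as P_n y_k →
y_k and the P_n are uniformly bounded, dominated convergence for series applies. -/
theorem IsResolution.tendsto_trace (h : IsResolution μ K b l) {T : B →L[ℂ] B}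
    {x' : ℕ → B →L[ℂ] ℂ} {y : ℕ → B} (hrep : IsNuclearRepresentation 1 T x' y) :
    Filter.Tendsto (fun n => ∫ z in K n, l z (T (b z)) ∂μ) Filter.atTop
      (𝓝 (∑' k, x' k (y k))) := by
  obtain ⟨hsum, hT⟩ := hrep
  simp only [Real.rpow_one] at hsum
  -- Sum and integral may be exchanged because b and l are bounded in norm on the compact set K n,
  -- which has finite measure, and ∑ ‖x'_k‖ ‖y_k‖ converges.
  have hexch : ∀ n, ∑' k, x' k (∫ z in K n, l z (y k) • b z ∂μ) =
      ∫ z in K n, l z (T (b z)) ∂μ := by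
    intro n
    obtain ⟨C, hC⟩ := h.exists_bound n
    obtain ⟨D, hD⟩ := (h.isCompact n).exists_bound_of_continuousOn h.continuous_vec.continuousOn
    have hfin : μ (K n) < ⊤ := (h.isCompact n).measure_lt_top
    have hint : ∀ k, Integrable (fun z => l z (y k) * x' k (b z)) (μ.restrict (K n)) := fun k =>
      ((h.continuous_apply (y k)).mul
        ((x' k).continuous.comp h.continuous_vec)).continuousOn.integrableOn_compact (h.isCompact n)
    have hb : ∀ k, ∀ z ∈ K n, ‖l z (y k) * x' k (b z)‖ ≤ (C * D) * (‖x' k‖ * ‖y k‖) := by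
      intro k z hz
      have hC0 : 0 ≤ C := (norm_nonneg _).trans (hC z hz)
      rw [norm_mul]
      calc ‖l z (y k)‖ * ‖x' k (b z)‖ ≤ (C * ‖y k‖) * (‖x' k‖ * D) := by
            refine mul_le_mul ?_ ?_ (norm_nonneg _) (by positivity)
            · exact ((l z).le_opNorm _).trans (mul_le_mul_of_nonneg_right (hC z hz) (norm_nonneg _))
            · exact ((x' k).le_opNorm _).trans (mul_le_mul_of_nonneg_left (hD z hz) (norm_nonneg _))
        _ = _ := by ring
    have hnorm : Summable fun k => ∫ z in K n, ‖l z (y k) * x' k (b z)‖ ∂μ := by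
      refine Summable.of_nonneg_of_le (fun k => integral_nonneg fun z => norm_nonneg _) (fun k => ?_)
        ((hsum.mul_left (C * D)).mul_left (μ.real (K n)))
      refine (setIntegral_mono_on (hint k).norm (integrableOn_const hfin.ne)
        (h.isCompact n).measurableSet (hb k)).trans (le_of_eq ?_)
      rw [setIntegral_const, smul_eq_mul]
    have hs := hasSum_integral_of_summable_integral_norm hint hnorm
    have h1 : ∀ k, ∫ z in K n, l z (y k) * x' k (b z) ∂μ =
        x' k (∫ z in K n, l z (y k) • b z ∂μ) := fun k => by
      rw [← (x' k).integral_comp_comm (h.integrableOn n (y k))]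
      simp
    simp_rw [h1] at hs
    rw [hs.tsum_eq]
    refine integral_congr_ae (ae_of_all _ fun z => ?_)
    have h2 := (l z).hasSum (hT (b z))
    simp only [map_smul, smul_eq_mul] at h2
    change ∑' k, l z (y k) * x' k (b z) = l z (T (b z))
    rw [← h2.tsum_eq]
    exact tsum_congr fun k => mul_comm _ _
  simp_rw [← hexch]
  obtain ⟨C, hC⟩ := h.exists_uniform_bound
  refine tendsto_tsum_of_dominated_convergence (hsum.mul_left C)
    (fun k => ((x' k).continuous.tendsto _).comp (h.tendsto (y k)))
    (Filter.Eventually.of_forall fun n k => ?_)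
  calc _ ≤ ‖x' k‖ * ‖∫ z in K n, l z (y k) • b z ∂μ‖ := (x' k).le_opNorm _
    _ ≤ ‖x' k‖ * (C * ‖y k‖) := by gcongr; exact hC n (y k)
    _ = _ := by ring

end Localization

/-! ### The resolution of the identity by time-frequency shifts -/

namespace ModulationSpace

variable {g : 𝓢(Rn d, ℂ)} {p q : ℝ≥0∞} [hp : Fact (1 ≤ p)] [hq : Fact (1 ≤ q)] {s : ℝ}

/-- The inversion formula over growing balls. The error y - P_n y is synthesised from the part of
the transform of y outside the ball; boundedness of synthesis makes the error at most C ‖y‖, and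
dominated convergence makes it tend to zero. -/
theorem isResolution_gaborAtom (hg : g ≠ 0) (hpt : p ≠ ⊤) (hqt : q ≠ ⊤) :
    letI := normedAddCommGroup (p := p) (q := q) (s := s) hg
    IsResolution (B := ModulationSpace g p q s) (volume : Measure (Rn d × Rn d))
      (fun n => Metric.closedBall 0 n)
      (fun z => schwartzCLM g p q s (gaborAtom g z.1 z.2))
      (fun z => (inversionConst g : ℂ)⁻¹ • evalCLM hg (stftAtom g z.1 z.2)) := by
  let := normedAddCommGroup (p := p) (q := q) (s := s) hg
  have := completeSpace (g := g) (p := p) (q := q) (s := s) hg hpt hqt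
  have hc : (inversionConst g : ℂ) ≠ 0 := by exact_mod_cast (inversionConst_pos hg).ne'
  have hvec : Continuous fun z : Rn d × Rn d => schwartzCLM g p q s (gaborAtom g z.1 z.2) :=
    (schwartzCLM g p q s).continuous.comp (continuous_gaborAtom g)
  have happ : ∀ y : ModulationSpace g p q s, Continuous fun z : Rn d × Rn d =>
      ((inversionConst g : ℂ)⁻¹ • evalCLM hg (stftAtom g z.1 z.2)) y := fun y =>
    continuous_const.mul (continuous_stft g (toDistribution y))
  set P : ℕ → ModulationSpace g p q s → ModulationSpace g p q s := fun n y =>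
    ∫ z in Metric.closedBall (0 : Rn d × Rn d) n,
      ((inversionConst g : ℂ)⁻¹ • evalCLM hg (stftAtom g z.1 z.2)) y •
        schwartzCLM g p q s (gaborAtom g z.1 z.2) with hP
  let H : ℕ → ModulationSpace g p q s → Rn d × Rn d → ℂ := fun n y =>
    (Metric.closedBall (0 : Rn d × Rn d) n)ᶜ.indicator fun z => stft g (toDistribution y) z.1 z.2
  have hHm : ∀ n y, Measurable (H n y) := fun n y =>
    (continuous_stft g (toDistribution y)).measurable.indicator
      Metric.isClosed_closedBall.measurableSet.compl
  have hint : ∀ n (y : ModulationSpace g p q s), IntegrableOn (fun z : Rn d × Rn d =>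
      ((inversionConst g : ℂ)⁻¹ • evalCLM hg (stftAtom g z.1 z.2)) y •
        schwartzCLM g p q s (gaborAtom g z.1 z.2)) (Metric.closedBall 0 n) volume := fun n y =>
    ((happ y).smul hvec).continuousOn.integrableOn_compact (isCompact_closedBall 0 _)
  -- Subtracting the integral over the ball from the full inversion formula leaves the integral over
  -- the complement, which has the form that the synthesis bound requires.
  have hsynth : ∀ n y u, (inversionConst g : ℂ) * toDistribution (y - P n y) u =
      ∫ z, H n y z * ofSchwartz u (gaborAtom g z.1 z.2) := by
    intro n y u
    have h1 := stft_inversion g (toDistribution y) u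
    have hms : MeasurableSet (Metric.closedBall (0 : Rn d × Rn d) n) :=
      Metric.isClosed_closedBall.measurableSet
    have h2 : (inversionConst g : ℂ) * evalCLM hg u (P n y) =
        ∫ z in Metric.closedBall (0 : Rn d × Rn d) n,
          stft g (toDistribution y) z.1 z.2 * ofSchwartz u (gaborAtom g z.1 z.2) := by
      rw [hP, ← (evalCLM hg u).integral_comp_comm (hint n y), ← integral_const_mul]
      refine integral_congr_ae (ae_of_all _ fun z => ?_)
      simp only [map_smul, smul_eq_mul, evalCLM_apply, toDistribution_schwartzCLM, smul_apply]
      rw [ofSchwartz_apply, ofSchwartz_apply, ← mul_assoc, ← mul_assoc, mul_inv_cancel₀ hc, one_mul]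
      simp_rw [mul_comm (u _)]
      rfl
    have h3 := integral_add_compl hms h1.1
    have h4 : (fun z => H n y z * ofSchwartz u (gaborAtom g z.1 z.2)) =
        (Metric.closedBall (0 : Rn d × Rn d) n)ᶜ.indicator fun z =>
          stft g (toDistribution y) z.1 z.2 * ofSchwartz u (gaborAtom g z.1 z.2) := by
      funext z
      by_cases hz : z ∈ (Metric.closedBall (0 : Rn d × Rn d) n)ᶜ
      · simp only [H, Set.indicator_of_mem hz]
      · simp only [H, Set.indicator_of_notMem hz, zero_mul]
    rw [h4, integral_indicator hms.compl, ← evalCLM_apply hg, map_sub, mul_sub, h2, evalCLM_apply,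
      ← h1.2, ← h3]
    ring
  obtain ⟨C, hC, hCb⟩ := exists_modNorm_le_of_synthesis hg hp.out hq.out hpt hqt s
  have hle : ∀ n y x ξ, ‖polyWeight s x ξ • H n y (x, ξ)‖ₑ ≤
      ‖polyWeight s x ξ • stft g (toDistribution y) x ξ‖ₑ := by
    intro n y x ξ
    rw [enorm_smul, enorm_smul]
    gcongr
    exact enorm_indicator_le_enorm_self _ _
  have hsmall : ∀ n y, modNorm g p q s (toDistribution (y - P n y)) ≤
      C * mixedNorm volume volume p q fun x ξ => ‖polyWeight s x ξ • H n y (x, ξ)‖ₑ := fun n y =>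
    hCb _ (hHm n y) _ (hsynth n y)
  have hbound : ∀ n y, ‖y - P n y‖ ≤ C.toReal * ‖y‖ := by
    intro n y
    have h1 : modNorm g p q s (toDistribution (y - P n y)) ≤
        C * modNorm g p q s (toDistribution y) := by
      refine (hsmall n y).trans ?_
      rw [modNorm_eq_mixedNorm g p q s (toDistribution y)]
      gcongr
      exact mixedNorm_mono (hle n y)
    have h2 := ENNReal.toReal_mono (ENNReal.mul_ne_top hC (modNorm_lt_top y).ne) h1
    rwa [ENNReal.toReal_mul] at h2
  refine ⟨fun n => isCompact_closedBall 0 _, hvec, happ, fun n => ?_, fun y => ?_, ?_⟩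
  · obtain ⟨Q, hQc, hQ⟩ := exists_seminorm_eval_bound g p q s hg
    obtain ⟨D, hD⟩ := (isCompact_closedBall (0 : Rn d × Rn d) n).exists_bound_of_continuousOn
      (hQc.comp (continuous_stftAtom g)).continuousOn
    refine ⟨‖(inversionConst g : ℂ)⁻¹‖ * D, fun z hz => ?_⟩
    rw [norm_smul]
    gcongr
    have hD0 : 0 ≤ D := (norm_nonneg _).trans (hD z hz)
    refine ContinuousLinearMap.opNorm_le_bound _ hD0 fun y => ?_
    rw [mul_comm]
    refine (hQ y _).trans ?_
    gcongr
    exact (le_abs_self _).trans (hD z hz)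
  · rw [tendsto_iff_norm_sub_tendsto_zero]
    have h1 := tendsto_mixedNorm_zero (μ := (volume : Measure (Rn d)))
      (ν := (volume : Measure (Rn d))) hp.out hpt hq.out hqt
      (u := fun n x ξ => ‖polyWeight s x ξ • H n y (x, ξ)‖ₑ)
      (fun n => ((continuous_polyWeight s).measurable.smul (hHm n y)).enorm)
      (v := fun x ξ => ‖polyWeight s x ξ • stft g (toDistribution y) x ξ‖ₑ)
      (continuous_weighted_stft g s _).enorm.measurable
      (by rw [← modNorm_eq_mixedNorm]; exact (modNorm_lt_top y).ne) (fun n => hle n y)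
      (fun x ξ => by
        refine tendsto_const_nhds.congr' ?_
        filter_upwards [Filter.eventually_ge_atTop ⌈‖(x, ξ)‖⌉₊] with n hn
        have hmem : (x, ξ) ∈ Metric.closedBall (0 : Rn d × Rn d) n := by
          rw [mem_closedBall_zero_iff]
          exact Nat.ceil_le.1 hn
        simp [H, hmem])
    have h2 := ENNReal.Tendsto.const_mul h1 (Or.inr hC)
    rw [mul_zero] at h2
    have h3 := tendsto_of_tendsto_of_tendsto_of_le_of_le tendsto_const_nhds h2
      (fun n => zero_le) (fun n => hsmall n y)
    have h4 := (ENNReal.tendsto_toReal ENNReal.zero_ne_top).comp h3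
    refine h4.congr fun n => ?_
    rw [norm_sub_rev]
    rfl
  · refine ⟨1 + C.toReal, fun n y => ?_⟩
    have h1 := norm_sub_norm_le (P n y) y
    have h2 := hbound n y
    rw [norm_sub_rev] at h2
    change ‖P n y‖ ≤ _
    linarith

/-- The trace of a nuclear operator on a modulation space is well defined. -/
theorem trace_unique (hg : g ≠ 0) (hpt : p ≠ ⊤) (hqt : q ≠ ⊤)
    {T : ModulationSpace g p q s →L[ℂ] ModulationSpace g p q s}
    {x₁ x₂ : ℕ → ModulationSpace g p q s →L[ℂ] ℂ} {y₁ y₂ : ℕ → ModulationSpace g p q s}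
    (h₁ : IsNuclearRepresentation 1 T x₁ y₁) (h₂ : IsNuclearRepresentation 1 T x₂ y₂) :
    ∑' n, x₁ n (y₁ n) = ∑' n, x₂ n (y₂ n) :=
  letI := normedAddCommGroup (p := p) (q := q) (s := s) hg
  have := completeSpace (g := g) (p := p) (q := q) (s := s) hg hpt hqt
  have h := isResolution_gaborAtom (p := p) (q := q) (s := s) hg hpt hqt
  -- Both sums are limits of the same localised integrals.
  tendsto_nhds_unique (h.tendsto_trace h₁) (h.tendsto_trace h₂)

/-- A bounded operator on a modulation space that vanishes on Schwartz functions is zero. -/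
theorem eq_zero_of_schwartzCLM (hg : g ≠ 0) (hpt : p ≠ ⊤) (hqt : q ≠ ⊤)
    {T : ModulationSpace g p q s →L[ℂ] ModulationSpace g p q s}
    (hT : ∀ u, T (schwartzCLM g p q s u) = 0) : T = 0 :=
  letI := normedAddCommGroup (p := p) (q := q) (s := s) hg
  have := completeSpace (g := g) (p := p) (q := q) (s := s) hg hpt hqt
  have h := isResolution_gaborAtom (p := p) (q := q) (s := s) hg hpt hqt
  h.eq_zero fun _ => hT _

end ModulationSpace

/-! ### Orthonormality of the Hermite functions -/

theorem integrable_polynomial_mul_gaussian (a b : ℝ) (hb : 0 < b) (Q : Polynomial ℤ) :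
    Integrable fun t : ℝ => Polynomial.aeval (a * t) Q * Real.exp (-b * t ^ 2) := by
  simp_rw [Polynomial.aeval_eq_sum_range, Finset.sum_mul]
  refine integrable_finsetSum _ fun k _ => ?_
  have h := (integrable_rpow_mul_exp_neg_mul_sq hb (s := (k : ℝ))
    (by have := k.cast_nonneg (α := ℝ); linarith)).const_mul ((Q.coeff k : ℝ) * a ^ k)
  simp_rw [Real.rpow_natCast] at h
  refine h.congr (ae_of_all _ fun t => ?_)
  simp only [zsmul_eq_mul, mul_pow]
  ring

/-- The weighted inner product `∫ P(√2 t) Q(√2 t) exp (-t²) dt`. -/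
def hermiteInner (P Q : Polynomial ℤ) : ℝ :=
  ∫ t : ℝ, Polynomial.aeval (Real.sqrt 2 * t) (P * Q) * Real.exp (-1 * t ^ 2)

theorem hermiteInner_comm (P Q : Polynomial ℤ) : hermiteInner P Q = hermiteInner Q P := by
  rw [hermiteInner, hermiteInner, mul_comm]

/-- Integration by parts: He_m(√2 t) exp(-t²) has derivative -√2 He_{m+1}(√2 t) exp(-t²). The factor
√2 cancels against the one from the derivative of Q(√2 t). -/
theorem hermiteInner_hermite_succ (m : ℕ) (Q : Polynomial ℤ) :
    hermiteInner (Polynomial.hermite (m + 1)) Q =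
      hermiteInner (Polynomial.hermite m) (Polynomial.derivative Q) := by
  set w := Real.sqrt 2 with hw
  have hw2 : w * w = 2 := Real.mul_self_sqrt (by norm_num)
  have hw0 : w ≠ 0 := by positivity
  have hpoly : ∀ (Q : Polynomial ℤ) (t : ℝ), HasDerivAt (fun t => Polynomial.aeval (w * t) Q)
      (Polynomial.aeval (w * t) (Polynomial.derivative Q) * w) t := by
    intro Q t
    have h1 : HasDerivAt (fun t : ℝ => w * t) w t := by
      simpa using (hasDerivAt_id t).const_mul w
    exact (Q.hasDerivAt_aeval (w * t)).comp t h1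
  have hexp : ∀ t : ℝ, HasDerivAt (fun t : ℝ => Real.exp (-1 * t ^ 2))
      (Real.exp (-1 * t ^ 2) * (-2 * t)) t := by
    intro t
    have h1 : HasDerivAt (fun t : ℝ => -1 * t ^ 2) (-2 * t) t :=
      ((hasDerivAt_pow 2 t).const_mul (-1)).congr_deriv (by norm_num)
    exact h1.exp
  have hv : ∀ t, HasDerivAt
      (fun t => Polynomial.aeval (w * t) (Polynomial.hermite m) * Real.exp (-1 * t ^ 2))
      (-w * (Polynomial.aeval (w * t) (Polynomial.hermite (m + 1)) * Real.exp (-1 * t ^ 2))) t := by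
    intro t
    refine ((hpoly _ t).mul (hexp t)).congr_deriv ?_
    rw [Polynomial.hermite_succ, map_sub, map_mul, Polynomial.aeval_X]
    linear_combination (t * Polynomial.aeval (w * t) (Polynomial.hermite m) *
      Real.exp (-1 * t ^ 2)) * hw2
  have hint : ∀ P : Polynomial ℤ, Integrable fun t : ℝ =>
      Polynomial.aeval (w * t) P * Real.exp (-1 * t ^ 2) := fun P =>
    integrable_polynomial_mul_gaussian w 1 one_pos P
  have h := integral_mul_deriv_eq_deriv_mul_of_integrable (fun t _ => hpoly Q t) (fun t _ => hv t)
    (((hint (Polynomial.hermite (m + 1) * Q)).const_mul (-w)).congr (ae_of_all _ fun t => by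
      simp only [Pi.mul_apply, map_mul]; ring))
    (((hint (Polynomial.hermite m * Polynomial.derivative Q)).const_mul w).congr
      (ae_of_all _ fun t => by simp only [Pi.mul_apply, map_mul]; ring))
    ((hint (Polynomial.hermite m * Q)).congr (ae_of_all _ fun t => by
      simp only [Pi.mul_apply, map_mul]; ring))
  have h1 : -w * hermiteInner (Polynomial.hermite (m + 1)) Q =
      -(w * hermiteInner (Polynomial.hermite m) (Polynomial.derivative Q)) := by
    rw [hermiteInner, hermiteInner, ← integral_const_mul, ← integral_const_mul]
    convert h using 1
    · refine integral_congr_ae (ae_of_all _ fun t => ?_)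
      simp only [map_mul]; ring
    · congr 1
      refine integral_congr_ae (ae_of_all _ fun t => ?_)
      simp only [map_mul]; ring
  rw [neg_mul, neg_inj] at h1
  exact mul_left_cancel₀ hw0 h1

/-- Each step lowers both indices by one, since the derivative of He_{n+1} is (n + 1) He_n; this
accounts for the factorial, and the Gaussian integral for √π. -/
theorem hermiteInner_hermite (m n : ℕ) :
    hermiteInner (Polynomial.hermite m) (Polynomial.hermite n) =
      if m = n then n ! * Real.sqrt Real.pi else 0 := by
  have hzero : ∀ P, hermiteInner P 0 = 0 := fun P => by simp [hermiteInner]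
  induction m generalizing n with
  | zero =>
    cases n with
    | zero =>
      have := integral_gaussian 1
      rw [div_one] at this
      simpa [hermiteInner] using this
    | succ n =>
      rw [hermiteInner_comm, hermiteInner_hermite_succ]
      simp [hzero]
  | succ m ih =>
    rw [hermiteInner_hermite_succ]
    cases n with
    | zero => simp [hzero]
    | succ n =>
      have h : hermiteInner (Polynomial.hermite m) (Polynomial.derivative (Polynomial.hermite (n + 1)))
          = (n + 1 : ℝ) * hermiteInner (Polynomial.hermite m) (Polynomial.hermite n) := by
        rw [hermiteInner, hermiteInner, ← integral_const_mul]
        refine integral_congr_ae (ae_of_all _ fun t => ?_)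
        simp only [derivative_hermite_succ, map_mul, map_add, map_natCast, map_one]
        ring
      rw [h, ih]
      simp only [add_left_inj]
      split_ifs
      · rw [Nat.factorial_succ]; push_cast; ring
      · simp

theorem integral_normHermite_mul (m n : ℕ) :
    ∫ t : ℝ, normHermite m t * Real.exp (-(t ^ 2 / 2)) *
      (normHermite n t * Real.exp (-(t ^ 2 / 2))) = if m = n then 1 else 0 := by
  have h : ∀ t : ℝ, normHermite m t * Real.exp (-(t ^ 2 / 2)) *
      (normHermite n t * Real.exp (-(t ^ 2 / 2))) =
      ((Real.sqrt (m ! * Real.sqrt Real.pi))⁻¹ * (Real.sqrt (n ! * Real.sqrt Real.pi))⁻¹) *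
      (Polynomial.aeval (Real.sqrt 2 * t) (Polynomial.hermite m * Polynomial.hermite n) *
        Real.exp (-1 * t ^ 2)) := by
    intro t
    have he : Real.exp (-1 * t ^ 2) = Real.exp (-(t ^ 2 / 2)) * Real.exp (-(t ^ 2 / 2)) := by
      rw [← Real.exp_add]; congr 1; ring
    rw [he, normHermite, normHermite, map_mul]
    ring
  simp_rw [h]
  rw [integral_const_mul]
  change _ * hermiteInner _ _ = _
  rw [hermiteInner_hermite]
  split_ifs with hmn
  · subst hmn
    rw [← mul_inv, Real.mul_self_sqrt (by positivity)]
    exact inv_mul_cancel₀ (by positivity)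
  · simp

theorem hermiteDistribution_hermiteFunction (α β : Fin d → ℕ) :
    hermiteDistribution α (hermiteFunction β) = if α = β then 1 else 0 := by
  change ofSchwartz (hermiteFunction α) (hermiteFunction β) = _
  rw [ofSchwartz_apply]
  have h : ∀ y : Rn d, hermiteFunction β y * hermiteFunction α y =
      ((∏ i, (normHermite (β i) (y i) * Real.exp (-((y i) ^ 2 / 2)) *
        (normHermite (α i) (y i) * Real.exp (-((y i) ^ 2 / 2)))) : ℝ) : ℂ) := by
    intro y
    rw [hermiteFunction_apply, hermiteFunction_apply, ← Complex.ofReal_mul,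
      ← Finset.prod_mul_distrib]
  simp_rw [h]
  rw [integral_complex_ofReal]
  have hv := (EuclideanSpace.volume_preserving_symm_measurableEquiv_toLp (Fin d)).integral_comp'
    (fun y : Fin d → ℝ => ∏ i, (normHermite (β i) (y i) * Real.exp (-((y i) ^ 2 / 2)) *
        (normHermite (α i) (y i) * Real.exp (-((y i) ^ 2 / 2)))))
  have hv2 := hv.trans (integral_fintype_prod_volume_eq_prod fun (i : Fin d) (t : ℝ) =>
    normHermite (β i) t * Real.exp (-(t ^ 2 / 2)) *
        (normHermite (α i) t * Real.exp (-(t ^ 2 / 2))))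
  refine (congrArg Complex.ofReal hv2).trans ?_
  simp_rw [integral_normHermite_mul]
  by_cases hαβ : α = β
  · subst hαβ; simp
  · rw [if_neg hαβ]
    obtain ⟨i, hi⟩ := Function.ne_iff.1 hαβ
    rw [Finset.prod_eq_zero (Finset.mem_univ i) (if_neg hi.symm), Complex.ofReal_zero]

theorem conjSchwartz_hermiteFunction (α : Fin d → ℕ) :
    conjSchwartz (hermiteFunction α) = hermiteFunction α := by
  ext y
  rw [conjSchwartz_apply, hermiteFunction_apply, Complex.conj_ofReal]

/-! ### Totality of the Hermite functions -/

/-- The three-term recurrence. For n = 0 the truncated n - 1 is 0 instead of -1, which does no harm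
because the coefficient b then contains the factor n = 0. -/
theorem exists_mul_normHermite (n : ℕ) : ∃ a b : ℝ, ∀ t,
    t * normHermite n t = a * normHermite (n + 1) t + b * normHermite (n - 1) t := by
  have hc : ∀ n : ℕ, (Real.sqrt (n ! * Real.sqrt Real.pi))⁻¹ ≠ 0 := fun n => by positivity
  set w := Real.sqrt 2 with hw
  have hw0 : w ≠ 0 := by positivity
  have hrec : ∀ t : ℝ, w * t * Polynomial.aeval (w * t) (Polynomial.hermite n) =
      Polynomial.aeval (w * t) (Polynomial.hermite (n + 1)) +
        n * Polynomial.aeval (w * t) (Polynomial.hermite (n - 1)) := by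
    intro t
    rw [Polynomial.hermite_succ, map_sub, map_mul, Polynomial.aeval_X]
    cases n with
    | zero => simp
    | succ k =>
      rw [derivative_hermite_succ, map_mul, map_add, map_natCast, map_one, Nat.add_sub_cancel]
      push_cast; ring
  refine ⟨(Real.sqrt (n ! * Real.sqrt Real.pi))⁻¹ / w /
    (Real.sqrt ((n + 1)! * Real.sqrt Real.pi))⁻¹, (Real.sqrt (n ! * Real.sqrt Real.pi))⁻¹ / w * n /
    (Real.sqrt ((n - 1)! * Real.sqrt Real.pi))⁻¹, fun t => ?_⟩
  simp only [normHermite]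
  rw [← mul_assoc (_ / _), div_mul_cancel₀ _ (hc (n + 1)), ← mul_assoc (_ / _),
    div_mul_cancel₀ _ (hc (n - 1))]
  rw [← hw, mul_assoc, ← mul_add, ← hrec t]
  field_simp

theorem exists_coord_mul_hermiteFunction (α : Fin d → ℕ) (i : Fin d) : ∃ a b : ℂ, ∀ y : Rn d,
    (y i : ℂ) * hermiteFunction α y =
      a * hermiteFunction (Function.update α i (α i + 1)) y +
      b * hermiteFunction (Function.update α i (α i - 1)) y := by
  obtain ⟨a, b, hab⟩ := exists_mul_normHermite (α i)
  refine ⟨a, b, fun y => ?_⟩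
  have h : ∀ n, hermiteFunction (Function.update α i n) y =
      ((normHermite n (y i) * Real.exp (-((y i) ^ 2 / 2)) *
        ∏ j ∈ Finset.univ.erase i, (normHermite (α j) (y j) * Real.exp (-((y j) ^ 2 / 2))) : ℝ) :
          ℂ) := by
    intro n
    rw [hermiteFunction_apply, ← Finset.mul_prod_erase _ _ (Finset.mem_univ i),
      Function.update_self]
    congr 2
    refine Finset.prod_congr rfl fun j hj => ?_
    rw [Function.update_of_ne (Finset.ne_of_mem_erase hj)]
  have h0 := h (α i)
  rw [Function.update_eq_self] at h0
  rw [h0, h, h, ← Complex.ofReal_mul, ← Complex.ofReal_mul, ← Complex.ofReal_mul,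
    ← Complex.ofReal_add]
  congr 1
  linear_combination (Real.exp (-((y i) ^ 2 / 2)) *
    ∏ j ∈ Finset.univ.erase i, (normHermite (α j) (y j) * Real.exp (-((y j) ^ 2 / 2)))) * hab (y i)

/-- The linear span of the Hermite functions. -/
def hermiteSpan (d : ℕ) : Submodule ℂ 𝓢(Rn d, ℂ) := Submodule.span ℂ (Set.range hermiteFunction)

theorem smulLeftCLM_mem_hermiteSpan (l : Rn d →L[ℝ] ℂ) {u : 𝓢(Rn d, ℂ)} (hu : u ∈ hermiteSpan d) :
    SchwartzMap.smulLeftCLM ℂ (fun y => l y) u ∈ hermiteSpan d := by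
  induction hu using Submodule.span_induction with
  | mem u hu =>
    obtain ⟨α, rfl⟩ := hu
    choose a b hab using fun i => exists_coord_mul_hermiteFunction α i
    have h : SchwartzMap.smulLeftCLM ℂ (fun y => l y) (hermiteFunction α) =
        ∑ i, l (EuclideanSpace.basisFun (Fin d) ℝ i) •
          (a i • hermiteFunction (Function.update α i (α i + 1)) +
          b i • hermiteFunction (Function.update α i (α i - 1))) := by
      ext y
      rw [SchwartzMap.smulLeftCLM_apply_apply l.hasTemperateGrowth, sum_apply]
      have hy : l y = ∑ i, (y i : ℂ) * l (EuclideanSpace.basisFun (Fin d) ℝ i) := by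
        conv_lhs => rw [← (EuclideanSpace.basisFun (Fin d) ℝ).sum_repr y]
        rw [map_sum]
        refine Finset.sum_congr rfl fun i _ => ?_
        rw [map_smul, Complex.real_smul]
        rfl
      rw [hy, Finset.sum_smul]
      refine Finset.sum_congr rfl fun i _ => ?_
      simp only [smul_apply, add_apply, smul_eq_mul]
      rw [← hab]
      ring
    rw [h]
    refine Submodule.sum_mem _ fun i _ => Submodule.smul_mem _ _ (Submodule.add_mem _ ?_ ?_) <;>
    exact Submodule.smul_mem _ _ (Submodule.subset_span ⟨_, rfl⟩)
  | zero => rw [map_zero]; exact Submodule.zero_mem _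
  | add u v _ _ hu hv => rw [map_add]; exact Submodule.add_mem _ hu hv
  | smul c u _ hu => rw [map_smul]; exact Submodule.smul_mem _ _ hu

theorem hermiteFunction_zero_apply (y : Rn d) : hermiteFunction (0 : Fin d → ℕ) y =
    ((((Real.sqrt (Real.sqrt Real.pi))⁻¹) ^ d : ℝ) : ℂ) *
      ((Real.exp (-(‖y‖ ^ 2 / 2)) : ℝ) : ℂ) := by
  rw [hermiteFunction_apply, ← Complex.ofReal_mul, Finset.prod_mul_distrib, ← Real.exp_sum,
    Finset.sum_neg_distrib, ← Finset.sum_div, EuclideanSpace.norm_sq_eq]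
  simp [normHermite]

/-- From τⁿ/n! = 2⁻ⁿ (2τ)ⁿ/n! ≤ 2⁻ⁿ exp(2τ): doubling the exponent buys a geometric factor in n. A
derivative lowers n by one and brings out ‖l‖, so it costs exactly 2‖l‖. -/
theorem norm_iteratedFDeriv_pow_div_factorial_le {E : Type*} [NormedAddCommGroup E]
    [NormedSpace ℝ E] (l : E →L[ℝ] ℂ) (i n : ℕ) (y : E) :
    ‖iteratedFDeriv ℝ i (fun y => l y ^ n / (n ! : ℂ)) y‖ ≤
      (2 * ‖l‖) ^ i * ((1 / 2) ^ n * Real.exp (2 * ‖l‖ * ‖y‖)) := by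
  induction i generalizing n with
  | zero =>
    rw [norm_iteratedFDeriv_zero, pow_zero, one_mul, norm_div, norm_pow, Complex.norm_natCast]
    have h1 := Real.pow_div_factorial_le_exp (2 * ‖l‖ * ‖y‖) (by positivity) n
    calc ‖l y‖ ^ n / (n ! : ℝ) ≤ (‖l‖ * ‖y‖) ^ n / (n ! : ℝ) := by gcongr; exact l.le_opNorm y
      _ = (1 / 2) ^ n * ((2 * ‖l‖ * ‖y‖) ^ n / (n ! : ℝ)) := by
        rw [mul_assoc 2, mul_pow 2, one_div, inv_pow]; field_simp
      _ ≤ _ := by gcongr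
  | succ i ih =>
    cases n with
    | zero =>
      have : (fun y : E => l y ^ 0 / ((0 !  : ℕ) : ℂ)) = fun _ => 1 := by simp
      rw [this, iteratedFDeriv_const_of_ne (Nat.succ_ne_zero i)]
      simp only [Pi.zero_apply, norm_zero]
      positivity
    | succ n =>
      have hd : fderiv ℝ (fun y : E => l y ^ (n + 1) / ((n + 1)! : ℂ)) =
          fun y => (ContinuousLinearMap.mul ℝ ℂ (l y ^ n / (n ! : ℂ))).comp l := by
        funext y
        have h1 : HasFDerivAt (fun y : E => l y ^ (n + 1) / ((n + 1)! : ℂ)) _ y :=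
          ((l.hasFDerivAt (x := y)).pow (n + 1)).mul_const (((n + 1)! : ℂ)⁻¹)
        rw [h1.fderiv]
        ext v
        have h2 : ((n + 1)! : ℂ) = (n + 1) * n ! := by
          rw [Nat.factorial_succ]; push_cast; ring
        have h3 : (n ! : ℂ) ≠ 0 := by exact_mod_cast n.factorial_ne_zero
        have h4 : (n + 1 : ℂ) ≠ 0 := by exact_mod_cast n.succ_ne_zero
        simp [h2]
        field_simp
      have hc : ContDiff ℝ ⊤ (fun y : E => l y ^ n / (n ! : ℂ)) :=
        (l.contDiff.pow n).div_const _
      let L : ℂ →L[ℝ] (E →L[ℝ] ℂ) :=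
        ((ContinuousLinearMap.compL ℝ E ℂ ℂ).flip l).comp (ContinuousLinearMap.mul ℝ ℂ)
      have hL : ‖L‖ ≤ ‖l‖ := by
        refine ContinuousLinearMap.opNorm_le_bound _ (norm_nonneg _) fun c => ?_
        refine ContinuousLinearMap.opNorm_le_bound _ (by positivity) fun v => ?_
        change ‖c * l v‖ ≤ _
        rw [norm_mul, mul_comm ‖l‖, mul_assoc]
        gcongr
        exact l.le_opNorm v
      rw [← norm_iteratedFDeriv_fderiv, hd]
      have h := L.norm_iteratedFDeriv_comp_left (x := y) (n := i) hc.contDiffAt (mod_cast le_top)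
      refine h.trans ((mul_le_mul hL (ih n) (norm_nonneg _) (norm_nonneg _)).trans (le_of_eq ?_))
      ring

/-- The Gaussian outweighs both the polynomial and the exponential. The polynomial factor is bounded
by a factorial times exp(1 + t), and completing the square in (a + 1) t - t²/2 yields the constant.
-/
theorem exists_exp_mul_gaussian_bound (k n : ℕ) (a : ℝ) : ∃ C : ℝ, ∀ x : Rn d,
    ‖x‖ ^ k * (Real.exp (a * ‖x‖) *
      ‖iteratedFDeriv ℝ n (fun x : Rn d => Real.exp (-(‖x‖ ^ 2 / 2))) x‖) ≤ C := by
  have hf : Function.HasTemperateGrowth (fun x : Rn d => -(‖x‖ ^ 2 / 2)) := by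
    have h1 : Function.HasTemperateGrowth (fun x : Rn d => (-(1 / 2) : ℝ) * ‖x‖ ^ 2) := by fun_prop
    convert h1 using 2
    ring
  obtain ⟨m, C, hC, hb⟩ := hf.norm_iteratedFDeriv_le_uniform n
  refine ⟨n ! * (1 + C) ^ n * ((k + m * n)! * Real.exp (1 + (a + 1) ^ 2 / 2)), fun x => ?_⟩
  set t := ‖x‖ with ht
  have ht0 : 0 ≤ t := norm_nonneg x
  have hD := norm_iteratedFDeriv_comp_le (𝕜 := ℝ) (g := Real.exp)
    (f := fun x : Rn d => -(‖x‖ ^ 2 / 2)) (n := n) (N := (⊤ : ℕ∞)) Real.contDiff_exp hf.1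
    (by exact_mod_cast le_top) x (C := Real.exp (-(t ^ 2 / 2))) (D := (1 + C) * (1 + t) ^ m)
    (by
      intro i _
      rw [norm_iteratedFDeriv_eq_norm_iteratedDeriv, iteratedDeriv_eq_iterate,
        Real.iter_deriv_exp, Real.norm_of_nonneg (Real.exp_pos _).le])
    (by
      intro i hi1 hi
      have hone : 1 ≤ (1 + C) * (1 + t) ^ m :=
        one_le_mul_of_one_le_of_one_le (by linarith) (one_le_pow₀ (by linarith))
      calc _ ≤ C * (1 + t) ^ m := hb i hi x
        _ ≤ (1 + C) * (1 + t) ^ m := by gcongr; linarith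
        _ ≤ ((1 + C) * (1 + t) ^ m) ^ i := le_self_pow₀ hone (by omega))
  have hpow : (1 + t) ^ (k + m * n) * (Real.exp (a * t) * Real.exp (-(t ^ 2 / 2))) ≤
      (k + m * n)! * Real.exp (1 + (a + 1) ^ 2 / 2) := by
    have h2 := Real.pow_div_factorial_le_exp (1 + t) (by positivity) (k + m * n)
    rw [div_le_iff₀ (by positivity)] at h2
    calc _ ≤ (Real.exp (1 + t) * (k + m * n)!) * (Real.exp (a * t) * Real.exp (-(t ^ 2 / 2))) := by
          gcongr
      _ = (k + m * n)! * Real.exp (1 + t + (a * t + -(t ^ 2 / 2))) := by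
          rw [Real.exp_add (1 + t), Real.exp_add (a * t)]; ring
      _ ≤ _ := by
          refine mul_le_mul_of_nonneg_left (Real.exp_le_exp.2 ?_) (by positivity)
          nlinarith [sq_nonneg (t - (a + 1))]
  calc t ^ k * (Real.exp (a * t) *
        ‖iteratedFDeriv ℝ n (fun x : Rn d => Real.exp (-(‖x‖ ^ 2 / 2))) x‖)
      ≤ (1 + t) ^ k * (Real.exp (a * t) *
          (n ! * Real.exp (-(t ^ 2 / 2)) * ((1 + C) * (1 + t) ^ m) ^ n)) := by
        gcongr
        · linarith
        · exact hD
    _ = n ! * (1 + C) ^ n * ((1 + t) ^ (k + m * n) *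
          (Real.exp (a * t) * Real.exp (-(t ^ 2 / 2)))) := by
        rw [mul_pow, pow_add, pow_mul]; ring
    _ ≤ _ := by gcongr

theorem exists_exp_mul_hermiteFunction_zero_bound (k n : ℕ) (a : ℝ) : ∃ C : ℝ, ∀ x : Rn d,
    ‖x‖ ^ k * (Real.exp (a * ‖x‖) *
      ‖iteratedFDeriv ℝ n (hermiteFunction (0 : Fin d → ℕ)) x‖) ≤ C := by
  obtain ⟨C, hC⟩ := exists_exp_mul_gaussian_bound (d := d) k n a
  let L : ℝ →L[ℝ] ℂ := ((((Real.sqrt (Real.sqrt Real.pi))⁻¹) ^ d : ℝ) : ℂ) • Complex.ofRealCLM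
  refine ⟨‖L‖ * C, fun x => ?_⟩
  have hfun : (hermiteFunction (0 : Fin d → ℕ) : Rn d → ℂ) =
      L ∘ fun x : Rn d => Real.exp (-(‖x‖ ^ 2 / 2)) := by
    funext y
    rw [hermiteFunction_zero_apply]
    rfl
  rw [hfun]
  have h := L.norm_iteratedFDeriv_comp_left (x := x) (n := n)
    ((gaussian d).smooth ⊤).contDiffAt (mod_cast le_top)
  calc _ ≤ ‖x‖ ^ k * (Real.exp (a * ‖x‖) *
        (‖L‖ * ‖iteratedFDeriv ℝ n (fun x : Rn d => Real.exp (-(‖x‖ ^ 2 / 2))) x‖)) := by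
        gcongr
        exact h
    _ = ‖L‖ * (‖x‖ ^ k * (Real.exp (a * ‖x‖) *
        ‖iteratedFDeriv ℝ n (fun x : Rn d => Real.exp (-(‖x‖ ^ 2 / 2))) x‖)) := by ring
    _ ≤ _ := by gcongr; exact hC x

/-- The terms `ℓⁿ/n! φ₀` of the expansion of `exp(ℓ) φ₀`. -/
def expTerm (l : Rn d →L[ℝ] ℂ) (n : ℕ) : 𝓢(Rn d, ℂ) :=
  (n ! : ℂ)⁻¹ • (SchwartzMap.smulLeftCLM ℂ (fun y => l y))^[n] (hermiteFunction 0)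

theorem expTerm_apply (l : Rn d →L[ℝ] ℂ) (n : ℕ) (y : Rn d) :
    expTerm l n y = l y ^ n / (n ! : ℂ) * hermiteFunction 0 y := by
  have h : (SchwartzMap.smulLeftCLM ℂ (fun y => l y))^[n] (hermiteFunction 0) y =
      l y ^ n * hermiteFunction 0 y := by
    induction n with
    | zero => simp
    | succ n ih =>
      rw [Function.iterate_succ_apply', SchwartzMap.smulLeftCLM_apply_apply l.hasTemperateGrowth,
        ih, smul_eq_mul, pow_succ']
      ring
  rw [expTerm, smul_apply, h, smul_eq_mul]
  ring

theorem expTerm_mem_hermiteSpan (l : Rn d →L[ℝ] ℂ) (n : ℕ) : expTerm l n ∈ hermiteSpan d := by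
  refine Submodule.smul_mem _ _ ?_
  induction n with
  | zero => exact Submodule.subset_span ⟨0, rfl⟩
  | succ n ih =>
    rw [Function.iterate_succ_apply']
    exact smulLeftCLM_mem_hermiteSpan l ih

/-- The Gaussian factor absorbs the exponential in the bound for lⁿ/n!, and the geometric factor
survives; hence the expansion of exp(l) φ₀ converges absolutely in every Schwartz seminorm. -/
theorem exists_seminorm_expTerm_le (l : Rn d →L[ℝ] ℂ) (k m : ℕ) :
    ∃ C : ℝ, 0 ≤ C ∧ ∀ n, SchwartzMap.seminorm ℂ k m (expTerm l n) ≤ C * (1 / 2) ^ n := by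
  choose C hC using fun j => exists_exp_mul_hermiteFunction_zero_bound (d := d) k j (2 * ‖l‖)
  have hC0 : ∀ j, 0 ≤ C j := fun j => le_trans (by positivity) (hC j 0)
  have hD0 : 0 ≤ ∑ i ∈ Finset.range (m + 1), (m.choose i : ℝ) * (2 * ‖l‖) ^ i * C (m - i) :=
    Finset.sum_nonneg fun i _ => mul_nonneg (by positivity) (hC0 _)
  refine ⟨_, hD0, fun n => ?_⟩
  refine SchwartzMap.seminorm_le_bound ℂ k m _ (by positivity) fun x => ?_
  have hfun : (expTerm l n : Rn d → ℂ) =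
      fun y => (l y ^ n / (n ! : ℂ)) * hermiteFunction 0 y := funext (expTerm_apply l n)
  have hc : ContDiff ℝ ⊤ (fun y : Rn d => l y ^ n / (n ! : ℂ)) := (l.contDiff.pow n).div_const _
  have h := norm_iteratedFDeriv_mul_le (hc.of_le le_top)
    ((hermiteFunction (0 : Fin d → ℕ)).smooth ⊤) x (n := m) (mod_cast le_top)
  rw [hfun]
  refine (mul_le_mul_of_nonneg_left h (by positivity)).trans ?_
  rw [Finset.mul_sum, Finset.sum_mul]
  refine Finset.sum_le_sum fun i _ => ?_
  have h1 := norm_iteratedFDeriv_pow_div_factorial_le l i n x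
  calc _ ≤ ‖x‖ ^ k * ((m.choose i : ℝ) *
        ((2 * ‖l‖) ^ i * ((1 / 2) ^ n * Real.exp (2 * ‖l‖ * ‖x‖))) *
          ‖iteratedFDeriv ℝ (m - i) (hermiteFunction (0 : Fin d → ℕ)) x‖) := by gcongr
    _ = (m.choose i : ℝ) * (2 * ‖l‖) ^ i * (1 / 2) ^ n * (‖x‖ ^ k * (Real.exp (2 * ‖l‖ * ‖x‖) *
          ‖iteratedFDeriv ℝ (m - i) (hermiteFunction (0 : Fin d → ℕ)) x‖)) := by ring
    _ ≤ (m.choose i : ℝ) * (2 * ‖l‖) ^ i * (1 / 2) ^ n * C (m - i) := by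
        gcongr
        exact hC (m - i) x
    _ = _ := by ring

/-- Seen as an integral over counting measure, the expansion falls under
`SchwartzIntegrable.integrable_integral_apply`, so that functionals may be applied term by term. -/
theorem schwartzIntegrable_expTerm (l : Rn d →L[ℝ] ℂ) :
    SchwartzIntegrable (expTerm l) Measure.count := by
  refine ⟨continuous_of_discreteTopology, fun p hp => ?_⟩
  obtain ⟨t, C, -, hC⟩ := Seminorm.bound_of_continuous (schwartz_withSeminorms ℂ (Rn d) ℂ) p hp
  choose D hD0 hD using fun i : ℕ × ℕ => exists_seminorm_expTerm_le l i.1 i.2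
  rw [integrable_count_iff]
  refine Summable.of_nonneg_of_le (fun n => norm_nonneg _) (fun n => ?_)
    (summable_geometric_two.mul_left (C * ∑ i ∈ t, D i))
  rw [Real.norm_of_nonneg (apply_nonneg _ _)]
  refine (hC _).trans ?_
  change (C : ℝ) * _ ≤ _
  rw [mul_assoc]
  gcongr
  refine Seminorm.finset_sup_apply_le
    (mul_nonneg (Finset.sum_nonneg fun i _ => hD0 i) (by positivity)) fun i hi => ?_
  refine (hD i n).trans ?_
  gcongr
  exact Finset.single_le_sum (fun i _ => hD0 i) hi

/-- A tempered distribution that vanishes on all Hermite functions is zero. -/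
theorem eq_zero_of_hermiteFunction {f : 𝓢'(Rn d, ℂ)} (hf : ∀ α, f (hermiteFunction α) = 0) :
    f = 0 := by
  have hspan : ∀ u ∈ hermiteSpan d, f u = 0 := by
    intro u hu
    induction hu using Submodule.span_induction with
    | mem u hu =>
      obtain ⟨α, rfl⟩ := hu
      exact hf α
    | zero => exact map_zero f
    | add u v _ _ hu hv => rw [map_add, hu, hv, add_zero]
    | smul c u _ hu => rw [map_smul, hu, smul_zero]
  have hne : hermiteFunction (0 : Fin d → ℕ) ≠ 0 := by
    intro h
    have := hermiteDistribution_hermiteFunction (0 : Fin d → ℕ) 0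
    rw [h, map_zero] at this
    simp at this
  refine eq_zero_of_stft_eq_zero hne fun x ξ => ?_
  -- With the window φ₀ the atom is exp(-|x|²/2) exp(l) φ₀ for l(y) = x·y - i ξ·y, by expanding |y -
  -- x|². Each term lⁿ/n! φ₀ lies in the span of the Hermite functions, so f kills every atom and
  -- its transform vanishes.
  let l : Rn d →L[ℝ] ℂ := Complex.ofRealCLM.comp (innerSL ℝ x) -
    Complex.I • Complex.ofRealCLM.comp (innerSL ℝ ξ)
  have hl : ∀ y, l y = ((⟪x, y⟫_ℝ : ℝ) : ℂ) - Complex.I * ((⟪ξ, y⟫_ℝ : ℝ) : ℂ) := fun y => rfl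
  have hsum : ∀ y, ∫ n, expTerm l n y ∂Measure.count =
      (((Real.exp (‖x‖ ^ 2 / 2) : ℝ) : ℂ) • stftAtom (hermiteFunction 0) x ξ) y := by
    intro y
    rw [integral_countable ((schwartzIntegrable_expTerm l).integrable_eval y)]
    simp only [expTerm_apply, Measure.real, Measure.count_singleton, ENNReal.toReal_one, one_smul]
    rw [tsum_mul_right, (NormedSpace.expSeries_div_hasSum_exp (l y)).tsum_eq,
      ← Complex.exp_eq_exp_ℂ, smul_apply, stftAtom_apply, hermiteFunction_zero_apply,
      hermiteFunction_zero_apply, map_mul, Complex.conj_ofReal, Complex.conj_ofReal, smul_eq_mul]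
    have h1 : Complex.exp (l y) * ((Real.exp (-(‖y‖ ^ 2 / 2)) : ℝ) : ℂ) =
        ((Real.exp (‖x‖ ^ 2 / 2) : ℝ) : ℂ) * (Complex.exp (-(Complex.I * ((⟪y, ξ⟫_ℝ : ℝ) : ℂ))) *
          ((Real.exp (-(‖y - x‖ ^ 2 / 2)) : ℝ) : ℂ)) := by
      rw [Complex.ofReal_exp, Complex.ofReal_exp, Complex.ofReal_exp, ← Complex.exp_add,
        ← Complex.exp_add, ← Complex.exp_add, hl, norm_sub_sq_real, real_inner_comm x y,
        real_inner_comm ξ y]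
      congr 1
      push_cast
      ring
    linear_combination ((((Real.sqrt (Real.sqrt Real.pi))⁻¹) ^ d : ℝ) : ℂ) * h1
  have h := ((schwartzIntegrable_expTerm l).integrable_integral_apply hsum f).2
  have h2 : f (((Real.exp (‖x‖ ^ 2 / 2) : ℝ) : ℂ) • stftAtom (hermiteFunction 0) x ξ) = 0 :=
    h.symm.trans (integral_eq_zero_of_ae
      (ae_of_all _ fun n => hspan _ (expTerm_mem_hermiteSpan l n)))
  rw [map_smul, smul_eq_mul, mul_eq_zero] at h2
  exact h2.resolve_left (by exact_mod_cast (Real.exp_pos _).ne')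

/-! ### Functions of the harmonic oscillator -/

theorem ofSchwartz_injective {u : 𝓢(Rn d, ℂ)} (hu : ofSchwartz u = 0) : u = 0 := by
  by_contra hne
  have h1 : ofSchwartz u (conjSchwartz u) = 0 := by rw [hu]; rfl
  have h2 : ofSchwartz u (conjSchwartz u) = ((∫ y, ‖u y‖ ^ 2 : ℝ) : ℂ) := by
    rw [ofSchwartz_apply, ← integral_complex_ofReal]
    refine integral_congr_ae (ae_of_all _ fun y => ?_)
    simp only [conjSchwartz_apply]
    rw [← Complex.normSq_eq_conj_mul_self, Complex.normSq_eq_norm_sq]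
  rw [h2, Complex.ofReal_eq_zero] at h1
  have h3 := inversionConst_pos hne
  rw [inversionConst, h1, mul_zero] at h3
  exact lt_irrefl _ h3

/-- The operator is moved to the test function. That the Schwartz function so obtained is λ_β φ_β
follows from the eigenvalue equation for distributions, the symmetry of the pairing, orthonormality
and totality, without another computation of derivatives. -/
theorem harmonicOscillator_apply_hermiteFunction (f : 𝓢'(Rn d, ℂ)) (β : Fin d → ℕ) :
    harmonicOscillator f (hermiteFunction β) =
      (hermiteEigenvalue β : ℂ) * f (hermiteFunction β) := by
  set A : 𝓢(Rn d, ℂ) := -Δ (hermiteFunction β) +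
    SchwartzMap.smulLeftCLM ℂ (fun x : Rn d => ((‖x‖ ^ 2 : ℝ) : ℂ)) (hermiteFunction β) with hA
  have hdual : ∀ f : 𝓢'(Rn d, ℂ), harmonicOscillator f (hermiteFunction β) = f A := by
    intro f
    rw [hA, map_add, map_neg, ← TemperedDistribution.laplacian_apply_apply,
      ← TemperedDistribution.smulLeftCLM_apply_apply]
    rfl
  have hsymm : ∀ u v : 𝓢(Rn d, ℂ), ofSchwartz u v = ofSchwartz v u := fun u v => by
    simp_rw [ofSchwartz_apply, mul_comm]
  have hA' : A - (hermiteEigenvalue β : ℂ) • hermiteFunction β = 0 := by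
    refine ofSchwartz_injective (eq_zero_of_hermiteFunction fun α => ?_)
    rw [hsymm, map_sub, map_smul]
    change hermiteDistribution α A - _ • hermiteDistribution α _ = 0
    rw [← hdual, harmonicOscillator_hermiteDistribution]
    change (hermiteEigenvalue α : ℂ) • hermiteDistribution α (hermiteFunction β) - _ = 0
    rw [hermiteDistribution_hermiteFunction]
    split_ifs with h
    · rw [h, sub_self]
    · simp
  rw [hdual, sub_eq_zero.1 hA', map_smul, smul_eq_mul]

/-- All but finitely many terms are at most 1, and for those a ≤ a^r because r ≤ 1. -/
theorem summable_of_summable_rpow {ι : Type*} {a : ι → ℝ} (ha : ∀ i, 0 ≤ a i) {r : ℝ} (hr : 0 < r)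
    (hr1 : r ≤ 1) (h : Summable fun i => a i ^ r) : Summable a := by
  refine h.of_norm_bounded_eventually ?_
  filter_upwards [h.tendsto_cofinite_zero.eventually (gt_mem_nhds one_pos)] with i hi
  have h1 : a i ≤ 1 := by
    by_contra! hlt
    exact absurd (Real.one_le_rpow hlt.le hr.le) (not_le.2 hi)
  rw [Real.norm_of_nonneg (ha i)]
  calc a i = a i ^ (1 : ℝ) := (Real.rpow_one _).symm
    _ ≤ a i ^ r := Real.rpow_le_rpow_of_exponent_ge' (ha i) h1 hr.le hr1

theorem exists_hasSum_rank_one {B ι : Type*} [SeminormedAddCommGroup B] [NormedSpace ℂ B]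
    [CompleteSpace B] {x : ι → B →L[ℂ] ℂ} {y : ι → B} (h : Summable fun i => ‖x i‖ * ‖y i‖) :
    ∃ T : B →L[ℂ] B, ∀ z, HasSum (fun i => x i z • y i) (T z) := by
  have hsum : Summable fun i => (x i).smulRight (y i) := by
    refine Summable.of_norm ?_
    simp only [ContinuousLinearMap.norm_smulRight_apply]
    exact h
  obtain ⟨T, hT⟩ := hsum
  refine ⟨T, fun z => ?_⟩
  have := (ContinuousLinearMap.apply ℂ B z).hasSum hT
  exact this

theorem exists_isNuclearRepresentation_of_countable {B ι : Type*} [SeminormedAddCommGroup B]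
    [NormedSpace ℂ B] [Countable ι] {r : ℝ} (hr : 0 < r) {T : B →L[ℂ] B} {x : ι → B →L[ℂ] ℂ}
    {y : ι → B} (hs : Summable fun i => ‖x i‖ ^ r * ‖y i‖ ^ r)
    (hT : ∀ z, HasSum (fun i => x i z • y i) (T z)) :
    ∃ (x' : ℕ → B →L[ℂ] ℂ) (y' : ℕ → B), IsNuclearRepresentation r T x' y' ∧
      ∑' n, x' n (y' n) = ∑' i, x i (y i) := by
  -- An injection with extension by zero, not a bijection: the index set may be finite, as Fin d → ℕ
  -- is for d = 0.
  obtain ⟨e, he⟩ := exists_injective_nat ι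
  have hx : ∀ n ∉ Set.range e, Function.extend e x 0 n = 0 := fun n hn =>
    Function.extend_apply' _ _ _ hn
  refine ⟨Function.extend e x 0, Function.extend e y 0, ⟨?_, fun z => ?_⟩, ?_⟩
  · refine (he.summable_iff fun n hn => ?_).1 ?_
    · rw [hx n hn, norm_zero, Real.zero_rpow hr.ne', zero_mul]
    · simpa only [Function.comp_def, he.extend_apply] using hs
  · refine (he.hasSum_iff fun n hn => ?_).1 ?_
    · rw [hx n hn, zero_apply, zero_smul]
    · simpa only [Function.comp_def, he.extend_apply] using hT z
  · rw [← he.tsum_eq]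
    · simp only [he.extend_apply]
    · refine Function.support_subset_iff'.2 fun n hn => ?_
      rw [hx n hn, zero_apply]

/-! ### Existence, uniqueness and trace of F(A) on modulation spaces -/

namespace ModulationSpace

variable {g : 𝓢(Rn d, ℂ)} {p q : ℝ≥0∞} [hp : Fact (1 ≤ p)] [hq : Fact (1 ≤ q)] {s : ℝ}

theorem eq_of_hermiteFunction {f₁ f₂ : ModulationSpace g p q s}
    (h : ∀ β, toDistribution f₁ (hermiteFunction β) = toDistribution f₂ (hermiteFunction β)) :
    f₁ = f₂ := by
  refine toDistribution_injective (sub_eq_zero.1 (eq_zero_of_hermiteFunction fun β => ?_))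
  change toDistribution f₁ (hermiteFunction β) - toDistribution f₂ (hermiteFunction β) = 0
  rw [h, sub_self]

/-- Pairing the eigenvalue equation with φ_β gives (λ - λ_β) ⟨f, φ_β⟩ = 0. So each coefficient is
zero or belongs to λ_β = λ, and the diagonal action agrees with multiplication by F(λ) on every
eigenvector, not only on the φ_α. -/
theorem isFunctionOfOscillator_of_apply_hermiteFunction {F : ℝ → ℂ}
    {T : ModulationSpace g p q s →L[ℂ] ModulationSpace g p q s}
    (hT : ∀ f β, toDistribution (T f) (hermiteFunction β) =
      F (hermiteEigenvalue β) * toDistribution f (hermiteFunction β)) :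
    IsFunctionOfOscillator F T := by
  intro lam f hf
  refine eq_of_hermiteFunction fun β => ?_
  have h1 := harmonicOscillator_apply_hermiteFunction (toDistribution f) β
  rw [hf] at h1
  change (lam : ℂ) * toDistribution f (hermiteFunction β) = _ at h1
  rw [hT, map_smul]
  change _ = F lam * toDistribution f (hermiteFunction β)
  rcases mul_eq_mul_right_iff.1 h1 with h2 | h2
  · rw [Complex.ofReal_injective h2]
  · rw [h2, mul_zero, mul_zero]

theorem isFunctionOfOscillator_unique (hg : g ≠ 0) (hpt : p ≠ ⊤) (hqt : q ≠ ⊤) {F : ℝ → ℂ}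
    {T₁ T₂ : ModulationSpace g p q s →L[ℂ] ModulationSpace g p q s}
    (h₁ : IsFunctionOfOscillator F T₁) (h₂ : IsFunctionOfOscillator F T₂) : T₁ = T₂ := by
  suffices h : T₁ - T₂ = 0 from sub_eq_zero.1 h
  refine eq_zero_of_schwartzCLM hg hpt hqt fun u => ?_
  have hzero : ∀ α, (T₁ - T₂) (schwartzCLM g p q s (hermiteFunction α)) = 0 := fun α => by
    have heig : harmonicOscillator
        (toDistribution (schwartzCLM g p q s (hermiteFunction α))) =
          (hermiteEigenvalue α : ℂ) • toDistribution (schwartzCLM g p q s (hermiteFunction α)) :=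
      harmonicOscillator_hermiteDistribution α
    rw [sub_apply, h₁ _ _ heig, h₂ _ _ heig, sub_self]
  refine eq_of_hermiteFunction fun β => ?_
  -- For fixed β, the β-th Hermite coefficient of (T₁ - T₂) u is a tempered distribution in u. It
  -- vanishes on all Hermite functions, hence identically; no convergence of Hermite expansions in
  -- the modulation norm is needed.
  let f : 𝓢'(Rn d, ℂ) := ContinuousLinearMap.toPointwiseConvergenceCLM _ _ _ _
    ((evalCLM hg (hermiteFunction β)).comp ((T₁ - T₂).comp (schwartzCLM g p q s)))
  have hf : f = 0 := eq_zero_of_hermiteFunction fun α => by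
    change evalCLM hg (hermiteFunction β)
      ((T₁ - T₂) (schwartzCLM g p q s (hermiteFunction α))) = 0
    rw [hzero, map_zero]
  change f u = _
  rw [hf, map_zero]
  rfl

/-- The functionals `F(λ_α) ⟨·, φ_α⟩` of the Hermite expansion of `F(A)`. -/
def hermiteFunctional (hg : g ≠ 0) (F : ℝ → ℂ) (α : Fin d → ℕ) : ModulationSpace g p q s →L[ℂ] ℂ :=
  F (hermiteEigenvalue α) • evalCLM hg (hermiteFunction α)

theorem hermiteFunctional_apply (hg : g ≠ 0) (F : ℝ → ℂ) (α : Fin d → ℕ)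
    (f : ModulationSpace g p q s) : hermiteFunctional hg F α f =
      F (hermiteEigenvalue α) * toDistribution f (hermiteFunction α) := rfl

/-- The diagonal terms of the Hermite representation. They give the value of the trace and, through
|x'(y)| ≤ ‖x'‖ ‖y‖, the absolute convergence of its series. -/
theorem hermiteFunctional_schwartzCLM (hg : g ≠ 0) (F : ℝ → ℂ) (α : Fin d → ℕ) :
    hermiteFunctional hg F α (schwartzCLM g p q s (hermiteFunction α)) =
      F (hermiteEigenvalue α) := by
  rw [hermiteFunctional_apply, toDistribution_schwartzCLM]
  change _ * hermiteDistribution α (hermiteFunction α) = _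
  rw [hermiteDistribution_hermiteFunction, if_pos rfl, mul_one]

/-- The duality estimate bounds the functional by c⁻¹ times the dual norm of the conjugate of φ_α,
which is φ_α itself because Hermite functions are real. The constant only contributes the factor
c^{-r}. -/
theorem summable_norm_hermiteFunctional (hg : g ≠ 0) {F : ℝ → ℂ} {r : ℝ} (hr : 0 < r)
    (h : hermiteSeries g p q s F r < ⊤) :
    Summable fun α : Fin d → ℕ => ‖(hermiteFunctional hg F α : ModulationSpace g p q s →L[ℂ] ℂ)‖ ^ r *
      ‖schwartzCLM g p q s (hermiteFunction α)‖ ^ r := by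
  have h1 := ENNReal.summable_toReal h.ne
  have hc := (inv_pos.2 (inversionConst_pos hg)).le
  refine Summable.of_nonneg_of_le (fun α => by positivity) (fun α => ?_)
    (h1.mul_left ((inversionConst g)⁻¹ ^ r))
  simp only [ENNReal.toReal_mul, ← ENNReal.toReal_rpow, toReal_enorm]
  have h2 : dualNorm g p q s (hermiteFunction α) =
      (modNorm g p.conjExponent q.conjExponent (-s) (hermiteDistribution α)).toReal := by
    rw [dualNorm, conjSchwartz_hermiteFunction]
    rfl
  have h3 : ‖schwartzCLM g p q s (hermiteFunction α)‖ =
      (modNorm g p q s (hermiteDistribution α)).toReal := rfl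
  have h4 : ‖(hermiteFunctional hg F α : ModulationSpace g p q s →L[ℂ] ℂ)‖ ≤
      ‖F (hermiteEigenvalue α)‖ * ((inversionConst g)⁻¹ *
        (modNorm g p.conjExponent q.conjExponent (-s) (hermiteDistribution α)).toReal) := by
    rw [hermiteFunctional, norm_smul, ← h2]
    gcongr
    exact norm_evalCLM_le hg _
  rw [h3]
  refine (mul_le_mul_of_nonneg_right (Real.rpow_le_rpow (norm_nonneg _) h4 hr.le)
    (by positivity)).trans (le_of_eq ?_)
  rw [Real.mul_rpow (norm_nonneg _) (by positivity), Real.mul_rpow hc (by positivity)]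
  ring

/-- The Hermite expansion of `F(A)`. -/
theorem exists_hasSum_hermite (hg : g ≠ 0) (hpt : p ≠ ⊤) (hqt : q ≠ ⊤) {F : ℝ → ℂ}
    (h : Summable fun α : Fin d → ℕ =>
      ‖(hermiteFunctional hg F α : ModulationSpace g p q s →L[ℂ] ℂ)‖ *
      ‖schwartzCLM g p q s (hermiteFunction α)‖) :
    ∃ T : ModulationSpace g p q s →L[ℂ] ModulationSpace g p q s, IsFunctionOfOscillator F T ∧
      ∀ f, HasSum (fun α => hermiteFunctional hg F α f • schwartzCLM g p q s (hermiteFunction α))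
        (T f) := by
  have := completeSpace (g := g) (p := p) (q := q) (s := s) hg hpt hqt
  obtain ⟨T, hT'⟩ := exists_hasSum_rank_one h
  refine ⟨T, isFunctionOfOscillator_of_apply_hermiteFunction fun f β => ?_, hT'⟩
  have h1 := (evalCLM hg (hermiteFunction β)).hasSum (hT' f)
  refine h1.unique ?_
  convert hasSum_single β fun α hα => ?_ using 1
  · simp only [map_smul, smul_eq_mul, evalCLM_apply, toDistribution_schwartzCLM]
    change _ = _ * hermiteDistribution β (hermiteFunction β)
    rw [hermiteDistribution_hermiteFunction, if_pos rfl, mul_one, hermiteFunctional_apply]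
  · simp only [map_smul, smul_eq_mul, evalCLM_apply, toDistribution_schwartzCLM]
    change _ * hermiteDistribution α (hermiteFunction β) = 0
    rw [hermiteDistribution_hermiteFunction, if_neg hα, mul_zero]

theorem hasNuclearTrace_of_representation (hg : g ≠ 0) (hpt : p ≠ ⊤) (hqt : q ≠ ⊤)
    {T : ModulationSpace g p q s →L[ℂ] ModulationSpace g p q s}
    {x : ℕ → ModulationSpace g p q s →L[ℂ] ℂ} {y : ℕ → ModulationSpace g p q s}
    (h : IsNuclearRepresentation 1 T x y) : HasNuclearTrace T (∑' n, x n (y n)) := by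
  refine ⟨⟨x, y, h⟩, fun x' y' h' => ?_⟩
  rw [trace_unique hg hpt hqt h h']
  have h1 := h'.1
  simp only [Real.rpow_one] at h1
  exact (Summable.of_norm_bounded h1 fun n => (x' n).le_opNorm (y' n)).hasSum

/-- A single representation serves both parts: it exhibits r-nuclearity, and for r = 1 its diagonal
sum is the trace. -/
theorem exists_hermite_representation (hg : g ≠ 0) (hpt : p ≠ ⊤) (hqt : q ≠ ⊤) {F : ℝ → ℂ} {r : ℝ}
    (hr : 0 < r) (hr1 : r ≤ 1) (h : hermiteSeries g p q s F r < ⊤) :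
    ∃ T : ModulationSpace g p q s →L[ℂ] ModulationSpace g p q s, IsFunctionOfOscillator F T ∧
      ∃ x y, IsNuclearRepresentation r T x y ∧
        ∑' n, x n (y n) = ∑' α : Fin d → ℕ, F (hermiteEigenvalue α) := by
  have h1 := summable_norm_hermiteFunctional hg hr h
  have h2 := h1
  simp_rw [← Real.mul_rpow (norm_nonneg _) (norm_nonneg _)] at h2
  obtain ⟨T, hT, hTs⟩ := exists_hasSum_hermite hg hpt hqt
    (summable_of_summable_rpow (fun α => by positivity) hr hr1 h2)
  obtain ⟨x, y, hxy, ht⟩ := exists_isNuclearRepresentation_of_countable hr h1 hTs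
  simp_rw [hermiteFunctional_schwartzCLM] at ht
  exact ⟨T, hT, x, y, hxy, ht⟩

theorem summable_norm_apply_hermiteEigenvalue (hg : g ≠ 0) {F : ℝ → ℂ}
    (h : hermiteSeries g p q s F 1 < ⊤) :
    Summable fun α : Fin d → ℕ => ‖F (hermiteEigenvalue α)‖ := by
  have h1 := summable_norm_hermiteFunctional hg one_pos h
  simp only [Real.rpow_one] at h1
  refine h1.of_nonneg_of_le (fun α => norm_nonneg _) fun α => ?_
  rw [← hermiteFunctional_schwartzCLM (p := p) (q := q) (s := s) hg F α]
  exact ContinuousLinearMap.le_opNorm _ _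

end ModulationSpace
end HarmonicModulation
end

/-! ### The main theorem -/

theorem theorem2p5 (d : ℕ) (p q : ℝ≥0∞) [Fact (1 ≤ p)] [Fact (1 ≤ q)] (hp : p ≠ ⊤) (hq : q ≠ ⊤)
    (s : ℝ) (g : 𝓢(HarmonicModulation.Rn d, ℂ)) (hg : g ≠ 0) (F : ℝ → ℂ) :
    (∀ r : ℝ, 0 < r → r ≤ 1 → HarmonicModulation.hermiteSeries g p q s F r < ⊤ →
      (∃! T : HarmonicModulation.ModulationSpace g p q s →L[ℂ]
          HarmonicModulation.ModulationSpace g p q s,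
        HarmonicModulation.IsFunctionOfOscillator F T) ∧
      ∀ T : HarmonicModulation.ModulationSpace g p q s →L[ℂ]
          HarmonicModulation.ModulationSpace g p q s,
        HarmonicModulation.IsFunctionOfOscillator F T → HarmonicModulation.IsRNuclear r T) ∧
    (HarmonicModulation.hermiteSeries g p q s F 1 < ⊤ →
      Summable (fun α : Fin d → ℕ => ‖F (HarmonicModulation.hermiteEigenvalue α)‖) ∧
      ∀ T : HarmonicModulation.ModulationSpace g p q s →L[ℂ]
          HarmonicModulation.ModulationSpace g p q s,
        HarmonicModulation.IsFunctionOfOscillator F T →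
        HarmonicModulation.HasNuclearTrace T
          (∑' α : Fin d → ℕ, F (HarmonicModulation.hermiteEigenvalue α))) := by
  refine ⟨fun r hr hr1 h => ?_, fun h =>
    ⟨HarmonicModulation.ModulationSpace.summable_norm_apply_hermiteEigenvalue hg h,
      fun T hT => ?_⟩⟩
  · obtain ⟨T, hT, x, y, hxy, -⟩ :=
      HarmonicModulation.ModulationSpace.exists_hermite_representation hg hp hq hr hr1 h
    have hu : ∀ T', HarmonicModulation.IsFunctionOfOscillator F T' → T' = T := fun T' hT' =>
      HarmonicModulation.ModulationSpace.isFunctionOfOscillator_unique hg hp hq hT' hT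
    exact ⟨⟨T, hT, hu⟩, fun T' hT' => hu T' hT' ▸ ⟨x, y, hxy⟩⟩
  · obtain ⟨T', hT', x, y, hxy, ht⟩ :=
      HarmonicModulation.ModulationSpace.exists_hermite_representation hg hp hq one_pos le_rfl h
    rw [HarmonicModulation.ModulationSpace.isFunctionOfOscillator_unique hg hp hq hT hT', ← ht]
    exact HarmonicModulation.ModulationSpace.hasNuclearTrace_of_representation hg hp hq hxy
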